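/- Let $r\ge 2$ and $0\le k\le r-2$ be integers, let $T,\varepsilon,\mu,\beta>0$, let $b\in C^2[0,1]$, and put $\eta_b=1-\beta b$, where $\eta_b>0$ on $[0,1]$. Write $(\cdot,\cdot)$ and $\|\cdot\|$ for the inner product and norm of $L^2(0,1)$, $\|\cdot\|_1$ for the norm of $H^1(0,1)$, and $a(v,w)=(v,w)+\frac{\mu}{3}(v',w')$. Let $(\zeta,u)$ be a solution of $$\zeta_t+(\eta u)_x=0,\qquad u_t+\zeta_x+\varepsilon uu_x-\tfrac{\mu}{3}u_{xxt}=0,\qquad (x,t)\in[0,1]\times[0,T],$$ $$\zeta(x,0)=\zeta_0(x),\quad u(x,0)=u_0(x)\quad(0\le x\le1),\qquad u(0,t)=u(1,t)=0\quad(0\le t\le T),$$ where $\eta=\varepsilon\zeta+\eta_b>0$, which is smooth in the sense that $\zeta\in C([0,T];C^r[0,1])\cap C^1([0,T];C^0[0,1])$ and $u\in C([0,T];C^r[0,1])\cap C^1([0,T];C^2[0,1])$. For a partition $0=x_1<x_2<\dots<x_{N+1}=1$ with $h=\max_i(x_{i+1}-x_i)$, let $S_h$ be the space of all $\phi\in C^k[0,1]$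 whose restriction to each $[x_i,x_{i+1}]$ is a polynomial of degree at most $r-1$, and let $S_{h,0}=\{\phi\in S_h:\phi(0)=\phi(1)=0\}$. Let $P$ be the $L^2$-projection onto $S_h$, and let the elliptic projection $\widetilde R_hv\in S_{h,0}$ of $v\in H^1_0(0,1)$ be defined by $a(\widetilde R_hv,\chi)=a(v,\chi)$ for all $\chi\in S_{h,0}$. The semidiscrete problem is to find $\zeta_h:[0,T]\to S_h$ and $u_h:[0,T]\to S_{h,0}$, differentiable in $t$, such that for $0\le t\le T$ $$(\zeta_{ht},\phi)+\varepsilon\big((\zeta_hu_h)_x,\phi\big)+\big((\eta_bu_h)_x,\phi\big)=0\quad\forall\phi\in S_h,$$ $$a(u_{ht},\chi)+(\zeta_{hx},\chi)+\varepsilon(u_hu_{hx},\chi)=0\quad\forall\chi\in S_{h,0},$$ $$\zeta_h(0)=P\zeta_0,\qquad u_h(0)=\widetilde R_hu_0 .$$ Then for every $\gamma$ there are $h_0>0$ and $C$ such that, for every partition that is quasiuniform with constant $\gamma$ (that is, $h\le\gamma\min_i(x_{i+1}-x_i)$) and has $h\le h_0$, the semidiscrete problem has a unique solution $(\zeta_h,u_h)$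 on $[0,T]$, and it satisfies $$\max_{0\le t\le T}\big(\|\zeta(t)-\zeta_h(t)\|+\|u(t)-u_h(t)\|_1\big)\le C\,h^{r-1}.$$ Here $h_0$ and $C$ do not depend on the partition; in particular $C$ is independent of $h$. -/

import Mathlib

open Set

namespace CBw

noncomputable section

/-! Functions of space are maps `ℝ → ℝ` of which only the values on `[0,1]` matter; functions of
time and space are maps `w : ℝ → ℝ → ℝ`, `w t x`, of which only the values for
`(t, x) ∈ [0,T] × [0,1]` matter. -/

/-- The spatial derivative on `[0,1]` (one-sided at the endpoints). -/
def dx (f : ℝ → ℝ) (x : ℝ) : ℝ := derivWithin f (Icc 0 1) x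

/-- The time derivative on `[0,T]` (one-sided at the endpoints), at a fixed point of space. -/
def dt (T : ℝ) (w : ℝ → ℝ → ℝ) (t x : ℝ) : ℝ := derivWithin (fun s => w s x) (Icc 0 T) t

/-- The inner product of `L²(0,1)`. -/
def ip (f g : ℝ → ℝ) : ℝ := ∫ x in (0 : ℝ)..1, f x * g x

/-- The norm of `L²(0,1)`. -/
def normL2 (f : ℝ → ℝ) : ℝ := Real.sqrt (ip f f)

/-- The norm of `H¹(0,1)`. It is applied to continuous, piecewise `C¹` functions only, for which
the classical derivative, defined almost everywhere, is the weak derivative. -/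
def normH1 (f : ℝ → ℝ) : ℝ := Real.sqrt (ip f f + ip (dx f) (dx f))

/-- The weighted `H¹` inner product `a(v,w) = (v,w) + (μ/3)(v',w')`. -/
def a (μ : ℝ) (v w : ℝ → ℝ) : ℝ := ip v w + μ / 3 * ip (dx v) (dx w)

/-! ### The initial-boundary-value problem -/

/-- The undisturbed water depth `η_b = 1 - β b`. -/
def etab (β : ℝ) (b : ℝ → ℝ) (x : ℝ) : ℝ := 1 - β * b x

/-- `w ∈ C([0,T]; C^m[0,1])`: the spatial derivatives of order at most `m` exist and are
continuous on `[0,T] × [0,1]`. -/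
def ContCm (T : ℝ) (m : ℕ) (w : ℝ → ℝ → ℝ) : Prop :=
  (∀ t ∈ Icc 0 T, ContDiffOn ℝ m (w t) (Icc 0 1)) ∧
  ∀ j ≤ m, ContinuousOn (fun p : ℝ × ℝ => iteratedDerivWithin j (w p.1) (Icc 0 1) p.2)
    (Icc 0 T ×ˢ Icc 0 1)

/-- `w` is differentiable with respect to time on `[0,T]`, at every point of `[0,1]`. -/
def TimeDiff (T : ℝ) (w : ℝ → ℝ → ℝ) : Prop :=
  ∀ x ∈ Icc (0 : ℝ) 1, DifferentiableOn ℝ (fun t => w t x) (Icc 0 T)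

/-- The smoothness of the solution of the ibvp:
`ζ ∈ C([0,T]; C^r) ∩ C¹([0,T]; C⁰)` and `u ∈ C([0,T]; C^r) ∩ C¹([0,T]; C²)`. -/
structure IsSmooth (r : ℕ) (T : ℝ) (ζ u : ℝ → ℝ → ℝ) : Prop where
  zeta_space : ContCm T r ζ
  zeta_timeDiff : TimeDiff T ζ
  zeta_time : ContCm T 0 (dt T ζ)
  u_space : ContCm T r u
  u_timeDiff : TimeDiff T u
  u_time : ContCm T 2 (dt T u)

/-- `(ζ, u)` solves the ibvp for the system with weakly varying bottom on `[0,1] × [0,T]`. -/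
structure IsSolution (ε μ β : ℝ) (b : ℝ → ℝ) (T : ℝ) (ζ₀ u₀ : ℝ → ℝ)
    (ζ u : ℝ → ℝ → ℝ) : Prop where
  /-- the water depth `η = ε ζ + η_b` is positive -/
  depth_pos : ∀ t ∈ Icc 0 T, ∀ x ∈ Icc (0 : ℝ) 1, 0 < ε * ζ t x + etab β b x
  /-- `ζ_t + (η u)_x = 0` -/
  mass : ∀ t ∈ Icc 0 T, ∀ x ∈ Icc (0 : ℝ) 1,
    dt T ζ t x + dx (fun y => (ε * ζ t y + etab β b y) * u t y) x = 0
  /-- `u_t + ζ_x + ε u u_x - (μ/3) u_{xxt} = 0` -/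
  momentum : ∀ t ∈ Icc 0 T, ∀ x ∈ Icc (0 : ℝ) 1,
    dt T u t x + dx (ζ t) x + ε * (u t x * dx (u t) x) - μ / 3 * dx (dx (dt T u t)) x = 0
  zeta_init : ∀ x ∈ Icc (0 : ℝ) 1, ζ 0 x = ζ₀ x
  u_init : ∀ x ∈ Icc (0 : ℝ) 1, u 0 x = u₀ x
  u_left : ∀ t ∈ Icc 0 T, u t 0 = 0
  u_right : ∀ t ∈ Icc 0 T, u t 1 = 0

/-! ### The finite element spaces -/

/-- A partition `0 = x₀ < x₁ < ⋯ < x_N = 1` of `[0,1]`. -/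
structure Mesh where
  N : ℕ
  x : Fin (N + 1) → ℝ
  strictMono : StrictMono x
  first : x 0 = 0
  last : x (Fin.last N) = 1

/-- The meshlength `h = max_i (x_{i+1} - x_i)`. -/
def Mesh.h (M : Mesh) : ℝ := ⨆ i : Fin M.N, (M.x i.succ - M.x i.castSucc)

/-- Quasiuniformity with constant `γ`: `h ≤ γ min_i (x_{i+1} - x_i)`. -/
def Mesh.Quasiuniform (γ : ℝ) (M : Mesh) : Prop :=
  ∀ i : Fin M.N, M.h ≤ γ * (M.x i.succ - M.x i.castSucc)

/-- `φ ∈ S_h`: `φ ∈ C^k[0,1]`, and `φ` is a polynomial of degree at most `r - 1` on every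
subinterval of the mesh. -/
def MemSh (r k : ℕ) (M : Mesh) (φ : ℝ → ℝ) : Prop :=
  ContDiffOn ℝ k φ (Icc 0 1) ∧
  ∀ i : Fin M.N, ∃ p : Polynomial ℝ, p.natDegree ≤ r - 1 ∧
    ∀ y ∈ Icc (M.x i.castSucc) (M.x i.succ), φ y = p.eval y

/-- `φ ∈ S_{h,0}`: `φ ∈ S_h` and `φ(0) = φ(1) = 0`. -/
def MemSh0 (r k : ℕ) (M : Mesh) (φ : ℝ → ℝ) : Prop :=
  MemSh r k M φ ∧ φ 0 = 0 ∧ φ 1 = 0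

/-- `w` is the `L²` projection of `v` onto `S_h`. -/
def IsL2Proj (r k : ℕ) (M : Mesh) (v w : ℝ → ℝ) : Prop :=
  MemSh r k M w ∧ ∀ φ, MemSh r k M φ → ip w φ = ip v φ

/-- `w` is the elliptic projection of `v` onto `S_{h,0}` associated with `a`. -/
def IsEllProj (μ : ℝ) (r k : ℕ) (M : Mesh) (v w : ℝ → ℝ) : Prop :=
  MemSh0 r k M w ∧ ∀ χ, MemSh0 r k M χ → a μ w χ = a μ v χ

/-- `(ζh, uh)` solves the standard Galerkin semidiscretization on `[0,T]`. As `S_h` is a space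
of functions on `[0,1]` of finite dimension, differentiability in time with values in `S_h` is
differentiability in time at every point of `[0,1]`. -/
structure IsSemidiscrete (ε μ β : ℝ) (b : ℝ → ℝ) (T : ℝ) (ζ₀ u₀ : ℝ → ℝ) (r k : ℕ) (M : Mesh)
    (ζh uh : ℝ → ℝ → ℝ) : Prop where
  zeta_mem : ∀ t ∈ Icc 0 T, MemSh r k M (ζh t)
  u_mem : ∀ t ∈ Icc 0 T, MemSh0 r k M (uh t)
  zeta_timeDiff : TimeDiff T ζh
  u_timeDiff : TimeDiff T uh
  /-- `(ζ_{ht}, φ) + ε ((ζ_h u_h)_x, φ) + ((η_b u_h)_x, φ) = 0` for all `φ ∈ S_h` -/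
  mass : ∀ t ∈ Icc 0 T, ∀ φ, MemSh r k M φ →
    ip (dt T ζh t) φ + ε * ip (dx (fun x => ζh t x * uh t x)) φ
      + ip (dx (fun x => etab β b x * uh t x)) φ = 0
  /-- `a(u_{ht}, χ) + (ζ_{hx}, χ) + ε (u_h u_{hx}, χ) = 0` for all `χ ∈ S_{h,0}` -/
  momentum : ∀ t ∈ Icc 0 T, ∀ χ, MemSh0 r k M χ →
    a μ (dt T uh t) χ + ip (dx (ζh t)) χ + ε * ip (fun x => uh t x * dx (uh t) x) χ = 0
  zeta_init : IsL2Proj r k M ζ₀ (ζh 0)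
  u_init : IsEllProj μ r k M u₀ (uh 0)

end

end CBw

/-! The proof is an energy argument closed by a bootstrap. Put `z = Pζ` and let `v` be the elliptic
projection of `u`; write `ρ = ζ - z`, `θ = z - ζh`, `σ = u - v`, `ξ = v - uh`. Projection commutes
with `∂t`, so testing the difference of the exact and discrete equations with `θ` and `ξ` removes
`ρ_t` and `σ_t` and leaves an expression for the derivative of `G = ‖θ‖² + a(ξ,ξ)`, with `G(0) = 0`
by the choice of initial data.

Two terms of that expression are delicate. In `((ρ uh)_x, θ)` the derivative is moved onto `θ`; the
inverse inequality then costs a factor `h⁻¹` against `‖ρ‖ = O(h^r)`, and this is why the rate is `r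
- 1`. In `((θ uh)_x, θ)` integration by parts leaves `½ (uh_x θ, θ)`, which needs a bound on `uh_x`
in the maximum norm. No boundary terms appear, since `uh` and `ξ` vanish at the endpoints. This is
`energy_static`, and `exists_energy_rate` turns it into `G' ≤ Q (G + h^(2(r-1)))`.

The bound on `uh_x` is not available beforehand, but an inverse inequality provides it while `a(ξ,ξ)
≤ h` (`exists_lip_bound`). Under this assumption Grönwall gives `G ≤ K h^(2(r-1))`, and since `r ≥
2` the right side is strictly below `h` for small `h`. By continuity (`barrier`) the assumption
never fails; see `exists_energy_bound`.

The same estimate holds for any solution on a shorter interval, so it also excludes blow-up of the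
ordinary differential equation satisfied by the coordinates. That gives existence on all of `[0,T]`;
uniqueness is local Lipschitz continuity. Finally `ζ - ζh = ρ + θ` and `u - uh = σ + ξ` are
orthogonal sums, so only the projection errors remain. They are bounded by best approximation with
smoothest splines, which are constructed here by induction on the degree. -/

namespace CBw

open MeasureTheory

/-! ### Integration and differentiation of Lipschitz functions on `[0,1]`. -/

/-- Lebesgue measure on `(0,1)`. -/
noncomputable abbrev mI : Measure ℝ := volume.restrict (Ioo 0 1)

/-- `f` is Lipschitz on `[0,1]` with constant `K`. -/
def LipC (K : ℝ) (f : ℝ → ℝ) : Prop :=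
  ∀ x ∈ Icc (0 : ℝ) 1, ∀ y ∈ Icc (0 : ℝ) 1, |f x - f y| ≤ K * |x - y|

/-- `f` is Lipschitz on `[0,1]`. -/
def Lip (f : ℝ → ℝ) : Prop := ∃ K, LipC K f

/-- `f` is bounded and measurable on `(0,1)`. -/
def BM (f : ℝ → ℝ) : Prop :=
  AEStronglyMeasurable f mI ∧ ∃ C, ∀ x ∈ Ioo (0 : ℝ) 1, |f x| ≤ C

theorem ip_eq (f g : ℝ → ℝ) : ip f g = ∫ x, f x * g x ∂mI := by
  rw [ip, intervalIntegral.integral_of_le zero_le_one, integral_Ioc_eq_integral_Ioo]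

theorem ip_comm (f g : ℝ → ℝ) : ip f g = ip g f := by
  simp only [ip, mul_comm]

namespace BM

variable {f g : ℝ → ℝ}

theorem add (hf : BM f) (hg : BM g) : BM (fun x => f x + g x) := by
  obtain ⟨hf, C, hC⟩ := hf
  obtain ⟨hg, D, hD⟩ := hg
  exact ⟨hf.add hg, C + D, fun x hx => (abs_add_le _ _).trans (add_le_add (hC x hx) (hD x hx))⟩

theorem mul (hf : BM f) (hg : BM g) : BM (fun x => f x * g x) := by
  obtain ⟨hf, C, hC⟩ := hf
  obtain ⟨hg, D, hD⟩ := hg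
  refine ⟨hf.mul hg, C * D, fun x hx => ?_⟩
  rw [abs_mul]
  exact mul_le_mul (hC x hx) (hD x hx) (abs_nonneg _) ((abs_nonneg _).trans (hC x hx))

theorem const (c : ℝ) : BM (fun _ => c) := ⟨aestronglyMeasurable_const, |c|, fun _ _ => le_rfl⟩

theorem const_mul (c : ℝ) (hf : BM f) : BM (fun x => c * f x) := (const c).mul hf

theorem neg (hf : BM f) : BM (fun x => -f x) := by
  simpa using hf.const_mul (-1)

theorem sub (hf : BM f) (hg : BM g) : BM (fun x => f x - g x) := by
  simpa [sub_eq_add_neg] using hf.add (hg.const_mul (-1))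

theorem integrable (hf : BM f) : Integrable f mI := by
  obtain ⟨hf, C, hC⟩ := hf
  have : IsFiniteMeasure mI := ⟨by simp [mI]⟩
  refine Integrable.of_bound hf C ?_
  filter_upwards [ae_restrict_mem measurableSet_Ioo] with x hx using hC x hx

end BM

theorem ContinuousOn.bm {f : ℝ → ℝ} (hf : ContinuousOn f (Icc 0 1)) : BM f := by
  refine ⟨(hf.mono Ioo_subset_Icc_self).aestronglyMeasurable measurableSet_Ioo, ?_⟩
  obtain ⟨C, hC⟩ := isCompact_Icc.exists_bound_of_continuousOn hf
  exact ⟨C, fun x hx => hC x (Ioo_subset_Icc_self hx)⟩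

section ip

variable {f g h : ℝ → ℝ}

theorem ip_add_left (hf : BM f) (hg : BM g) (hh : BM h) :
    ip (fun x => f x + g x) h = ip f h + ip g h := by
  simp only [ip_eq, add_mul]
  exact integral_add (hf.mul hh).integrable (hg.mul hh).integrable

theorem ip_sub_left (hf : BM f) (hg : BM g) (hh : BM h) :
    ip (fun x => f x - g x) h = ip f h - ip g h := by
  simp only [ip_eq, sub_mul]
  exact integral_sub (hf.mul hh).integrable (hg.mul hh).integrable

theorem ip_smul_left (c : ℝ) : ip (fun x => c * f x) h = c * ip f h := by
  simp only [ip_eq, mul_assoc]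
  exact integral_const_mul _ _

theorem ip_add_right (hf : BM f) (hg : BM g) (hh : BM h) :
    ip h (fun x => f x + g x) = ip h f + ip h g := by
  rw [ip_comm, ip_add_left hf hg hh, ip_comm f, ip_comm g]

theorem ip_smul_right (c : ℝ) : ip h (fun x => c * f x) = c * ip h f := by
  rw [ip_comm, ip_smul_left, ip_comm]

theorem ip_congr_ae {f' g' : ℝ → ℝ} (hf : f =ᵐ[mI] f') (hg : g =ᵐ[mI] g') :
    ip f g = ip f' g' := by
  rw [ip_eq, ip_eq]
  apply integral_congr_ae
  filter_upwards [hf, hg] with x h1 h2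
  rw [h1, h2]

theorem ip_congr {f' g' : ℝ → ℝ} (hf : EqOn f f' (Ioo 0 1)) (hg : EqOn g g' (Ioo 0 1)) :
    ip f g = ip f' g' :=
  ip_congr_ae (ae_restrict_of_forall_mem measurableSet_Ioo hf)
    (ae_restrict_of_forall_mem measurableSet_Ioo hg)

theorem ip_self_nonneg (f : ℝ → ℝ) : 0 ≤ ip f f := by
  rw [ip_eq]
  exact integral_nonneg fun x => mul_self_nonneg _

theorem eq_zero_of_ip_self (hf : ContinuousOn f (Icc 0 1)) (h : ip f f = 0) :
    ∀ x ∈ Icc (0 : ℝ) 1, f x = 0 := by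
  have hb := ContinuousOn.bm hf
  rw [ip_eq, integral_eq_zero_iff_of_nonneg (fun x => mul_self_nonneg _)
    (hb.mul hb).integrable] at h
  have h2 : f =ᵐ[volume.restrict (Icc (0 : ℝ) 1)] fun _ => 0 := by
    rw [← restrict_Ioo_eq_restrict_Icc]
    filter_upwards [h] with x hx using mul_self_eq_zero.1 hx
  exact Measure.eqOn_Icc_of_ae_eq volume zero_ne_one h2 hf continuousOn_const

end ip

theorem Icc_mem_nhds_of_Ioo {x : ℝ} (hx : x ∈ Ioo (0 : ℝ) 1) : Icc (0 : ℝ) 1 ∈ nhds x :=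
  Icc_mem_nhds hx.1 hx.2

theorem dx_eq_deriv (f : ℝ → ℝ) {x : ℝ} (hx : x ∈ Ioo (0 : ℝ) 1) : dx f x = deriv f x :=
  derivWithin_of_mem_nhds (Icc_mem_nhds_of_Ioo hx)

theorem dx_congr {f g : ℝ → ℝ} (h : EqOn f g (Icc 0 1)) : EqOn (dx f) (dx g) (Icc 0 1) :=
  fun _ hx => derivWithin_congr h (h hx)

theorem LipC.lipschitzOnWith {K : ℝ} {f : ℝ → ℝ} (hf : LipC K f) :
    LipschitzOnWith K.toNNReal f (Icc 0 1) := by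
  apply LipschitzOnWith.of_dist_le_mul
  intro x hx y hy
  rw [Real.dist_eq, Real.dist_eq]
  exact (hf x hx y hy).trans (mul_le_mul_of_nonneg_right (Real.le_coe_toNNReal K) (abs_nonneg _))

theorem LipC.nonneg {K : ℝ} {f : ℝ → ℝ} (hf : LipC K f) : 0 ≤ K := by
  have := hf 0 (by simp) 1 (by simp)
  simp only [zero_sub, abs_neg, abs_one, mul_one] at this
  exact (abs_nonneg _).trans this

theorem LipC.abs_dx_le {K : ℝ} {f : ℝ → ℝ} (hf : LipC K f) {x : ℝ} (hx : x ∈ Ioo (0 : ℝ) 1) :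
    |dx f x| ≤ K := by
  have := norm_deriv_le_of_lipschitzOn (Icc_mem_nhds_of_Ioo hx) hf.lipschitzOnWith
  rw [dx_eq_deriv f hx]
  simpa [hf.nonneg] using this

theorem LipC.mono {K L : ℝ} {f : ℝ → ℝ} (hf : LipC K f) (h : K ≤ L) : LipC L f :=
  fun x hx y hy => (hf x hx y hy).trans (mul_le_mul_of_nonneg_right h (abs_nonneg _))

theorem LipC.congr {K : ℝ} {f g : ℝ → ℝ} (hf : LipC K f) (h : EqOn f g (Icc 0 1)) : LipC K g :=
  fun x hx y hy => by rw [← h hx, ← h hy]; exact hf x hx y hy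

theorem LipC.add {K L : ℝ} {f g : ℝ → ℝ} (hf : LipC K f) (hg : LipC L g) :
    LipC (K + L) (fun x => f x + g x) := fun x hx y hy => by
  have : f x + g x - (f y + g y) = (f x - f y) + (g x - g y) := by ring
  rw [this, add_mul]
  exact (abs_add_le _ _).trans (add_le_add (hf x hx y hy) (hg x hx y hy))

theorem LipC.const_mul {K : ℝ} {f : ℝ → ℝ} (c : ℝ) (hf : LipC K f) :
    LipC (|c| * K) (fun x => c * f x) := fun x hx y hy => by
  rw [← mul_sub, abs_mul, mul_assoc]
  exact mul_le_mul_of_nonneg_left (hf x hx y hy) (abs_nonneg _)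

theorem LipC.sub {K L : ℝ} {f g : ℝ → ℝ} (hf : LipC K f) (hg : LipC L g) :
    LipC (K + L) (fun x => f x - g x) := by
  simpa [sub_eq_add_neg] using hf.add (hg.const_mul (-1))

/-- A function Lipschitz with constant `K` that vanishes at `0` is bounded by `K`. -/
theorem LipC.abs_le {K : ℝ} {f : ℝ → ℝ} (hf : LipC K f) (h0 : f 0 = 0) {x : ℝ}
    (hx : x ∈ Icc (0 : ℝ) 1) : |f x| ≤ K := by
  have := hf x hx 0 (by simp)
  rw [h0, sub_zero, sub_zero, abs_of_nonneg hx.1] at this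
  exact this.trans (mul_le_of_le_one_right hf.nonneg hx.2)

theorem ae_mem_Ioo : ∀ᵐ x ∂mI, x ∈ Ioo (0 : ℝ) 1 := ae_restrict_mem measurableSet_Ioo

namespace Lip

variable {f g : ℝ → ℝ}

theorem continuousOn (hf : Lip f) : ContinuousOn f (Icc 0 1) := by
  obtain ⟨K, hK⟩ := hf
  exact hK.lipschitzOnWith.continuousOn

theorem bm (hf : Lip f) : BM f := ContinuousOn.bm hf.continuousOn

theorem bm_dx (hf : Lip f) : BM (dx f) := by
  refine ⟨?_, ?_⟩
  · refine (measurable_deriv f).aestronglyMeasurable.congr ?_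
    filter_upwards [ae_mem_Ioo] with x hx using (dx_eq_deriv f hx).symm
  · obtain ⟨K, hK⟩ := hf
    exact ⟨K, fun x hx => hK.abs_dx_le hx⟩

theorem add (hf : Lip f) (hg : Lip g) : Lip (fun x => f x + g x) :=
  let ⟨_, hK⟩ := hf
  let ⟨_, hL⟩ := hg
  ⟨_, hK.add hL⟩

theorem sub (hf : Lip f) (hg : Lip g) : Lip (fun x => f x - g x) :=
  let ⟨_, hK⟩ := hf
  let ⟨_, hL⟩ := hg
  ⟨_, hK.sub hL⟩

theorem const_mul (c : ℝ) (hf : Lip f) : Lip (fun x => c * f x) :=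
  let ⟨_, hK⟩ := hf
  ⟨_, hK.const_mul c⟩

theorem const (c : ℝ) : Lip (fun _ => c) := ⟨0, fun x _ y _ => by simp⟩

theorem mul (hf : Lip f) (hg : Lip g) : Lip (fun x => f x * g x) := by
  obtain ⟨A, hA⟩ := isCompact_Icc.exists_bound_of_continuousOn hf.continuousOn
  obtain ⟨B, hB⟩ := isCompact_Icc.exists_bound_of_continuousOn hg.continuousOn
  obtain ⟨K, hK⟩ := hf
  obtain ⟨L, hL⟩ := hg
  refine ⟨A * L + B * K, fun x hx y hy => ?_⟩
  have e : f x * g x - f y * g y = f x * (g x - g y) + g y * (f x - f y) := by ring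
  rw [e, add_mul, mul_assoc, mul_assoc]
  refine (abs_add_le _ _).trans (add_le_add ?_ ?_)
  · rw [abs_mul]
    exact mul_le_mul (hA x hx) (hL x hx y hy) (abs_nonneg _) ((norm_nonneg _).trans (hA x hx))
  · rw [abs_mul]
    exact mul_le_mul (hB y hy) (hK x hx y hy) (abs_nonneg _) ((norm_nonneg _).trans (hB y hy))

theorem of_contDiffOn (hf : ContDiffOn ℝ 1 f (Icc 0 1)) : Lip f := by
  obtain ⟨K, hK⟩ := hf.exists_lipschitzOnWith (by decide) (convex_Icc _ _) isCompact_Icc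
  exact ⟨K, fun x hx y hy => by simpa [Real.dist_eq] using hK.dist_le_mul x hx y hy⟩

/-- Rademacher's theorem in one dimension. Finite element functions have kinks, so the rules for
`dx` below hold almost everywhere, which is all that integrals see. -/
theorem ae_diff (hf : Lip f) : ∀ᵐ x ∂mI, DifferentiableWithinAt ℝ f (Icc 0 1) x := by
  obtain ⟨K, hK⟩ := hf
  have := hK.lipschitzOnWith.ae_differentiableWithinAt_real measurableSet_Icc
  exact ae_mono (Measure.restrict_mono Ioo_subset_Icc_self le_rfl) this

theorem dx_add (hf : Lip f) (hg : Lip g) :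
    dx (fun x => f x + g x) =ᵐ[mI] fun x => dx f x + dx g x := by
  filter_upwards [hf.ae_diff, hg.ae_diff] with x h1 h2 using derivWithin_fun_add h1 h2

theorem dx_sub (hf : Lip f) (hg : Lip g) :
    dx (fun x => f x - g x) =ᵐ[mI] fun x => dx f x - dx g x := by
  filter_upwards [hf.ae_diff, hg.ae_diff] with x h1 h2 using derivWithin_fun_sub h1 h2

theorem dx_const_mul (c : ℝ) (hf : Lip f) :
    dx (fun x => c * f x) =ᵐ[mI] fun x => c * dx f x := by
  filter_upwards [hf.ae_diff] with x h1 using derivWithin_const_mul c h1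

theorem dx_mul (hf : Lip f) (hg : Lip g) :
    dx (fun x => f x * g x) =ᵐ[mI] fun x => dx f x * g x + f x * dx g x := by
  filter_upwards [hf.ae_diff, hg.ae_diff] with x h1 h2 using derivWithin_fun_mul h1 h2

theorem integral_dx (hf : Lip f) {y z : ℝ} (hy : y ∈ Icc (0 : ℝ) 1) (hz : z ∈ Icc (0 : ℝ) 1) :
    ∫ x in y..z, dx f x = f z - f y := by
  obtain ⟨K, hK⟩ := hf
  have hs : uIcc y z ⊆ Icc 0 1 := (convex_Icc (0 : ℝ) 1).ordConnected.uIcc_subset hy hz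
  rw [← (hK.lipschitzOnWith.mono hs).absolutelyContinuousOnInterval.integral_deriv_eq_sub]
  apply intervalIntegral.integral_congr_ae
  -- The endpoints are discarded because the one-sided `dx` need not agree with `deriv` there.
  filter_upwards [(measure_eq_zero_iff_ae_notMem).1 (Set.Finite.measure_zero
    (Set.toFinite ({0, 1} : Set ℝ)) volume)] with x hx hx2
  have h3 := hs (uIoc_subset_uIcc hx2)
  simp only [mem_insert_iff, mem_singleton_iff, not_or] at hx
  exact dx_eq_deriv f ⟨lt_of_le_of_ne h3.1 (Ne.symm hx.1), lt_of_le_of_ne h3.2 hx.2⟩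

theorem integral_mI_dx (hf : Lip f) : ∫ x, dx f x ∂mI = f 1 - f 0 := by
  rw [← hf.integral_dx (by simp) (by simp), intervalIntegral.integral_of_le zero_le_one,
    integral_Ioc_eq_integral_Ioo]

/-- Integration by parts. -/
theorem ip_dx_left (hf : Lip f) (hg : Lip g) :
    ip (dx f) g = f 1 * g 1 - f 0 * g 0 - ip f (dx g) := by
  have h := (hf.mul hg).integral_mI_dx
  rw [integral_congr_ae (hf.dx_mul hg), integral_add (hf.bm_dx.mul hg.bm).integrable
    (hf.bm.mul hg.bm_dx).integrable, ← ip_eq, ← ip_eq] at h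
  linarith

end Lip

/-! ### Continuation arguments, ordinary differential equations and Grönwall's inequality. -/

open Metric

/-- A continuous function that starts below `δ'` and cannot be between `δ'` and `δ` before leaving
`(-∞, δ]` stays below `δ'`. -/
theorem barrier {g : ℝ → ℝ} {T δ δ' : ℝ} (hg : ContinuousOn g (Icc 0 T)) (hδ : δ' < δ)
    (h0 : g 0 ≤ δ') (h : ∀ t ∈ Icc 0 T, (∀ s ∈ Icc 0 t, g s ≤ δ) → g t ≤ δ') :
    ∀ t ∈ Icc 0 T, g t ≤ δ' := by
  have hempty : ¬ (Icc 0 T ∩ g ⁻¹' Ici δ).Nonempty := by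
    intro hne
    have hc : IsCompact (Icc 0 T ∩ g ⁻¹' Ici δ) :=
      isCompact_Icc.of_isClosed_subset (hg.preimage_isClosed_of_isClosed isClosed_Icc isClosed_Ici)
        inter_subset_left
    -- At the first time `t` with `g t ≥ δ`, the intermediate value theorem gives `g ≤ δ` up to `t`;
    -- the hypothesis then yields `g t ≤ δ' < δ`.
    obtain ⟨t, ⟨ht, hgt⟩, hmin⟩ := hc.exists_isLeast hne
    have hlt : ∀ s ∈ Icc 0 t, g s ≤ δ := by
      intro s hs
      by_contra! hcon
      have hsub : Icc 0 s ⊆ Icc 0 T := Icc_subset_Icc_right (hs.2.trans ht.2)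
      obtain ⟨z, hz, hgz⟩ := intermediate_value_Icc hs.1 (hg.mono hsub)
        ⟨(h0.trans_lt hδ).le, hcon.le⟩
      have h1 : t ≤ z := hmin ⟨hsub hz, hgz.ge⟩
      have h2 : z = s := le_antisymm hz.2 (hs.2.trans h1)
      rw [h2] at hgz
      exact hcon.ne' hgz
    have := h t ht hlt
    have h3 : δ ≤ g t := hgt
    linarith
  intro t ht
  refine h t ht fun s hs => ?_
  by_contra! hcon
  exact hempty ⟨s, ⟨hs.1, hs.2.trans ht.2⟩, hcon.le⟩

section ode

variable {E : Type*} [NormedAddCommGroup E] [NormedSpace ℝ E] [FiniteDimensional ℝ E]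

/-- Such a field is globally Lipschitz and bounded by some `L`, so Picard–Lindelöf on a ball of
radius `L * T` reaches time `T` in one step. -/
theorem exists_global_of_hasCompactSupport {F : E → E} (hF : ContDiff ℝ 1 F)
    (hc : HasCompactSupport F) (y₀ : E) {T : ℝ} (hT : 0 ≤ T) :
    ∃ y : ℝ → E, y 0 = y₀ ∧ ∀ s ∈ Icc 0 T, HasDerivWithinAt y (F (y s)) (Icc 0 T) s := by
  obtain ⟨K, hK⟩ := hF.lipschitzWith_of_hasCompactSupport hc one_ne_zero
  obtain ⟨L, hL⟩ := hc.exists_bound_of_continuous hF.continuous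
  have hp : IsPicardLindelof (fun _ => F) (⟨0, le_rfl, hT⟩ : Icc 0 T) y₀
      (L.toNNReal * T.toNNReal) 0 L.toNNReal K := by
    refine ⟨fun t _ => hK.lipschitzOnWith, fun x _ => continuousOn_const,
      fun t _ x _ => (hL x).trans (Real.le_coe_toNNReal L), ?_⟩
    simp [hT]
  exact hp.exists_eq_forall_mem_Icc_hasDerivWithinAt₀

/-- Global existence from an a priori bound. -/
theorem exists_global_of_apriori {F : E → E} (hF : ContDiff ℝ 1 F) {y₀ : E} {T R : ℝ} (hT : 0 ≤ T)
    (h0 : ‖y₀‖ ≤ R)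
    (hap : ∀ y : ℝ → E, y 0 = y₀ → ∀ t ∈ Icc 0 T,
      (∀ s ∈ Icc 0 t, HasDerivWithinAt y (F (y s)) (Icc 0 T) s) → ‖y t‖ ≤ R) :
    ∃ y : ℝ → E, y 0 = y₀ ∧ ∀ s ∈ Icc 0 T, HasDerivWithinAt y (F (y s)) (Icc 0 T) s := by
  have hR : 0 ≤ R := (norm_nonneg _).trans h0
  -- The cutoff is `1` on the ball of radius `R + 1`. While a solution of the truncated equation
  -- stays there it solves the original one, hence is bounded by `R`; the gap between `R` and `R +
  -- 1` feeds `barrier`.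
  let ψ : ContDiffBump (0 : E) := ⟨R + 1, R + 2, by linarith, by linarith⟩
  obtain ⟨y, hy0, hy⟩ := exists_global_of_hasCompactSupport (F := fun x => ψ x • F x)
    ((ψ.contDiff (n := 1)).smul hF) ψ.hasCompactSupport.smul_right y₀ hT
  have hone : ∀ x : E, ‖x‖ ≤ R + 1 → ψ x • F x = F x := by
    intro x hx
    rw [ψ.one_of_mem_closedBall (by simpa [ψ] using hx), one_smul]
  have hcont : ContinuousOn y (Icc 0 T) := fun s hs => (hy s hs).continuousWithinAt
  have hbd := barrier hcont.norm (lt_add_one R) (by rw [hy0]; exact h0) fun t ht hs =>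
    hap y hy0 t ht fun s hst => by
      rw [← hone _ (hs s hst)]
      exact hy s ⟨hst.1, hst.2.trans ht.2⟩
  refine ⟨y, hy0, fun s hs => ?_⟩
  rw [← hone _ ((hbd s hs).trans (by linarith))]
  exact hy s hs

/-- Both trajectories are compact, so they lie in one closed ball, on which a `C¹` field is
Lipschitz. -/
theorem ode_unique {F : E → E} (hF : ContDiff ℝ 1 F) {y z : ℝ → E} {T : ℝ} (h0 : y 0 = z 0)
    (hy : ∀ s ∈ Icc 0 T, HasDerivWithinAt y (F (y s)) (Icc 0 T) s)
    (hz : ∀ s ∈ Icc 0 T, HasDerivWithinAt z (F (z s)) (Icc 0 T) s) :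
    EqOn y z (Icc 0 T) := by
  have hcy : ContinuousOn y (Icc 0 T) := fun s hs => (hy s hs).continuousWithinAt
  have hcz : ContinuousOn z (Icc 0 T) := fun s hs => (hz s hs).continuousWithinAt
  obtain ⟨A, hA⟩ := isCompact_Icc.exists_bound_of_continuousOn hcy
  obtain ⟨B, hB⟩ := isCompact_Icc.exists_bound_of_continuousOn hcz
  obtain ⟨K, hK⟩ := (hF.contDiffOn (s := closedBall 0 (max A B))).exists_lipschitzOnWith
    one_ne_zero (convex_closedBall _ _) (isCompact_closedBall _ _)
  refine ODE_solution_unique_of_mem_Icc_right (v := fun _ => F)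
    (s := fun _ => closedBall 0 (max A B)) (K := K) (fun t _ => hK) hcy ?_ ?_ hcz ?_ ?_ h0
  · intro t ht
    exact (hy t (Ico_subset_Icc_self ht)).mono_of_mem_nhdsWithin (Icc_mem_nhdsGE_of_mem ht)
  · intro t ht
    simpa using Or.inl (hA t (Ico_subset_Icc_self ht))
  · intro t ht
    exact (hz t (Ico_subset_Icc_self ht)).mono_of_mem_nhdsWithin (Icc_mem_nhdsGE_of_mem ht)
  · intro t ht
    simpa using Or.inr (hB t (Ico_subset_Icc_self ht))

end ode

/-- A Grönwall inequality. -/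
theorem gronwall {g g' : ℝ → ℝ} {t K δ : ℝ} (hK : 0 < K) (hδ : 0 ≤ δ)
    (hg : ∀ s ∈ Icc 0 t, HasDerivWithinAt g (g' s) (Icc 0 t) s) (h0 : g 0 = 0)
    (hb : ∀ s ∈ Icc 0 t, g' s ≤ K * g s + δ) (ht : 0 ≤ t) : g t ≤ δ / K * Real.exp (K * t) := by
  have := le_gronwallBound_of_liminf_deriv_right_le (f := g) (f' := g') (δ := 0) (K := K) (ε := δ)
    (a := 0) (b := t) (fun s hs => (hg s hs).continuousWithinAt) ?_ h0.le
    (fun s hs => hb s (Ico_subset_Icc_self hs)) t ⟨ht, le_rfl⟩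
  · refine this.trans ?_
    rw [gronwallBound_of_K_ne_0 hK.ne']
    simp only [zero_mul, zero_add, sub_zero]
    have : 0 ≤ δ / K := by positivity
    nlinarith
  · intro s hs r hr
    exact ((hg s (Ico_subset_Icc_self hs)).mono_of_mem_nhdsWithin
      (Icc_mem_nhdsGE_of_mem hs)).liminf_right_slope_le hr

/-! ### Definite quadratic forms in finite dimension. -/

/-- A positive continuous quadratic function on `ℝⁿ` dominates the square of the norm. -/
theorem exists_quadratic_lower_bound {n : ℕ} {q : (Fin n → ℝ) → ℝ} (hq : Continuous q)
    (hs : ∀ (s : ℝ) c, q (s • c) = s ^ 2 * q c) (hpos : ∀ c, c ≠ 0 → 0 < q c) :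
    ∃ m > 0, ∀ c, m * ‖c‖ ^ 2 ≤ q c := by
  have h0 : q 0 = 0 := by simpa using hs 0 0
  have hunit : ∀ c : Fin n → ℝ, c ≠ 0 → ‖c‖⁻¹ • c ∈ sphere (0 : Fin n → ℝ) 1 := fun c hc => by
    simp [norm_smul, norm_ne_zero_iff.2 hc]
  -- The unit sphere is empty when `n = 0`, where any constant will do.
  by_cases hne : (sphere (0 : Fin n → ℝ) 1).Nonempty
  · obtain ⟨c₀, hc₀, hmin⟩ := (isCompact_sphere (0 : Fin n → ℝ) 1).exists_isMinOn hne hq.continuousOn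
    refine ⟨q c₀, hpos _ (ne_zero_of_mem_unit_sphere ⟨c₀, hc₀⟩), fun c => ?_⟩
    rcases eq_or_ne c 0 with rfl | hc
    · simp [h0]
    have hn : ‖c‖ ≠ 0 := norm_ne_zero_iff.2 hc
    have h1 : q c₀ ≤ q (‖c‖⁻¹ • c) := hmin (hunit c hc)
    rw [hs] at h1
    calc q c₀ * ‖c‖ ^ 2 ≤ (‖c‖⁻¹) ^ 2 * q c * ‖c‖ ^ 2 := by gcongr
      _ = q c := by field_simp
  · refine ⟨1, one_pos, fun c => ?_⟩
    rcases eq_or_ne c 0 with rfl | hc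
    · simp [h0]
    · exact absurd ⟨_, hunit c hc⟩ hne

/-- A definite bilinear form on `ℝⁿ` can be inverted. -/
theorem exists_gram_inverse {n : ℕ} (g : (Fin n → ℝ) →ₗ[ℝ] (Fin n → ℝ) →ₗ[ℝ] ℝ)
    (hpos : ∀ c, g c c = 0 → c = 0) :
    ∃ S : (Fin n → ℝ) →ₗ[ℝ] (Fin n → ℝ), ∀ y c, g (S y) c = ∑ i, y i * c i := by
  have hexp : ∀ v c, g v c = ∑ i, g v (Pi.single i 1) * c i := by
    intro v c
    conv_lhs => rw [pi_eq_sum_univ' c]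
    simp only [map_sum, map_smul, smul_eq_mul]
    refine Finset.sum_congr rfl fun i _ => ?_
    rw [mul_comm]
  let A : (Fin n → ℝ) →ₗ[ℝ] (Fin n → ℝ) :=
    LinearMap.pi fun i => g.flip (Pi.single i 1)
  have hA : ∀ v i, A v i = g v (Pi.single i 1) := fun v i => by simp [A]
  have hinj : Function.Injective A := by
    rw [← LinearMap.ker_eq_bot, LinearMap.ker_eq_bot']
    intro v hv
    apply hpos
    rw [hexp]
    refine Finset.sum_eq_zero fun i _ => ?_
    rw [← hA, hv]
    simp
  let e := LinearEquiv.ofInjectiveEndo A hinj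
  refine ⟨e.symm.toLinearMap, fun y c => ?_⟩
  rw [hexp]
  refine Finset.sum_congr rfl fun i _ => ?_
  rw [← hA]
  have : A (e.symm y) = y := e.apply_symm_apply y
  exact congrArg (fun w => w i * c i) this

/-! ### Spline approximation with constants independent of the mesh. -/

open Polynomial in
theorem exists_polynomial_derivative_eq (p : ℝ[X]) :
    ∃ q : ℝ[X], derivative q = p ∧ q.natDegree ≤ p.natDegree + 1 := by
  refine ⟨∑ i ∈ Finset.range (p.natDegree + 1), monomial (i + 1) (p.coeff i / (i + 1)), ?_, ?_⟩
  · conv_rhs => rw [p.as_sum_range]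
    rw [derivative_sum]
    refine Finset.sum_congr rfl fun i _ => ?_
    rw [derivative_monomial]
    congr 1
    have : (i : ℝ) + 1 ≠ 0 := by positivity
    push_cast
    field_simp
  · refine natDegree_sum_le_of_forall_le _ _ fun i hi => ?_
    refine (natDegree_monomial_le _).trans ?_
    have := Finset.mem_range.1 hi
    omega

/-- Piecewise polynomials of degree at most `d` on the partition with nodes `x`. -/
def PiecewisePoly (x : ℕ → ℝ) (d : ℕ) (f : ℝ → ℝ) : Prop :=
  ∀ j, ∃ p : Polynomial ℝ, p.natDegree ≤ d ∧ ∀ y ∈ Icc (x j) (x (j + 1)), f y = p.eval y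

/-- Splines of degree `m + 1` of maximal smoothness `C^m`. -/
def Spline (x : ℕ → ℝ) (m : ℕ) (f : ℝ → ℝ) : Prop :=
  ContDiff ℝ m f ∧ PiecewisePoly x (m + 1) f

namespace Spline

variable {x : ℕ → ℝ} {m : ℕ} {f g : ℝ → ℝ}

theorem continuous (hf : Spline x m f) : Continuous f := hf.1.continuous

theorem add (hf : Spline x m f) (hg : Spline x m g) : Spline x m (fun y => f y + g y) := by
  refine ⟨hf.1.add hg.1, fun j => ?_⟩
  obtain ⟨p, hp, hp'⟩ := hf.2 j
  obtain ⟨q, hq, hq'⟩ := hg.2 j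
  exact ⟨p + q, (Polynomial.natDegree_add_le _ _).trans (max_le hp hq), fun y hy => by
    simp only [hp' y hy, hq' y hy, Polynomial.eval_add]⟩

theorem const_mul (c : ℝ) (hf : Spline x m f) : Spline x m (fun y => c * f y) := by
  refine ⟨contDiff_const.mul hf.1, fun j => ?_⟩
  obtain ⟨p, hp, hp'⟩ := hf.2 j
  exact ⟨Polynomial.C c * p, (Polynomial.natDegree_C_mul_le _ _).trans hp, fun y hy => by
    simp only [hp' y hy, Polynomial.eval_mul, Polynomial.eval_C]⟩

theorem const (c : ℝ) : Spline x m (fun _ => c) :=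
  ⟨contDiff_const, fun _ => ⟨Polynomial.C c, by simp, by simp⟩⟩

theorem sub (hf : Spline x m f) (hg : Spline x m g) : Spline x m (fun y => f y - g y) := by
  simpa [sub_eq_add_neg] using hf.add (hg.const_mul (-1))

/-- Integration raises degree and smoothness together, so maximal smoothness survives. Both
inductions on `m` rest on this. -/
theorem integral (hf : Spline x m f) (a : ℝ) : Spline x (m + 1) (fun y => ∫ z in a..y, f z) := by
  have hd : ∀ y, HasDerivAt (fun y => ∫ z in a..y, f z) (f y) y := fun y =>
    intervalIntegral.integral_hasDerivAt_right (hf.continuous.intervalIntegrable _ _)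
      (hf.continuous.stronglyMeasurableAtFilter _ _) hf.continuous.continuousAt
  refine ⟨?_, fun j => ?_⟩
  · have : ((m + 1 : ℕ) : WithTop ℕ∞) = (m : WithTop ℕ∞) + 1 := by push_cast; rfl
    rw [this, contDiff_succ_iff_deriv]
    refine ⟨fun y => (hd y).differentiableAt, by simp, ?_⟩
    rw [funext fun y => (hd y).deriv]
    exact hf.1
  · obtain ⟨p, hp, hp'⟩ := hf.2 j
    obtain ⟨q, hq, hq'⟩ := exists_polynomial_derivative_eq p
    -- The constant term makes the antiderivative on element `j` take the right value at its left
    -- node.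
    refine ⟨Polynomial.C ((∫ z in a..x j, f z) - q.eval (x j)) + q, ?_, fun y hy => ?_⟩
    · refine (Polynomial.natDegree_add_le _ _).trans (max_le (by simp) (hq'.trans (by omega)))
    · have h1 : ∫ z in x j..y, f z = q.eval y - q.eval (x j) := by
        rw [← intervalIntegral.integral_eq_sub_of_hasDerivAt (f := fun z => q.eval z)
          (f' := fun z => p.eval z)]
        · refine intervalIntegral.integral_congr fun z hz => ?_
          rw [uIcc_of_le hy.1] at hz
          exact hp' z ⟨hz.1, hz.2.trans hy.2⟩
        · intro z _
          rw [← hq]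
          exact q.hasDerivAt z
        · exact p.continuous.intervalIntegrable _ _
      simp only []
      rw [← intervalIntegral.integral_add_adjacent_intervals
        (hf.continuous.intervalIntegrable a (x j)) (hf.continuous.intervalIntegrable (x j) y), h1]
      simp
      ring

end Spline

/-- Splines rising monotonically in a bounded number of elements from `0` to `1`. -/
theorem exists_ramp {x : ℕ → ℝ} (hx : StrictMono x) (m : ℕ) :
    ∃ R : ℕ → ℝ → ℝ, ∀ i, Spline x m (R i) ∧ (∀ y, R i y ∈ Icc (0 : ℝ) 1) ∧
      (∀ y ≤ x i, R i y = 0) ∧ ∀ y, x (i + 2 ^ m) ≤ y → R i y = 1 := by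
  induction m with
  | zero =>
    refine ⟨fun i y => max 0 (min 1 ((y - x i) / (x (i + 1) - x i))), fun i => ?_⟩
    have hgap : 0 < x (i + 1) - x i := sub_pos.2 (hx (Nat.lt_succ_self i))
    have hle : ∀ y ≤ x i, max 0 (min 1 ((y - x i) / (x (i + 1) - x i))) = 0 := fun y hy =>
      max_eq_left ((min_le_right _ _).trans (div_nonpos_of_nonpos_of_nonneg (by linarith) hgap.le))
    have hge : ∀ y, x (i + 1) ≤ y → max 0 (min 1 ((y - x i) / (x (i + 1) - x i))) = 1 := by
      intro y hy
      rw [min_eq_left ((one_le_div hgap).2 (by linarith))]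
      norm_num
    refine ⟨⟨contDiff_zero.2 (by fun_prop), fun j => ?_⟩,
      fun y => ⟨le_max_left _ _, max_le zero_le_one (min_le_left _ _)⟩, hle, hge⟩
    rcases lt_trichotomy j i with hj | rfl | hj
    · exact ⟨0, by simp, fun y hy => by
        simpa using hle y (hy.2.trans (hx.monotone (by omega)))⟩
    · refine ⟨Polynomial.C (-x j / (x (j + 1) - x j)) +
        Polynomial.C (1 / (x (j + 1) - x j)) * Polynomial.X, ?_, fun y hy => ?_⟩
      · refine (Polynomial.natDegree_add_le _ _).trans (max_le (by simp) ?_)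
        refine (Polynomial.natDegree_C_mul_le _ _).trans ?_
        simp
      · simp only []
        rw [min_eq_right ((div_le_one hgap).2 (by linarith [hy.2])),
          max_eq_right (div_nonneg (by linarith [hy.1]) hgap.le)]
        simp
        ring
    · exact ⟨1, by simp, fun y hy => by
        simpa using hge y ((hx.monotone (by omega)).trans hy.1)⟩
  | succ m ih =>
    obtain ⟨R, hR⟩ := ih
    have hL : ∀ i, i + 2 ^ m + 2 ^ m = i + 2 ^ (m + 1) := fun i => by rw [pow_succ]; ring
    -- `R i` has reached `1` where its shift by `2 ^ m` nodes begins to rise, so the difference is a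
    -- nonnegative bump supported in `2 ^ (m + 1)` elements. Its normalized antiderivative is the
    -- next ramp.
    let B : ℕ → ℝ → ℝ := fun i y => R i y - R (i + 2 ^ m) y
    have hB : ∀ i, Spline x m (B i) := fun i => (hR i).1.sub (hR _).1
    have hBi : ∀ i a b, IntervalIntegrable (B i) MeasureTheory.volume a b := fun i a b =>
      (hB i).continuous.intervalIntegrable a b
    have hB0 : ∀ i y, 0 ≤ B i y := by
      intro i y
      rcases le_total y (x (i + 2 ^ m)) with h | h
      · simp only [B, (hR (i + 2 ^ m)).2.2.1 y h, sub_zero]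
        exact ((hR i).2.1 y).1
      · simp only [B, (hR i).2.2.2 y h]
        linarith [((hR (i + 2 ^ m)).2.1 y).2]
    have hBl : ∀ i, ∀ y ≤ x i, B i y = 0 := fun i y hy => by
      simp only [B, (hR i).2.2.1 y hy,
        (hR (i + 2 ^ m)).2.2.1 y (hy.trans (hx.monotone (Nat.le_add_right _ _))), sub_zero]
    have hBr : ∀ i y, x (i + 2 ^ (m + 1)) ≤ y → B i y = 0 := fun i y hy => by
      rw [← hL] at hy
      simp only [B, (hR (i + 2 ^ m)).2.2.2 y hy,
        (hR i).2.2.2 y ((hx.monotone (Nat.le_add_right _ _)).trans hy), sub_self]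
    have hIpos : ∀ i, 0 < ∫ z in x i..x (i + 2 ^ (m + 1)), B i z := by
      intro i
      refine intervalIntegral.integral_pos (hx (by simp)) (hB i).continuous.continuousOn
        (fun y _ => hB0 i y) ⟨x (i + 2 ^ m), ⟨hx.monotone (Nat.le_add_right _ _), hx.monotone ?_⟩, ?_⟩
      · rw [← hL]; exact Nat.le_add_right _ _
      · simp [B, (hR i).2.2.2 _ le_rfl, (hR (i + 2 ^ m)).2.2.1 _ le_rfl]
    have hl : ∀ i, ∀ y ≤ x i, ∫ z in x i..y, B i z = 0 := fun i y hy => by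
      rw [intervalIntegral.integral_congr (g := fun _ => 0), intervalIntegral.integral_zero]
      intro z hz
      rw [uIcc_of_ge hy] at hz
      exact hBl i z hz.2
    have hr : ∀ i y, x (i + 2 ^ (m + 1)) ≤ y →
        ∫ z in x i..y, B i z = ∫ z in x i..x (i + 2 ^ (m + 1)), B i z := fun i y hy => by
      rw [← intervalIntegral.integral_add_adjacent_intervals (hBi i _ (x (i + 2 ^ (m + 1))))
        (hBi i _ y), intervalIntegral.integral_congr (a := x (i + 2 ^ (m + 1))) (g := fun _ => 0),
        intervalIntegral.integral_zero, add_zero]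
      intro z hz
      rw [uIcc_of_le hy] at hz
      exact hBr i z hz.1
    have hmono : ∀ i a b, a ≤ b → ∫ z in x i..a, B i z ≤ ∫ z in x i..b, B i z := by
      intro i a b hab
      rw [← intervalIntegral.integral_add_adjacent_intervals (hBi i _ a) (hBi i _ b)]
      have : 0 ≤ ∫ z in a..b, B i z := intervalIntegral.integral_nonneg hab fun u _ => hB0 i u
      linarith
    refine ⟨fun i y => (∫ z in x i..x (i + 2 ^ (m + 1)), B i z)⁻¹ * ∫ z in x i..y, B i z,
      fun i => ⟨((hB i).integral (x i)).const_mul _, fun y => ?_, fun y hy => ?_, fun y hy => ?_⟩⟩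
    · have h0 : 0 ≤ ∫ z in x i..y, B i z := by
        rcases le_total y (x i) with h | h
        · exact (hl i y h).ge
        · exact intervalIntegral.integral_nonneg h fun u _ => hB0 i u
      have h1 : ∫ z in x i..y, B i z ≤ ∫ z in x i..x (i + 2 ^ (m + 1)), B i z := by
        rcases le_total y (x (i + 2 ^ (m + 1))) with h | h
        · exact hmono i _ _ h
        · exact (hr i y h).le
      refine ⟨mul_nonneg (inv_nonneg.2 (hIpos i).le) h0, ?_⟩
      rw [inv_mul_le_iff₀ (hIpos i), mul_one]
      exact h1
    · simp only [hl i y hy, mul_zero]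
    · simp only [hr i y hy]
      exact inv_mul_cancel₀ (hIpos i).ne'

theorem nodes_sub_le {x : ℕ → ℝ} {h : ℝ} (hh : ∀ n, x (n + 1) - x n ≤ h) (i L : ℕ) :
    x (i + L) - x i ≤ L * h := by
  induction L with
  | zero => simp
  | succ L ih =>
    have := hh (i + L)
    rw [← add_assoc]
    push_cast
    linarith

/-- Splines approximate Lipschitz functions to first order. -/
theorem exists_spline_approx_lipschitz {x : ℕ → ℝ} (hx : StrictMono x) {h : ℝ}
    (hh : ∀ n, x (n + 1) - x n ≤ h) (m : ℕ) {f : ℝ → ℝ} {K : ℝ} (hK : 0 ≤ K)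
    (hf : ∀ y z, |f y - f z| ≤ K * |y - z|) (J : ℕ) :
    ∃ s, Spline x m s ∧ (∀ y, x (J * 2 ^ m) ≤ y → s y = f (x (J * 2 ^ m))) ∧
      (∀ j ≤ J, s (x (j * 2 ^ m)) = f (x (j * 2 ^ m))) ∧
      ∀ y ∈ Icc (x 0) (x (J * 2 ^ m)), |f y - s y| ≤ 2 * K * 2 ^ m * h := by
  have hh0 : 0 ≤ h := (sub_nonneg.2 (hx.monotone (Nat.le_succ 0))).trans (hh 0)
  obtain ⟨R, hR⟩ := exists_ramp hx m
  induction J with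
  | zero =>
    refine ⟨fun _ => f (x 0), Spline.const _, by simp, by simp, fun y hy => ?_⟩
    rw [zero_mul] at hy
    rw [le_antisymm hy.2 hy.1, sub_self, abs_zero]
    positivity
  | succ J ih =>
    obtain ⟨s, hs, hs1, hs2, hs3⟩ := ih
    have hJ : (J + 1) * 2 ^ m = J * 2 ^ m + 2 ^ m := by ring
    have hend : ∀ y, x ((J + 1) * 2 ^ m) ≤ y →
        s y + (f (x ((J + 1) * 2 ^ m)) - f (x (J * 2 ^ m))) * R (J * 2 ^ m) y =
          f (x ((J + 1) * 2 ^ m)) := by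
      intro y hy
      rw [hs1 y ((hx.monotone (hJ ▸ Nat.le_add_right _ _)).trans hy),
        (hR (J * 2 ^ m)).2.2.2 y (by rw [← hJ]; exact hy)]
      ring
    -- The spline built so far is constant past `x (J * 2 ^ m)`. Adding a ramp whose height is the
    -- increment of `f` over the next block of `2 ^ m` elements keeps interpolation at the block
    -- ends and does not alter anything to the left. Inside the block, `f` and the ramp each move by
    -- at most `K * 2 ^ m * h`.
    refine ⟨fun y => s y + (f (x ((J + 1) * 2 ^ m)) - f (x (J * 2 ^ m))) * R (J * 2 ^ m) y,
      hs.add ((hR _).1.const_mul _), hend, fun j hj => ?_, fun y hy => ?_⟩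
    · rcases Nat.of_le_succ hj with hj | rfl
      · simp only []
        rw [hs2 j hj, (hR (J * 2 ^ m)).2.2.1 _ (hx.monotone (Nat.mul_le_mul_right _ hj))]
        ring
      · exact hend _ le_rfl
    · rcases le_total y (x (J * 2 ^ m)) with hyJ | hyJ
      · simp only []
        rw [(hR (J * 2 ^ m)).2.2.1 y hyJ, mul_zero, add_zero]
        exact hs3 y ⟨hy.1, hyJ⟩
      · simp only []
        rw [hs1 y hyJ]
        have hlen : x ((J + 1) * 2 ^ m) - x (J * 2 ^ m) ≤ 2 ^ m * h := by
          rw [hJ]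
          exact_mod_cast nodes_sub_le hh (J * 2 ^ m) (2 ^ m)
        have h1 : |f y - f (x (J * 2 ^ m))| ≤ K * (2 ^ m * h) := by
          refine (hf _ _).trans (mul_le_mul_of_nonneg_left ?_ hK)
          rw [abs_of_nonneg (by linarith)]
          linarith [hy.2]
        have h2 : |f (x ((J + 1) * 2 ^ m)) - f (x (J * 2 ^ m))| ≤ K * (2 ^ m * h) := by
          refine (hf _ _).trans (mul_le_mul_of_nonneg_left ?_ hK)
          rw [abs_of_nonneg (by linarith [hy.2])]
          exact hlen
        have h3 : |(f (x ((J + 1) * 2 ^ m)) - f (x (J * 2 ^ m))) * R (J * 2 ^ m) y| ≤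
            K * (2 ^ m * h) := by
          rw [abs_mul]
          have hr := (hR (J * 2 ^ m)).2.1 y
          rw [abs_of_nonneg hr.1]
          exact (mul_le_of_le_one_right (abs_nonneg _) hr.2).trans h2
        rw [← sub_sub]
        refine (abs_sub _ _).trans ?_
        linarith

/-- Adjacent elements share a node, and on the line `|y - z|` splits exactly at a node between `y`
and `z`, so Lipschitz bounds chain without loss. -/
theorem lipschitz_glue {x : ℕ → ℝ} (hx : Monotone x) {f : ℝ → ℝ} {K : ℝ} (N : ℕ)
    (h : ∀ j < N, ∀ y ∈ Icc (x j) (x (j + 1)), ∀ z ∈ Icc (x j) (x (j + 1)),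
      |f y - f z| ≤ K * |y - z|) :
    ∀ y ∈ Icc (x 0) (x N), ∀ z ∈ Icc (x 0) (x N), |f y - f z| ≤ K * |y - z| := by
  induction N with
  | zero =>
    intro y hy z hz
    rw [le_antisymm hy.2 hy.1, le_antisymm hz.2 hz.1]
    simp
  | succ N ih =>
    have ih := ih fun j hj => h j (by omega)
    have key : ∀ y ∈ Icc (x 0) (x (N + 1)), ∀ z ∈ Icc (x 0) (x (N + 1)), y ≤ z →
        |f y - f z| ≤ K * |y - z| := by
      intro y hy z hz hyz
      rcases le_total z (x N) with h1 | h1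
      · exact ih y ⟨hy.1, hyz.trans h1⟩ z ⟨hz.1, h1⟩
      · rcases le_total y (x N) with h2 | h2
        · have e1 := ih y ⟨hy.1, h2⟩ (x N) ⟨hx (Nat.zero_le N), le_rfl⟩
          have e2 := h N (by omega) (x N) ⟨le_rfl, hx (Nat.le_succ N)⟩ z ⟨h1, hz.2⟩
          have e3 : |y - z| = |y - x N| + |x N - z| := by
            rw [abs_of_nonpos (by linarith), abs_of_nonpos (by linarith),
              abs_of_nonpos (by linarith)]
            ring
          rw [e3, mul_add]
          exact (abs_sub_le _ _ _).trans (add_le_add e1 e2)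
        · exact h N (by omega) y ⟨h2, hy.2⟩ z ⟨h1, hz.2⟩
    intro y hy z hz
    rcases le_total y z with h1 | h1
    · exact key y hy z hz h1
    · rw [abs_sub_comm, abs_sub_comm y]
      exact key z hz y hy h1

/-- A function on `[0,1]`, extended by constants. -/
noncomputable def ext (f : ℝ → ℝ) (x : ℝ) : ℝ := f (projIcc 0 1 zero_le_one x)

theorem ext_of_mem (f : ℝ → ℝ) {x : ℝ} (hx : x ∈ Icc (0 : ℝ) 1) : ext f x = f x := by
  rw [ext, projIcc_of_mem _ hx]

theorem LipC.ext {K : ℝ} {f : ℝ → ℝ} (hf : LipC K f) (y z : ℝ) :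
    |ext f y - ext f z| ≤ K * |y - z| := by
  refine (hf _ (Subtype.mem _) _ (Subtype.mem _)).trans (mul_le_mul_of_nonneg_left ?_ hf.nonneg)
  have := (LipschitzWith.projIcc (zero_le_one (α := ℝ))).dist_le_mul y z
  simpa [Subtype.dist_eq, Real.dist_eq] using this

theorem lipC_of_hasDerivWithinAt {f f' : ℝ → ℝ} {K : ℝ}
    (hf : ∀ x ∈ Icc (0 : ℝ) 1, HasDerivWithinAt f (f' x) (Icc 0 1) x)
    (hb : ∀ x ∈ Icc (0 : ℝ) 1, |f' x| ≤ K) : LipC K f := fun x hx y hy => by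
  simpa using (convex_Icc (0 : ℝ) 1).norm_image_sub_le_of_norm_hasDerivWithin_le hf hb hy hx

/-- Approximation by splines, with an error bound on the derivative. -/
def SplineApproxDeriv (m : ℕ) (C : ℝ) : Prop :=
  ∀ (x : ℕ → ℝ) (N : ℕ) (h : ℝ), StrictMono x → x 0 = 0 → x N = 1 →
    (∀ n, x (n + 1) - x n ≤ h) → ∀ (v : ℝ → ℝ) (K : ℝ), ContDiffOn ℝ (m + 2 : ℕ) v (Icc 0 1) →
    (∀ y ∈ Icc (0 : ℝ) 1, |iteratedDerivWithin (m + 2) v (Icc 0 1) y| ≤ K) →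
    ∃ s, Spline x m s ∧ LipC (C * h ^ (m + 1) * K) (fun y => v y - s y) ∧
      s 0 = v 0 ∧ s 1 = v 1

/-- Approximation by splines. -/
def SplineApprox (m : ℕ) (C : ℝ) : Prop :=
  ∀ (x : ℕ → ℝ) (N : ℕ) (h : ℝ), StrictMono x → x 0 = 0 → x N = 1 →
    (∀ n, x (n + 1) - x n ≤ h) → ∀ (v : ℝ → ℝ) (K : ℝ), ContDiffOn ℝ (m + 2 : ℕ) v (Icc 0 1) →
    (∀ y ∈ Icc (0 : ℝ) 1, |iteratedDerivWithin (m + 2) v (Icc 0 1) y| ≤ K) →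
    ∃ s, Spline x m s ∧ ∀ y ∈ Icc (0 : ℝ) 1, |v y - s y| ≤ C * h ^ (m + 2) * K

/-- The error `v - s` is Lipschitz with a constant of order `h^(m+1)`. Approximating this error by a
second spline, to first order only, gains the missing power of `h`. -/
theorem SplineApproxDeriv.splineApprox {m : ℕ} {C : ℝ} (H : SplineApproxDeriv m C) :
    SplineApprox m (2 ^ (m + 1) * C) := by
  intro x N h hx h0 h1 hh v K hv hK
  obtain ⟨s, hs, hL, -, -⟩ := H x N h hx h0 h1 hh v K hv hK
  -- `N` blocks of `2 ^ m` elements may reach beyond `1`, so the error is extended by constants.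
  obtain ⟨s', hs', -, -, he⟩ := exists_spline_approx_lipschitz hx hh m hL.nonneg hL.ext N
  refine ⟨fun y => s y + s' y, hs.add hs', fun y hy => ?_⟩
  have hN : (1 : ℝ) ≤ x (N * 2 ^ m) := by
    rw [← h1]
    exact hx.monotone (Nat.le_mul_of_pos_right _ (by positivity))
  have := he y ⟨h0 ▸ hy.1, hy.2.trans hN⟩
  rw [ext_of_mem _ hy] at this
  rw [← sub_sub]
  refine this.trans (le_of_eq ?_)
  ring

/-- The piecewise linear interpolant works: by the mean value theorem its slope on an element is a
value of `v'` on that element, and `v'` varies there by at most `K * h`. -/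
theorem splineApproxDeriv_zero : SplineApproxDeriv 0 1 := by
  intro x N h hx h0 h1 hh v K hv hK
  have hud : UniqueDiffOn ℝ (Icc (0 : ℝ) 1) := uniqueDiffOn_Icc zero_lt_one
  have hv1 : ContDiffOn ℝ 1 v (Icc 0 1) := hv.of_le (by norm_num)
  have hvd : ∀ y ∈ Icc (0 : ℝ) 1, HasDerivWithinAt v (dx v y) (Icc 0 1) y := fun y hy =>
    (hv1.differentiableOn one_ne_zero y hy).hasDerivWithinAt
  have hdv : ContDiffOn ℝ 1 (dx v) (Icc 0 1) := by
    have : ContDiffOn ℝ (1 + 1) v (Icc 0 1) := hv.of_le (by norm_num)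
    exact ((contDiffOn_succ_iff_derivWithin hud).1 this).2.2
  have hdvL : LipC K (dx v) := by
    refine lipC_of_hasDerivWithinAt (f' := derivWithin (dx v) (Icc 0 1))
      (fun y hy => (hdv.differentiableOn one_ne_zero y hy).hasDerivWithinAt) fun y hy => ?_
    have := hK y hy
    rw [zero_add, iteratedDerivWithin_succ, ] at this
    convert this using 2
    exact derivWithin_congr (fun z hz => by rw [iteratedDerivWithin_one]; rfl)
      (by rw [iteratedDerivWithin_one]; rfl)
  obtain ⟨L, hL⟩ := Lip.of_contDiffOn hv1
  obtain ⟨s, hs, -, hnode, -⟩ := exists_spline_approx_lipschitz hx hh 0 hL.nonneg hL.ext N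
  simp only [pow_zero, mul_one] at hnode
  have hmem : ∀ j ≤ N, x j ∈ Icc (0 : ℝ) 1 := fun j hj =>
    ⟨h0 ▸ hx.monotone (Nat.zero_le j), h1 ▸ hx.monotone hj⟩
  have hnode' : ∀ j ≤ N, s (x j) = v (x j) := fun j hj => by
    rw [hnode j hj, ext_of_mem _ (hmem j hj)]
  refine ⟨s, hs, ?_, ?_, ?_⟩
  · have hglue := lipschitz_glue hx.monotone (f := fun y => v y - s y) (K := 1 * h ^ (0 + 1) * K) N
      (fun j hj => ?_)
    · rwa [h0, h1] at hglue
    have hlt : x j < x (j + 1) := hx (Nat.lt_succ_self j)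
    have hsub : Icc (x j) (x (j + 1)) ⊆ Icc 0 1 :=
      Icc_subset_Icc (hmem j hj.le).1 (hmem (j + 1) hj).2
    obtain ⟨p, hp, hp'⟩ := hs.2 j
    rw [Polynomial.natDegree_le_iff_coeff_eq_zero] at hp
    have hpe : ∀ y, p.eval y = p.coeff 0 + p.coeff 1 * y := by
      intro y
      rw [Polynomial.eval_eq_sum_range' (n := 2)
        (Nat.lt_succ_of_le (Polynomial.natDegree_le_iff_coeff_eq_zero.2 hp))]
      simp [Finset.sum_range_succ]
    have hvy : ∀ y ∈ Ioo (x j) (x (j + 1)), HasDerivAt v (dx v y) y := fun y hy =>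
      (hvd y (hsub (Ioo_subset_Icc_self hy))).hasDerivAt
        (Filter.mem_of_superset (Icc_mem_nhds hy.1 hy.2) hsub)
    obtain ⟨ξ, hξ, hξ'⟩ := exists_hasDerivAt_eq_slope v (dx v) hlt
      (hv1.continuousOn.mono hsub) hvy
    have hslope : dx v ξ = p.coeff 1 := by
      have e1 := hp' (x j) ⟨le_rfl, hlt.le⟩
      have e2 := hp' (x (j + 1)) ⟨hlt.le, le_rfl⟩
      rw [hnode' j hj.le, hpe] at e1
      rw [hnode' (j + 1) hj, hpe] at e2
      rw [hξ', e1, e2, div_eq_iff (by linarith)]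
      ring
    have hder : ∀ y ∈ Icc (x j) (x (j + 1)),
        HasDerivWithinAt (fun y => v y - s y) (dx v y - dx v ξ) (Icc (x j) (x (j + 1))) y := by
      intro y hy
      refine ((hvd y (hsub hy)).mono hsub).sub ?_
      have h2 : HasDerivWithinAt (fun y => p.coeff 0 + p.coeff 1 * y) (dx v ξ)
          (Icc (x j) (x (j + 1))) y := by
        rw [hslope]
        simpa using ((hasDerivWithinAt_id y _).const_mul (p.coeff 1)).const_add (p.coeff 0)
      exact h2.congr (fun z hz => by rw [hp' z hz, hpe]) (by rw [hp' y hy, hpe])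
    have hbd : ∀ y ∈ Icc (x j) (x (j + 1)), ‖dx v y - dx v ξ‖ ≤ 1 * h ^ (0 + 1) * K := by
      intro y hy
      have := hdvL y (hsub hy) ξ (hsub (Ioo_subset_Icc_self hξ))
      refine this.trans ?_
      rw [zero_add, pow_one, one_mul, mul_comm]
      refine mul_le_mul_of_nonneg_right ?_ hdvL.nonneg
      rw [abs_le]
      have := hh j
      constructor <;> linarith [hy.1, hy.2, hξ.1, hξ.2]
    intro y hy z hz
    simpa using (convex_Icc _ _).norm_image_sub_le_of_norm_hasDerivWithin_le hder hbd hz hy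
  · simpa [h0] using hnode' 0 (Nat.zero_le N)
  · simpa [h1] using hnode' N le_rfl

/-- Approximate `v'` by a spline and integrate. Subtracting a constant beforehand makes the integral
match `v` at `1`; this constant is no larger than the error in `v'`, hence the factor `2`. -/
theorem SplineApprox.deriv_succ {m : ℕ} {C : ℝ} (H : SplineApprox m C) :
    SplineApproxDeriv (m + 1) (2 * C) := by
  intro x N h hx h0 h1 hh v K hv hK
  have hud : UniqueDiffOn ℝ (Icc (0 : ℝ) 1) := uniqueDiffOn_Icc zero_lt_one
  have hv' : ContDiffOn ℝ ((m + 2 : ℕ) + 1) v (Icc 0 1) := by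
    refine hv.of_le (le_of_eq ?_)
    push_cast
    ring
  have hdv : ContDiffOn ℝ (m + 2 : ℕ) (dx v) (Icc 0 1) :=
    ((contDiffOn_succ_iff_derivWithin hud).1 hv').2.2
  have hv1 : ContDiffOn ℝ 1 v (Icc 0 1) := hv.of_le (by norm_cast; omega)
  have hvd : ∀ y ∈ Icc (0 : ℝ) 1, HasDerivWithinAt v (dx v y) (Icc 0 1) y := fun y hy =>
    (hv1.differentiableOn one_ne_zero y hy).hasDerivWithinAt
  obtain ⟨s, hs, he⟩ := H x N h hx h0 h1 hh (dx v) K hdv fun y hy => by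
    have := hK y hy
    rw [show m + 1 + 2 = (m + 2) + 1 by ring, iteratedDerivWithin_succ'] at this
    exact this
  -- The mean over `[0,1]` of `s - v'`.
  set c : ℝ := (∫ z in (0 : ℝ)..1, s z) - (v 1 - v 0) with hc
  set E : ℝ := C * h ^ (m + 2) * K with hE
  have hLv := Lip.of_contDiffOn hv1
  have hcE : |c| ≤ E := by
    have hint : IntervalIntegrable (dx v) MeasureTheory.volume 0 1 := by
      apply ContinuousOn.intervalIntegrable
      rw [uIcc_of_le zero_le_one]
      exact hdv.continuousOn
    rw [hc, ← hLv.integral_dx (by simp) (by simp),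
      ← intervalIntegral.integral_sub (hs.continuous.intervalIntegrable _ _) hint,
      ← Real.norm_eq_abs]
    refine (intervalIntegral.norm_integral_le_of_norm_le_const (C := E) fun y hy => ?_).trans
      (by simp)
    rw [uIoc_of_le zero_le_one] at hy
    rw [Real.norm_eq_abs, abs_sub_comm]
    exact he y ⟨hy.1.le, hy.2⟩
  have hs' : Spline x m (fun y => s y - c) := hs.sub (Spline.const c)
  refine ⟨fun y => v 0 + ∫ z in (0 : ℝ)..y, (s z - c), (Spline.const _).add (hs'.integral 0),
    ?_, by simp, ?_⟩
  · have hd : ∀ y, HasDerivAt (fun y => ∫ z in (0 : ℝ)..y, (s z - c)) (s y - c) y := fun y =>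
      intervalIntegral.integral_hasDerivAt_right (hs'.continuous.intervalIntegrable _ _)
        (hs'.continuous.stronglyMeasurableAtFilter _ _) hs'.continuous.continuousAt
    refine lipC_of_hasDerivWithinAt (f' := fun y => dx v y - (s y - c)) (fun y hy => ?_)
      fun y hy => ?_
    · exact (hvd y hy).sub ((hd y).hasDerivWithinAt.const_add _)
    · rw [← sub_add]
      refine (abs_add_le _ _).trans ((add_le_add (he y hy) hcE).trans (le_of_eq ?_))
      rw [hE, show m + 1 + 1 = m + 2 by ring]
      ring
  · simp only []
    rw [intervalIntegral.integral_sub (hs.continuous.intervalIntegrable _ _)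
      intervalIntegrable_const]
    simp [hc]

theorem exists_splineApproxDeriv (m : ℕ) : ∃ C, SplineApproxDeriv m C := by
  induction m with
  | zero => exact ⟨1, splineApproxDeriv_zero⟩
  | succ m ih =>
    obtain ⟨C, hC⟩ := ih
    exact ⟨_, hC.splineApprox.deriv_succ⟩

theorem exists_splineApprox (m : ℕ) : ∃ C, SplineApprox m C :=
  let ⟨_, hC⟩ := exists_splineApproxDeriv m
  ⟨_, hC.splineApprox⟩

/-! ### Inverse inequalities for polynomials on one interval. -/

section inverse

/-- Equivalence of the `L²` norm and the coefficient norm on polynomials of degree at most `n`: a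
polynomial that vanishes on an interval is zero. -/
theorem exists_coeff_bound (n : ℕ) : ∃ m > 0, ∀ c : Fin (n + 1) → ℝ,
    m * ‖c‖ ^ 2 ≤ ∫ y in (0 : ℝ)..1, (∑ i, c i * y ^ (i : ℕ)) ^ 2 := by
  set q : (Fin (n + 1) → ℝ) → ℝ := fun c => ∫ y in (0 : ℝ)..1, (∑ i, c i * y ^ (i : ℕ)) ^ 2 with hq
  have hcont : Continuous q :=
    intervalIntegral.continuous_parametric_intervalIntegral_of_continuous' (by fun_prop) 0 1
  have hpos : ∀ c, c ≠ 0 → 0 < q c := by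
    intro c hc
    have h0 : 0 ≤ q c := intervalIntegral.integral_nonneg zero_le_one fun y _ => sq_nonneg _
    refine lt_of_le_of_ne h0 fun h => hc ?_
    have hz := eq_zero_of_ip_self (f := fun y => ∑ i, c i * y ^ (i : ℕ))
      (by fun_prop) (by rw [h, ip, hq]; simp only [sq])
    let p : Polynomial ℝ := ∑ i : Fin (n + 1), Polynomial.monomial (i : ℕ) (c i)
    have hp : p = 0 := by
      refine Polynomial.eq_zero_of_infinite_isRoot p
        ((Icc_infinite (zero_lt_one (α := ℝ))).mono fun y hy => ?_)
      have := hz y hy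
      simpa [p, Polynomial.IsRoot, Polynomial.eval_finsetSum] using this
    funext i
    have h2 := congrArg (fun p => Polynomial.coeff p (i : ℕ)) hp
    simpa [p, Polynomial.finsetSum_coeff, Polynomial.coeff_monomial, Fin.val_inj] using h2
  refine exists_quadratic_lower_bound hcont (fun s c => ?_) hpos
  simp only [Pi.smul_apply, smul_eq_mul, mul_assoc, ← Finset.mul_sum, mul_pow,
    intervalIntegral.integral_const_mul]

/-- Inverse inequalities on the unit interval. -/
theorem exists_inverse_unit (n : ℕ) : ∃ C ≥ 0, ∀ p : Polynomial ℝ, p.natDegree ≤ n →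
    ∀ y ∈ Icc (0 : ℝ) 1, (p.eval y) ^ 2 ≤ C * ∫ z in (0 : ℝ)..1, (p.eval z) ^ 2 ∧
      (p.derivative.eval y) ^ 2 ≤ C * ∫ z in (0 : ℝ)..1, (p.eval z) ^ 2 := by
  obtain ⟨m, hm, H⟩ := exists_coeff_bound n
  -- On `[0,1]` the polynomial and its derivative are sums of `n + 1` terms of size at most `(n + 1)
  -- * ‖c‖`.
  refine ⟨((n + 1 : ℝ) * (n + 1)) ^ 2 / m, by positivity, fun p hp y hy => ?_⟩
  set c : Fin (n + 1) → ℝ := fun i => p.coeff i with hc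
  have hpe : ∀ z, p.eval z = ∑ i, c i * z ^ (i : ℕ) := fun z => by
    rw [Polynomial.eval_eq_sum_range' (Nat.lt_succ_of_le hp), Finset.sum_range]
  have hco : ∀ i, |p.coeff i| ≤ ‖c‖ := fun i => by
    rcases lt_or_ge i (n + 1) with hi | hi
    · exact norm_le_pi_norm c ⟨i, hi⟩
    · rw [Polynomial.coeff_eq_zero_of_natDegree_lt (by omega), abs_zero]
      exact norm_nonneg _
  have hn1 : (1 : ℝ) ≤ n + 1 := by linarith [(Nat.cast_nonneg n : (0 : ℝ) ≤ n)]
  have hy1 : ∀ i : ℕ, |y ^ i| ≤ 1 := fun i => by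
    rw [abs_pow, abs_of_nonneg hy.1]
    exact pow_le_one₀ hy.1 hy.2
  have key : ∀ w : ℝ, |w| ≤ ((n + 1 : ℝ) * (n + 1)) * ‖c‖ →
      w ^ 2 ≤ ((n + 1 : ℝ) * (n + 1)) ^ 2 / m * ∫ z in (0 : ℝ)..1, (p.eval z) ^ 2 := by
    intro w hw
    have h1 := H c
    simp only [← hpe] at h1
    calc w ^ 2 = |w| ^ 2 := (sq_abs w).symm
      _ ≤ (((n + 1 : ℝ) * (n + 1)) * ‖c‖) ^ 2 := by gcongr
      _ = ((n + 1 : ℝ) * (n + 1)) ^ 2 / m * (m * ‖c‖ ^ 2) := by field_simp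
      _ ≤ _ := by gcongr
  constructor
  · apply key
    rw [Polynomial.eval_eq_sum_range' (Nat.lt_succ_of_le hp)]
    calc |∑ i ∈ Finset.range (n + 1), p.coeff i * y ^ i|
        ≤ ∑ i ∈ Finset.range (n + 1), ‖c‖ := by
          refine (Finset.abs_sum_le_sum_abs _ _).trans (Finset.sum_le_sum fun i _ => ?_)
          rw [abs_mul]
          exact (mul_le_of_le_one_right (abs_nonneg _) (hy1 i)).trans (hco i)
      _ = (n + 1) * ‖c‖ := by simp
      _ ≤ _ := by
          gcongr
          nlinarith
  · apply key
    have hd : p.derivative.natDegree < n + 1 :=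
      Nat.lt_succ_of_le ((Polynomial.natDegree_derivative_le p).trans (by omega))
    rw [Polynomial.eval_eq_sum_range' hd]
    calc |∑ i ∈ Finset.range (n + 1), p.derivative.coeff i * y ^ i|
        ≤ ∑ i ∈ Finset.range (n + 1), (n + 1) * ‖c‖ := by
          refine (Finset.abs_sum_le_sum_abs _ _).trans (Finset.sum_le_sum fun i hi => ?_)
          rw [abs_mul]
          refine (mul_le_of_le_one_right (abs_nonneg _) (hy1 i)).trans ?_
          rw [Polynomial.coeff_derivative, abs_mul, mul_comm]
          have hi' : (i : ℝ) + 1 ≤ n + 1 := by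
            have := Finset.mem_range.1 hi
            exact_mod_cast this
          rw [abs_of_nonneg (by positivity)]
          exact mul_le_mul hi' (hco _) (abs_nonneg _) (by positivity)
      _ = ((n + 1 : ℝ) * (n + 1)) * ‖c‖ := by
          simp
          ring

/-- Inverse inequalities on an interval. -/
theorem exists_inverse_interval (n : ℕ) : ∃ C ≥ 0, ∀ p : Polynomial ℝ, p.natDegree ≤ n →
    ∀ a b : ℝ, a < b → ∀ y ∈ Icc a b,
      (b - a) * (p.eval y) ^ 2 ≤ C * ∫ z in a..b, (p.eval z) ^ 2 ∧
      (b - a) ^ 3 * (p.derivative.eval y) ^ 2 ≤ C * ∫ z in a..b, (p.eval z) ^ 2 := by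
  obtain ⟨C, hC, H⟩ := exists_inverse_unit n
  refine ⟨C, hC, fun p hp a b hab y hy => ?_⟩
  have hL : 0 < b - a := sub_pos.2 hab
  -- Pullback to the unit interval: the integral scales by `b - a`, and the squared derivative by
  -- `(b - a) ^ 2`.
  set P : Polynomial ℝ := p.comp (Polynomial.C a + Polynomial.C (b - a) * Polynomial.X) with hP
  have hPd : P.natDegree ≤ n := by
    refine Polynomial.natDegree_comp_le.trans ?_
    have : (Polynomial.C a + Polynomial.C (b - a) * Polynomial.X).natDegree ≤ 1 := by
      refine (Polynomial.natDegree_add_le _ _).trans (max_le (by simp) ?_)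
      exact (Polynomial.natDegree_C_mul_le _ _).trans (by simp)
    calc p.natDegree * _ ≤ p.natDegree * 1 := Nat.mul_le_mul_left _ this
      _ ≤ n := by omega
  have hPe : ∀ z, P.eval z = p.eval (a + (b - a) * z) := fun z => by simp [hP]
  have hint : (b - a) * ∫ z in (0 : ℝ)..1, (P.eval z) ^ 2 = ∫ z in a..b, (p.eval z) ^ 2 := by
    simp only [hPe]
    rw [intervalIntegral.mul_integral_comp_add_mul (f := fun z => (p.eval z) ^ 2)]
    simp
  have hy' : a + (b - a) * ((y - a) / (b - a)) = y := by field_simp; ring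
  obtain ⟨h1, h2⟩ := H P hPd ((y - a) / (b - a))
    ⟨div_nonneg (by linarith [hy.1]) hL.le, (div_le_one hL).2 (by linarith [hy.2])⟩
  have hPd' : P.derivative.eval ((y - a) / (b - a)) = (b - a) * p.derivative.eval y := by
    rw [hP, Polynomial.derivative_comp]
    simp [hy']
  rw [hPe, hy'] at h1
  rw [hPd'] at h2
  rw [← hint]
  constructor
  · calc (b - a) * (p.eval y) ^ 2 ≤ (b - a) * (C * ∫ z in (0 : ℝ)..1, (P.eval z) ^ 2) := by gcongr
      _ = _ := by ring
  · calc (b - a) ^ 3 * (p.derivative.eval y) ^ 2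
        = (b - a) * ((b - a) * p.derivative.eval y) ^ 2 := by ring
      _ ≤ (b - a) * (C * ∫ z in (0 : ℝ)..1, (P.eval z) ^ 2) := by gcongr
      _ = _ := by ring

end inverse

/-! ### Meshes and finite element functions. -/

namespace Mesh

variable (M : Mesh)

theorem N_pos : 0 < M.N := by
  rcases Nat.eq_zero_or_pos M.N with h | h
  · exfalso
    have h1 : (0 : Fin (M.N + 1)) = Fin.last M.N := by
      ext
      simp [h]
    have := M.first
    rw [h1, M.last] at this
    exact one_ne_zero this
  · exact h

theorem gap_pos (i : Fin M.N) : 0 < M.x i.succ - M.x i.castSucc :=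
  sub_pos.2 (M.strictMono i.castSucc_lt_succ)

theorem gap_le (i : Fin M.N) : M.x i.succ - M.x i.castSucc ≤ M.h :=
  le_ciSup (f := fun i : Fin M.N => M.x i.succ - M.x i.castSucc) (Set.finite_range _).bddAbove i

theorem h_pos : 0 < M.h := (M.gap_pos ⟨0, M.N_pos⟩).trans_le (M.gap_le _)

/-- The nodes, continued beyond `1` with spacing `h`. -/
noncomputable def node (n : ℕ) : ℝ :=
  if hn : n ≤ M.N then M.x ⟨n, Nat.lt_succ_of_le hn⟩ else 1 + (n - M.N : ℝ) * M.h

theorem node_castSucc (i : Fin M.N) : M.node i = M.x i.castSucc := by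
  rw [node, dif_pos i.2.le]
  rfl

theorem node_succ (i : Fin M.N) : M.node (i + 1) = M.x i.succ := by
  rw [node, dif_pos (Nat.succ_le_of_lt i.2)]
  rfl

theorem node_zero : M.node 0 = 0 := by
  rw [node, dif_pos (Nat.zero_le _)]
  exact M.first

theorem node_N : M.node M.N = 1 := by
  rw [node, dif_pos le_rfl]
  exact M.last

theorem node_gap_of_ge {n : ℕ} (hn : M.N ≤ n) : M.node (n + 1) - M.node n = M.h := by
  have h1 : M.node (n + 1) = 1 + ((n + 1 : ℕ) - M.N : ℝ) * M.h := by
    rw [node, dif_neg (by omega)]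
  have h2 : M.node n = 1 + (n - M.N : ℝ) * M.h := by
    rcases eq_or_lt_of_le hn with rfl | hn
    · rw [node_N]
      ring
    · rw [node, dif_neg (by omega)]
  rw [h1, h2]
  push_cast
  ring

theorem node_gap_le (n : ℕ) : M.node (n + 1) - M.node n ≤ M.h := by
  rcases lt_or_ge n M.N with hn | hn
  · have := M.gap_le ⟨n, hn⟩
    rwa [← node_succ, ← node_castSucc] at this
  · exact (M.node_gap_of_ge hn).le

theorem node_lt_succ (n : ℕ) : M.node n < M.node (n + 1) := by
  rw [← sub_pos]
  rcases lt_or_ge n M.N with hn | hn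
  · have := M.gap_pos ⟨n, hn⟩
    rwa [← node_succ, ← node_castSucc] at this
  · rw [M.node_gap_of_ge hn]
    exact M.h_pos

theorem node_strictMono : StrictMono M.node := strictMono_nat_of_lt_succ M.node_lt_succ

theorem node_mem {n : ℕ} (hn : n ≤ M.N) : M.node n ∈ Icc (0 : ℝ) 1 :=
  ⟨M.node_zero ▸ M.node_strictMono.monotone (Nat.zero_le n),
    M.node_N ▸ M.node_strictMono.monotone hn⟩

theorem elem_subset {n : ℕ} (hn : n < M.N) : Icc (M.node n) (M.node (n + 1)) ⊆ Icc 0 1 :=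
  Icc_subset_Icc (M.node_mem hn.le).1 (M.node_mem hn).2

theorem Quasiuniform.node {M : Mesh} {γ : ℝ} (hM : M.Quasiuniform γ) {n : ℕ} (hn : n < M.N) :
    M.h ≤ γ * (M.node (n + 1) - M.node n) := by
  have := hM ⟨n, hn⟩
  rwa [← node_succ, ← node_castSucc] at this

theorem Quasiuniform.pos {M : Mesh} {γ : ℝ} (hM : M.Quasiuniform γ) : 0 < γ := by
  have h1 := hM.node M.N_pos
  have h2 := M.node_lt_succ 0
  exact pos_of_mul_pos_left (M.h_pos.trans_le h1) (sub_pos.2 h2).le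

end Mesh

theorem Spline.memSh {M : Mesh} {m k : ℕ} (hk : k ≤ m) {s : ℝ → ℝ} (hs : Spline M.node m s) :
    MemSh (m + 2) k M s := by
  refine ⟨(hs.1.of_le (by exact_mod_cast hk)).contDiffOn, fun i => ?_⟩
  obtain ⟨p, hp, hp'⟩ := hs.2 i
  refine ⟨p, hp, ?_⟩
  rwa [M.node_castSucc, M.node_succ] at hp'

namespace MemSh

variable {r k : ℕ} {M : Mesh} {φ ψ : ℝ → ℝ}

theorem elem (hφ : MemSh r k M φ) {n : ℕ} (hn : n < M.N) : ∃ p : Polynomial ℝ,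
    p.natDegree ≤ r - 1 ∧ ∀ y ∈ Icc (M.node n) (M.node (n + 1)), φ y = p.eval y := by
  obtain ⟨p, hp, hp'⟩ := hφ.2 ⟨n, hn⟩
  rw [← M.node_castSucc, ← M.node_succ] at hp'
  exact ⟨p, hp, hp'⟩

theorem congr (hφ : MemSh r k M φ) (h : EqOn ψ φ (Icc 0 1)) : MemSh r k M ψ := by
  refine ⟨hφ.1.congr h, fun i => ?_⟩
  obtain ⟨p, hp, hp'⟩ := hφ.2 i
  refine ⟨p, hp, fun y hy => ?_⟩
  rw [← M.node_castSucc, ← M.node_succ] at hy hp'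
  rw [h (M.elem_subset i.2 hy), hp' y hy]

theorem add (hφ : MemSh r k M φ) (hψ : MemSh r k M ψ) : MemSh r k M (φ + ψ) := by
  refine ⟨hφ.1.add hψ.1, fun i => ?_⟩
  obtain ⟨p, hp, hp'⟩ := hφ.2 i
  obtain ⟨q, hq, hq'⟩ := hψ.2 i
  exact ⟨p + q, (Polynomial.natDegree_add_le _ _).trans (max_le hp hq), fun y hy => by
    rw [Pi.add_apply, hp' y hy, hq' y hy, Polynomial.eval_add]⟩

theorem smul (c : ℝ) (hφ : MemSh r k M φ) : MemSh r k M (c • φ) := by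
  refine ⟨contDiffOn_const.smul hφ.1, fun i => ?_⟩
  obtain ⟨p, hp, hp'⟩ := hφ.2 i
  exact ⟨Polynomial.C c * p, (Polynomial.natDegree_C_mul_le _ _).trans hp, fun y hy => by
    rw [Pi.smul_apply, hp' y hy, Polynomial.eval_mul, Polynomial.eval_C, smul_eq_mul]⟩

theorem zero : MemSh r k M 0 :=
  ⟨contDiffOn_const, fun _ => ⟨0, by simp, by simp⟩⟩

theorem sub (hφ : MemSh r k M φ) (hψ : MemSh r k M ψ) : MemSh r k M (fun x => φ x - ψ x) := by
  refine (hφ.add (hψ.smul (-1))).congr fun x _ => ?_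
  simp [sub_eq_add_neg]

theorem lipC_of_elem (hφ : MemSh r k M φ) {K : ℝ}
    (h : ∀ n < M.N, ∀ p : Polynomial ℝ, p.natDegree ≤ r - 1 →
      (∀ y ∈ Icc (M.node n) (M.node (n + 1)), φ y = p.eval y) →
      ∀ y ∈ Icc (M.node n) (M.node (n + 1)), |p.derivative.eval y| ≤ K) : LipC K φ := by
  have := lipschitz_glue M.node_strictMono.monotone (f := φ) (K := K) M.N fun n hn y hy z hz => ?_
  · rw [M.node_zero, M.node_N] at this
    exact this
  obtain ⟨p, hp, hp'⟩ := hφ.elem hn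
  rw [hp' y hy, hp' z hz]
  simpa using (convex_Icc (M.node n) (M.node (n + 1))).norm_image_sub_le_of_norm_hasDerivWithin_le
    (fun x _ => (p.hasDerivAt x).hasDerivWithinAt) (h n hn p hp hp') hz hy

/-- Purely qualitative: the constant depends on `φ`. It makes the calculus of Lipschitz functions
available for every `k`, including `k = 0`. -/
theorem lip (hφ : MemSh r k M φ) : Lip φ := by
  have hbd : ∀ n : Fin M.N, ∃ K : ℝ, ∀ p : Polynomial ℝ,
      (∀ y ∈ Icc (M.node n) (M.node (n + 1)), φ y = p.eval y) →
      ∀ y ∈ Icc (M.node n) (M.node (n + 1)), |p.derivative.eval y| ≤ K := by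
    intro n
    obtain ⟨q, hq, hq'⟩ := hφ.elem n.2
    obtain ⟨K, hK⟩ := isCompact_Icc.exists_bound_of_continuousOn
      (q.derivative.continuous.continuousOn (s := Icc (M.node n) (M.node (n + 1))))
    refine ⟨K, fun p hp y hy => ?_⟩
    have : p = q := by
      refine Polynomial.eq_of_infinite_eval_eq p q
        ((Icc_infinite (M.node_lt_succ n)).mono fun z hz => ?_)
      exact (hp z hz).symm.trans (hq' z hz)
    rw [this]
    exact hK y hy
  choose K hK using hbd
  refine ⟨∑ n, |K n|, hφ.lipC_of_elem fun n hn p _ hp y hy => ?_⟩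
  refine (hK ⟨n, hn⟩ p hp y hy).trans ((le_abs_self _).trans ?_)
  exact Finset.single_le_sum (f := fun i => |K i|) (fun i _ => abs_nonneg _)
    (Finset.mem_univ (⟨n, hn⟩ : Fin M.N))

theorem dx_elem {n : ℕ} (hn : n < M.N) {p : Polynomial ℝ}
    (hp : ∀ y ∈ Icc (M.node n) (M.node (n + 1)), φ y = p.eval y) {y : ℝ}
    (hy : y ∈ Ioo (M.node n) (M.node (n + 1))) : dx φ y = p.derivative.eval y := by
  have h1 : Icc (M.node n) (M.node (n + 1)) ∈ nhds y := Icc_mem_nhds hy.1 hy.2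
  rw [dx, derivWithin_of_mem_nhds (Filter.mem_of_superset h1 (M.elem_subset hn))]
  have : φ =ᶠ[nhds y] fun z => p.eval z := Filter.eventually_of_mem h1 hp
  rw [this.deriv_eq, Polynomial.deriv]

theorem integral_dx_elem {n : ℕ} (hn : n < M.N) {p : Polynomial ℝ}
    (hp : ∀ y ∈ Icc (M.node n) (M.node (n + 1)), φ y = p.eval y) :
    ∫ y in M.node n..M.node (n + 1), dx φ y * dx φ y =
      ∫ y in M.node n..M.node (n + 1), (p.derivative.eval y) ^ 2 := by
  rw [intervalIntegral.integral_of_le (M.node_lt_succ n).le,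
    intervalIntegral.integral_of_le (M.node_lt_succ n).le, integral_Ioc_eq_integral_Ioo,
    integral_Ioc_eq_integral_Ioo]
  refine setIntegral_congr_fun measurableSet_Ioo fun y hy => ?_
  simp only [dx_elem hn hp hy, sq]

end MemSh

theorem BM.intervalIntegrable {f : ℝ → ℝ} (hf : BM f) {a b : ℝ} (ha : a ∈ Icc (0 : ℝ) 1)
    (hb : b ∈ Icc (0 : ℝ) 1) : IntervalIntegrable f volume a b := by
  have h1 : IntervalIntegrable f volume 0 1 := by
    rw [intervalIntegrable_iff_integrableOn_Ioo_of_le zero_le_one]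
    exact hf.integrable
  refine h1.mono_set ?_
  rw [uIcc_of_le zero_le_one]
  exact (convex_Icc (0 : ℝ) 1).ordConnected.uIcc_subset ha hb

theorem ip_self_eq_sum (M : Mesh) {f : ℝ → ℝ} (hf : BM f) :
    ip f f = ∑ n ∈ Finset.range M.N, ∫ y in M.node n..M.node (n + 1), f y * f y := by
  rw [intervalIntegral.sum_integral_adjacent_intervals fun n hn =>
    (hf.mul hf).intervalIntegrable (M.node_mem hn.le) (M.node_mem hn), M.node_zero, M.node_N, ip]

theorem integral_elem_le_ip {M : Mesh} {f : ℝ → ℝ} (hf : BM f) {n : ℕ} (hn : n < M.N) :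
    ∫ y in M.node n..M.node (n + 1), f y * f y ≤ ip f f := by
  rw [ip_self_eq_sum M hf]
  exact Finset.single_le_sum (f := fun n => ∫ y in M.node n..M.node (n + 1), f y * f y)
    (fun i _ => intervalIntegral.integral_nonneg (M.node_lt_succ i).le fun y _ =>
      mul_self_nonneg _) (Finset.mem_range.2 hn)

/-! ### Inverse inequalities on quasiuniform meshes. -/

/-- The inverse inequality between `L²` norms of a finite element function and its derivative. -/
theorem exists_inverse_L2 (r : ℕ) (γ : ℝ) : ∃ C ≥ 0, ∀ (k : ℕ) (M : Mesh) (φ : ℝ → ℝ),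
    M.Quasiuniform γ → MemSh r k M φ → M.h ^ 2 * ip (dx φ) (dx φ) ≤ C * ip φ φ := by
  obtain ⟨C, hC, H⟩ := exists_inverse_interval (r - 1)
  refine ⟨γ ^ 2 * C, by positivity, fun k M φ hM hφ => ?_⟩
  rw [ip_self_eq_sum M hφ.lip.bm_dx, ip_self_eq_sum M hφ.lip.bm, Finset.mul_sum, Finset.mul_sum]
  refine Finset.sum_le_sum fun n hn => ?_
  have hn := Finset.mem_range.1 hn
  obtain ⟨p, hp, hp'⟩ := hφ.elem hn
  have hlt := M.node_lt_succ n
  set a := M.node n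
  set b := M.node (n + 1)
  have hL : 0 < b - a := sub_pos.2 hlt
  rw [MemSh.integral_dx_elem hn hp']
  have e1 : ∫ y in a..b, φ y * φ y = ∫ y in a..b, (p.eval y) ^ 2 := by
    refine intervalIntegral.integral_congr fun y hy => ?_
    rw [uIcc_of_le hlt.le] at hy
    simp only [hp' y hy, sq]
  rw [e1]
  set I := ∫ y in a..b, (p.eval y) ^ 2
  have e2 : ∫ y in a..b, (p.derivative.eval y) ^ 2 ≤ ∫ y in a..b, C * I / (b - a) ^ 3 := by
    refine intervalIntegral.integral_mono_on hlt.le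
      ((p.derivative.continuous.pow 2).intervalIntegrable _ _) intervalIntegrable_const
      fun y hy => ?_
    rw [le_div_iff₀ (by positivity), mul_comm]
    exact (H p hp a b hlt y hy).2
  rw [intervalIntegral.integral_const, smul_eq_mul] at e2
  have hh := hM.node hn
  have hI : 0 ≤ I := intervalIntegral.integral_nonneg hlt.le fun y _ => sq_nonneg _
  -- Integrating the pointwise bound leaves `(b - a)⁻²`, which quasiuniformity absorbs into `h ^ 2`.
  calc M.h ^ 2 * ∫ y in a..b, (p.derivative.eval y) ^ 2
      ≤ (γ * (b - a)) ^ 2 * ((b - a) * (C * I / (b - a) ^ 3)) := by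
        have := M.h_pos.le
        have h3 : 0 ≤ ∫ y in a..b, (p.derivative.eval y) ^ 2 :=
          intervalIntegral.integral_nonneg hlt.le fun y _ => sq_nonneg _
        gcongr
    _ = γ ^ 2 * C * I := by field_simp

/-- The inverse inequality between the maximum norm and the `L²` norm of the derivative. -/
theorem exists_inverse_max (r : ℕ) (γ : ℝ) : ∃ C ≥ 0, ∀ (k : ℕ) (M : Mesh) (φ : ℝ → ℝ) (K : ℝ),
    M.Quasiuniform γ → MemSh r k M φ → 0 ≤ K → C * ip (dx φ) (dx φ) ≤ M.h * K ^ 2 →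
    LipC K φ := by
  obtain ⟨C, hC, H⟩ := exists_inverse_interval (r - 1)
  -- The sign of `γ` is only known once a quasiuniform mesh is given; the absolute value keeps the
  -- constant nonnegative.
  refine ⟨|γ| * C, by positivity, fun k M φ K hM hφ hK hle => ?_⟩
  refine hφ.lipC_of_elem fun n hn p hp hp' y hy => ?_
  have hlt := M.node_lt_succ n
  have hL := sub_pos.2 hlt
  have h1 := (H p.derivative ((Polynomial.natDegree_derivative_le p).trans (by omega)) _ _ hlt
    y hy).1
  rw [← MemSh.integral_dx_elem hn hp'] at h1
  have h2 := integral_elem_le_ip hφ.lip.bm_dx hn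
  have h3 := hM.node hn
  have hγ := hM.pos
  rw [abs_of_pos hγ] at hle
  have hh := M.h_pos
  apply abs_le_of_sq_le_sq _ hK
  refine le_of_mul_le_mul_left ?_ hh
  calc M.h * p.derivative.eval y ^ 2
      ≤ γ * (M.node (n + 1) - M.node n) * p.derivative.eval y ^ 2 := by gcongr
    _ = γ * ((M.node (n + 1) - M.node n) * p.derivative.eval y ^ 2) := by ring
    _ ≤ γ * (C * ip (dx φ) (dx φ)) := by
        refine mul_le_mul_of_nonneg_left (h1.trans ?_) hγ.le
        exact mul_le_mul_of_nonneg_left h2 hC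
    _ = γ * C * ip (dx φ) (dx φ) := by ring
    _ ≤ _ := hle

/-! ### Coordinates on the finite element spaces. -/

/-- Coordinates on a space of functions on `[0,1]`: a linear parametrization `B`, inverted by a
linear function `ℓ` of the values at finitely many points. -/
structure Coords (Vp : (ℝ → ℝ) → Prop) where
  n : ℕ
  ι : Type
  fin : Fintype ι
  pts : ι → ℝ
  pts_mem : ∀ i, pts i ∈ Icc (0 : ℝ) 1
  B : (Fin n → ℝ) →ₗ[ℝ] (ℝ → ℝ)
  ℓ : (ι → ℝ) →ₗ[ℝ] (Fin n → ℝ)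
  mem : ∀ c, Vp (B c)
  B_ℓ : ∀ φ, Vp φ → EqOn (B (ℓ fun i => φ (pts i))) φ (Icc 0 1)
  ℓ_B : ∀ c, (ℓ fun i => B c (pts i)) = c

/-- Functions are unconstrained outside `[0,1]`, so the space itself need not be finite-dimensional.
Its image under evaluation at separating points is; a basis of the image is lifted to functions. -/
theorem exists_coords {Vp : (ℝ → ℝ) → Prop} (hadd : ∀ f g, Vp f → Vp g → Vp (f + g))
    (hsmul : ∀ (c : ℝ) f, Vp f → Vp (c • f)) (hzero : Vp 0) {ι : Type} [Fintype ι] (pts : ι → ℝ)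
    (hpts : ∀ i, pts i ∈ Icc (0 : ℝ) 1)
    (hsep : ∀ f, Vp f → (∀ i, f (pts i) = 0) → ∀ x ∈ Icc (0 : ℝ) 1, f x = 0) :
    Nonempty (Coords Vp) := by
  let V : Submodule ℝ (ℝ → ℝ) :=
    { carrier := {f | Vp f}
      add_mem' := fun {f g} hf hg => hadd f g hf hg
      zero_mem' := hzero
      smul_mem' := fun c f hf => hsmul c f hf }
  let ev : (ℝ → ℝ) →ₗ[ℝ] (ι → ℝ) := LinearMap.funLeft ℝ ℝ pts
  let W : Submodule ℝ (ι → ℝ) := V.map ev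
  let b := Module.finBasis ℝ W
  have hφ : ∀ i, ∃ f, Vp f ∧ ev f = b i := fun i => by
    obtain ⟨f, hf, hf'⟩ := Submodule.mem_map.1 (b i).2
    exact ⟨f, hf, hf'⟩
  choose φ hφ hφ' using hφ
  -- A linear retraction onto `W`, so that `ℓ` is defined on all vectors of values.
  obtain ⟨π, hπ⟩ := W.subtype.exists_leftInverse_of_injective
    (LinearMap.ker_eq_bot.2 W.injective_subtype)
  have hπ' : ∀ w : W, π w = w := fun w => congrArg (fun f => f w) hπ
  have hB : ∀ c : Fin (Module.finrank ℝ W) → ℝ, Vp (Fintype.linearCombination ℝ φ c) := fun c => by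
    rw [Fintype.linearCombination_apply]
    exact V.sum_mem fun i _ => V.smul_mem _ (hφ i)
  have hevB : ∀ c : Fin (Module.finrank ℝ W) → ℝ,
      ev (Fintype.linearCombination ℝ φ c) = (b.equivFun.symm c : W) := fun c => by
    rw [Fintype.linearCombination_apply, map_sum, Module.Basis.equivFun_symm_apply]
    push_cast
    simp [hφ']
  refine ⟨⟨Module.finrank ℝ W, ι, inferInstance, pts, hpts, Fintype.linearCombination ℝ φ,
    b.equivFun.toLinearMap ∘ₗ π, hB, fun f hf x hx => ?_, fun c => ?_⟩⟩
  · have hmem : ev f ∈ W := Submodule.mem_map_of_mem (show f ∈ V from hf)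
    set c := (b.equivFun.toLinearMap ∘ₗ π) fun i => f (pts i) with hc
    have hc' : c = b.equivFun ⟨ev f, hmem⟩ := congrArg b.equivFun (hπ' ⟨ev f, hmem⟩)
    have hev : ev (Fintype.linearCombination ℝ φ c) = ev f := by
      rw [hevB, hc', LinearEquiv.symm_apply_apply]
    have h2 := hsep (Fintype.linearCombination ℝ φ c + (-1 : ℝ) • f)
      (hadd _ _ (hB c) (hsmul _ _ hf)) (fun i => ?_) x hx
    · simp only [Pi.add_apply, Pi.smul_apply, smul_eq_mul] at h2
      linarith
    · have := congrFun hev i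
      simp only [ev, LinearMap.funLeft_apply] at this
      simp [this]
  · have : (fun i => Fintype.linearCombination ℝ φ c (pts i)) = (b.equivFun.symm c : W) := hevB c
    rw [this, LinearMap.comp_apply, hπ']
    exact b.equivFun.apply_symm_apply c

/-- On each element `r` distinct points determine a polynomial of degree at most `r - 1`. -/
theorem exists_separating (r k : ℕ) (hr : 1 ≤ r) (M : Mesh) : ∃ pts : Fin M.N × Fin r → ℝ,
    (∀ i, pts i ∈ Icc (0 : ℝ) 1) ∧
    ∀ f, MemSh r k M f → (∀ i, f (pts i) = 0) → ∀ x ∈ Icc (0 : ℝ) 1, f x = 0 := by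
  let pts : Fin M.N × Fin r → ℝ := fun i =>
    M.node i.1 + (i.2 : ℝ) / r * (M.node (i.1 + 1) - M.node i.1)
  have hr' : (0 : ℝ) < r := by exact_mod_cast hr
  have hmem : ∀ i, pts i ∈ Icc (M.node i.1) (M.node (i.1 + 1)) := fun i => by
    have h1 := sub_pos.2 (M.node_lt_succ i.1)
    have h2 : (i.2 : ℝ) / r ≤ 1 := (div_le_one hr').2 (by exact_mod_cast i.2.2.le)
    have h3 : (0 : ℝ) ≤ (i.2 : ℝ) / r := by positivity
    constructor
    · simp only [pts]
      nlinarith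
    · simp only [pts]
      nlinarith
  refine ⟨pts, fun i => M.elem_subset i.1.2 (hmem i), fun f hf h0 => ?_⟩
  have hL : LipC 0 f := by
    refine hf.lipC_of_elem fun n hn p hp hp' y hy => ?_
    have hp0 : p = 0 := by
      refine Polynomial.eq_zero_of_natDegree_lt_card_of_eval_eq_zero p
        (f := fun j : Fin r => pts (⟨n, hn⟩, j)) (fun i j hij => ?_) (fun j => ?_) ?_
      · have h1 := sub_pos.2 (M.node_lt_succ n)
        simp only [pts, add_right_inj, mul_eq_mul_right_iff, h1.ne', or_false] at hij
        rw [div_left_inj' hr'.ne'] at hij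
        exact Fin.ext (by exact_mod_cast hij)
      · rw [← hp' _ (hmem (⟨n, hn⟩, j))]
        exact h0 _
      · rw [Fintype.card_fin]
        omega
    simp [hp0]
  have hp0 := h0 (⟨0, M.N_pos⟩, ⟨0, hr⟩)
  intro x hx
  have := hL x hx _ (M.elem_subset M.N_pos (hmem (⟨0, M.N_pos⟩, ⟨0, hr⟩)))
  rw [hp0, zero_mul, sub_zero] at this
  exact abs_nonpos_iff.1 this

theorem exists_coords_Sh (r k : ℕ) (hr : 1 ≤ r) (M : Mesh) : Nonempty (Coords (MemSh r k M)) := by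
  obtain ⟨pts, h1, h2⟩ := exists_separating r k hr M
  exact exists_coords (fun _ _ => MemSh.add) (fun c _ => MemSh.smul c) MemSh.zero pts h1 h2

theorem exists_coords_Sh0 (r k : ℕ) (hr : 1 ≤ r) (M : Mesh) :
    Nonempty (Coords (MemSh0 r k M)) := by
  obtain ⟨pts, h1, h2⟩ := exists_separating r k hr M
  refine exists_coords (fun f g hf hg => ⟨hf.1.add hg.1, ?_, ?_⟩)
    (fun c f hf => ⟨hf.1.smul c, ?_, ?_⟩) ⟨MemSh.zero, rfl, rfl⟩ pts h1 fun f hf => h2 f hf.1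
  · simp [hf.2.1, hg.2.1]
  · simp [hf.2.2, hg.2.2]
  · simp [hf.2.1]
  · simp [hf.2.2]

namespace Coords

variable {Vp : (ℝ → ℝ) → Prop} (X : Coords Vp)

/-- The coordinates of a function. -/
noncomputable def coord (φ : ℝ → ℝ) : Fin X.n → ℝ := X.ℓ fun i => φ (X.pts i)

theorem B_coord {φ : ℝ → ℝ} (hφ : Vp φ) : EqOn (X.B (X.coord φ)) φ (Icc 0 1) := X.B_ℓ φ hφ

theorem coord_B (c : Fin X.n → ℝ) : X.coord (X.B c) = c := X.ℓ_B c

theorem coord_congr {φ ψ : ℝ → ℝ} (h : EqOn φ ψ (Icc 0 1)) : X.coord φ = X.coord ψ :=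
  congrArg X.ℓ (funext fun i => h (X.pts_mem i))

theorem eq_zero_of_B {c : Fin X.n → ℝ} (h : ∀ x ∈ Icc (0 : ℝ) 1, X.B c x = 0) : c = 0 := by
  rw [← X.coord_B c, X.coord_congr (ψ := X.B 0) fun x hx => by rw [h x hx]; simp, X.coord_B]

theorem hasDerivWithinAt_B {c : ℝ → Fin X.n → ℝ} {c' : Fin X.n → ℝ} {s : Set ℝ} {t : ℝ}
    (h : HasDerivWithinAt c c' s t) (x : ℝ) :
    HasDerivWithinAt (fun t => X.B (c t) x) (X.B c' x) s t := by
  let L : (Fin X.n → ℝ) →L[ℝ] ℝ := ((LinearMap.proj x).comp X.B).toContinuousLinearMap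
  exact L.hasFDerivAt.comp_hasDerivWithinAt t h

theorem hasDerivWithinAt_coord {w : ℝ → ℝ → ℝ} {w' : ℝ → ℝ} {s : Set ℝ} {t : ℝ}
    (h : ∀ x ∈ Icc (0 : ℝ) 1, HasDerivWithinAt (fun t => w t x) (w' x) s t) :
    HasDerivWithinAt (fun t => X.coord (w t)) (X.coord w') s t := by
  have := X.fin
  let L : (X.ι → ℝ) →L[ℝ] (Fin X.n → ℝ) := X.ℓ.toContinuousLinearMap
  have h1 : HasDerivWithinAt (fun t => fun i => w t (X.pts i)) (fun i => w' (X.pts i)) s t :=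
    hasDerivWithinAt_pi.2 fun i => h _ (X.pts_mem i)
  exact L.hasFDerivAt.comp_hasDerivWithinAt t h1

end Coords

/-! ### Differentiation in time of integrals and of spatial derivatives. -/

theorem HasDerivWithinAt.of_remainder {f : ℝ → ℝ} {f' t : ℝ} {s : Set ℝ}
    (h : ∀ e > 0, ∃ δ > 0, ∀ τ ∈ s, |τ - t| < δ → |f τ - f t - (τ - t) * f'| ≤ e * |τ - t|) :
    HasDerivWithinAt f f' s t := by
  rw [hasDerivWithinAt_iff_isLittleO, Asymptotics.isLittleO_iff]
  intro e he
  obtain ⟨δ, hδ, H⟩ := h e he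
  filter_upwards [self_mem_nhdsWithin, mem_nhdsWithin_of_mem_nhds (Metric.ball_mem_nhds t hδ)]
    with τ h1 h2
  simpa [Real.norm_eq_abs] using H τ h1 (by simpa [Real.dist_eq] using h2)

theorem continuousOn_uniform_time {T : ℝ} {w : ℝ → ℝ → ℝ}
    (hw : ContinuousOn (fun p : ℝ × ℝ => w p.1 p.2) (Icc 0 T ×ˢ Icc 0 1)) {t : ℝ}
    (ht : t ∈ Icc 0 T) {e : ℝ} (he : 0 < e) :
    ∃ δ > 0, ∀ τ ∈ Icc 0 T, |τ - t| < δ → ∀ x ∈ Icc (0 : ℝ) 1, |w τ x - w t x| ≤ e := by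
  have hu := (isCompact_Icc.prod isCompact_Icc).uniformContinuousOn_of_continuous hw
  obtain ⟨δ, hδ, H⟩ := Metric.uniformContinuousOn_iff.1 hu e he
  refine ⟨δ, hδ, fun τ hτ hd x hx => ?_⟩
  have := H (τ, x) ⟨hτ, hx⟩ (t, x) ⟨ht, hx⟩ (by simpa [Prod.dist_eq, Real.dist_eq] using hd)
  exact this.le

/-- Mean value inequality for `f s - s * c`. Used with a modulus `e` that is uniform in space, so
that the remainder can be integrated in `x` or read as a Lipschitz bound in `x`. -/
theorem time_remainder {T : ℝ} {f f' : ℝ → ℝ} {t τ e : ℝ} (c : ℝ) (ht : t ∈ Icc 0 T)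
    (hτ : τ ∈ Icc 0 T)
    (hf : ∀ s ∈ Icc 0 T, HasDerivWithinAt f (f' s) (Icc 0 T) s)
    (hb : ∀ s ∈ Icc 0 T, |s - t| ≤ |τ - t| → |f' s - c| ≤ e) :
    |f τ - f t - (τ - t) * c| ≤ e * |τ - t| := by
  have hsub : uIcc t τ ⊆ Icc 0 T := (convex_Icc 0 T).ordConnected.uIcc_subset ht hτ
  have hd : ∀ s ∈ uIcc t τ, HasDerivWithinAt (fun s => f s - s * c) (f' s - 1 * c) (uIcc t τ) s :=
    fun s hs => ((hf s (hsub hs)).mono hsub).sub ((hasDerivWithinAt_id s _).mul_const c)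
  have := (convex_uIcc t τ).norm_image_sub_le_of_norm_hasDerivWithin_le (C := e) hd
    (fun s hs => by
      rw [one_mul]
      exact hb s (hsub hs) (abs_sub_left_of_mem_uIcc hs)) left_mem_uIcc right_mem_uIcc
  rw [Real.norm_eq_abs, Real.norm_eq_abs] at this
  convert this using 2
  ring

theorem hasDerivWithinAt_ip {T : ℝ} {w w' : ℝ → ℝ → ℝ} {g : ℝ → ℝ}
    (hw : ∀ t ∈ Icc 0 T, ∀ x ∈ Ioo (0 : ℝ) 1,
      HasDerivWithinAt (fun s => w s x) (w' t x) (Icc 0 T) t)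
    (hc : ContinuousOn (fun p : ℝ × ℝ => w' p.1 p.2) (Icc 0 T ×ˢ Icc 0 1))
    (hb : ∀ t ∈ Icc 0 T, BM (w t)) (hb' : ∀ t ∈ Icc 0 T, BM (w' t)) (hg : BM g) {t : ℝ}
    (ht : t ∈ Icc 0 T) :
    HasDerivWithinAt (fun s => ip (w s) g) (ip (w' t) g) (Icc 0 T) t := by
  obtain ⟨G, hG⟩ := hg.2
  have hG0 : 0 ≤ G := (abs_nonneg _).trans (hG (1 / 2) (by norm_num))
  refine HasDerivWithinAt.of_remainder fun e he => ?_
  obtain ⟨δ, hδ, H⟩ := continuousOn_uniform_time hc ht (e := e / (G + 1)) (by positivity)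
  refine ⟨δ, hδ, fun τ hτ hd => ?_⟩
  have hbr : BM (fun x => w τ x - w t x - (τ - t) * w' t x) :=
    ((hb τ hτ).sub (hb t ht)).sub ((hb' t ht).const_mul _)
  have e1 : ip (w τ) g - ip (w t) g - (τ - t) * ip (w' t) g =
      ip (fun x => w τ x - w t x - (τ - t) * w' t x) g := by
    rw [ip_sub_left ((hb τ hτ).sub (hb t ht)) ((hb' t ht).const_mul _) hg,
      ip_sub_left (hb τ hτ) (hb t ht) hg, ip_smul_left]
  rw [e1, ip_eq]
  have h2 := norm_setIntegral_le_of_norm_le_const (μ := volume) (s := Ioo (0 : ℝ) 1)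
    (f := fun x => (w τ x - w t x - (τ - t) * w' t x) * g x)
    (C := e / (G + 1) * |τ - t| * G) (by simp) fun x hx => by
      rw [norm_mul]
      refine mul_le_mul ?_ (hG x hx) (norm_nonneg _) (by positivity)
      exact time_remainder (w' t x) ht hτ (fun s hs => hw s hs x hx) fun s hs hst =>
        H s hs (hst.trans_lt hd) x (Ioo_subset_Icc_self hx)
  rw [Real.norm_eq_abs] at h2
  refine h2.trans ?_
  simp only [Measure.real, Real.volume_Ioo, sub_zero, ENNReal.toReal_ofReal zero_le_one, mul_one]
  calc e / (G + 1) * |τ - t| * G = e * |τ - t| * (G / (G + 1)) := by ring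
    _ ≤ e * |τ - t| * 1 := by
        gcongr
        rw [div_le_one (by linarith)]
        linarith
    _ = _ := mul_one _

theorem continuousOn_ip_self {T : ℝ} (hT : 0 ≤ T) {w : ℝ → ℝ → ℝ}
    (hw : ContinuousOn (fun p : ℝ × ℝ => w p.1 p.2) (Icc 0 T ×ˢ Icc 0 1)) :
    ContinuousOn (fun t => ip (w t) (w t)) (Icc 0 T) := by
  -- Clamping both variables gives a globally continuous integrand that is unchanged on `[0,T] ×
  -- [0,1]`.
  let G : ℝ → ℝ → ℝ := fun t x => w (projIcc 0 T hT t) (projIcc 0 1 zero_le_one x)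
  have hG : Continuous (fun p : ℝ × ℝ => G p.1 p.2) := by
    refine hw.comp_continuous (f := fun p : ℝ × ℝ =>
      ((projIcc 0 T hT p.1 : ℝ), (projIcc 0 1 zero_le_one p.2 : ℝ))) ?_ fun p =>
        ⟨Subtype.mem _, Subtype.mem _⟩
    exact (continuous_subtype_val.comp (continuous_projIcc.comp continuous_fst)).prodMk
      (continuous_subtype_val.comp (continuous_projIcc.comp continuous_snd))
  have h1 : Continuous fun t => ∫ x in (0 : ℝ)..1, G t x * G t x :=
    intervalIntegral.continuous_parametric_intervalIntegral_of_continuous' (hG.mul hG) 0 1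
  refine h1.continuousOn.congr fun t ht => ?_
  refine intervalIntegral.integral_congr fun x hx => ?_
  rw [uIcc_of_le zero_le_one] at hx
  simp only [G, projIcc_of_mem _ ht, projIcc_of_mem _ hx]

section ContCm

variable {T : ℝ} {m : ℕ} {w : ℝ → ℝ → ℝ}

theorem ContCm.continuousOn (hw : ContCm T m w) :
    ContinuousOn (fun p : ℝ × ℝ => w p.1 p.2) (Icc 0 T ×ˢ Icc 0 1) := by
  simpa using hw.2 0 (Nat.zero_le m)

theorem ContCm.continuousOn_dx (hw : ContCm T m w) (hm : 1 ≤ m) :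
    ContinuousOn (fun p : ℝ × ℝ => dx (w p.1) p.2) (Icc 0 T ×ˢ Icc 0 1) := by
  have := hw.2 1 hm
  simp only [iteratedDerivWithin_one] at this
  exact this

theorem ContCm.exists_bound (hw : ContCm T m w) {j : ℕ} (hj : j ≤ m) : ∃ A ≥ 0, ∀ t ∈ Icc 0 T,
    ∀ x ∈ Icc (0 : ℝ) 1, |iteratedDerivWithin j (w t) (Icc 0 1) x| ≤ A := by
  obtain ⟨A, hA⟩ := (isCompact_Icc.prod isCompact_Icc).exists_bound_of_continuousOn (hw.2 j hj)
  exact ⟨max A 0, le_max_right _ _, fun t ht x hx => (hA (t, x) ⟨ht, hx⟩).trans (le_max_left _ _)⟩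

theorem ContCm.slice_continuousOn (hw : ContCm T m w) {t : ℝ} (ht : t ∈ Icc 0 T) :
    ContinuousOn (w t) (Icc 0 1) := (hw.1 t ht).continuousOn

theorem ContCm.hasDerivWithinAt (hw : ContCm T m w) (hm : 1 ≤ m) {t : ℝ} (ht : t ∈ Icc 0 T)
    {x : ℝ} (hx : x ∈ Icc (0 : ℝ) 1) : HasDerivWithinAt (w t) (dx (w t) x) (Icc 0 1) x :=
  ((hw.1 t ht).differentiableOn (by norm_cast; omega) x hx).hasDerivWithinAt

theorem ContCm.contDiffOn_one (hw : ContCm T m w) (hm : 1 ≤ m) {t : ℝ} (ht : t ∈ Icc 0 T) :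
    ContDiffOn ℝ 1 (w t) (Icc 0 1) := (hw.1 t ht).of_le (by exact_mod_cast hm)

theorem ContCm.lip (hw : ContCm T m w) (hm : 1 ≤ m) {t : ℝ} (ht : t ∈ Icc 0 T) : Lip (w t) :=
  Lip.of_contDiffOn (hw.contDiffOn_one hm ht)

theorem ContCm.exists_lipC (hw : ContCm T m w) (hm : 1 ≤ m) : ∃ A ≥ 0, ∀ t ∈ Icc 0 T,
    LipC A (w t) ∧ ∀ x ∈ Icc (0 : ℝ) 1, |w t x| ≤ A := by
  obtain ⟨A, hA, h0⟩ := hw.exists_bound (Nat.zero_le m)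
  obtain ⟨B, hB, h1⟩ := hw.exists_bound hm
  simp only [iteratedDerivWithin_zero, iteratedDerivWithin_one] at h0 h1
  refine ⟨max A B, le_max_of_le_left hA, fun t ht => ⟨?_, fun x hx =>
    (h0 t ht x hx).trans (le_max_left _ _)⟩⟩
  exact lipC_of_hasDerivWithinAt (fun x hx => hw.hasDerivWithinAt hm ht hx) fun x hx =>
    (h1 t ht x hx).trans (le_max_right _ _)

end ContCm

/-- Time and space derivatives commute. -/
theorem hasDerivWithinAt_dx {T : ℝ} {m : ℕ} {u : ℝ → ℝ → ℝ} (hu : ContCm T m u) (hm : 1 ≤ m)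
    (hut : TimeDiff T u) (hu' : ContCm T 2 (dt T u)) {t : ℝ} (ht : t ∈ Icc 0 T) {x : ℝ}
    (hx : x ∈ Ioo (0 : ℝ) 1) :
    HasDerivWithinAt (fun s => dx (u s) x) (dx (dt T u t) x) (Icc 0 T) t := by
  refine HasDerivWithinAt.of_remainder fun e he => ?_
  obtain ⟨δ, hδ, H⟩ := continuousOn_uniform_time (w := fun t x => dx (dt T u t) x)
    (hu'.continuousOn_dx one_le_two) ht he
  refine ⟨δ, hδ, fun τ hτ hd => ?_⟩
  -- The first-order remainder in time is Lipschitz in space with a constant `e * |τ - t|`: this is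
  -- `time_remainder` for differences between two points. A Lipschitz constant bounds the spatial
  -- derivative of the remainder, which is the remainder for `dx (u s) x`.
  have hL : LipC (e * |τ - t|) (fun y => u τ y - u t y - (τ - t) * dt T u t y) := by
    intro y hy z hz
    have := time_remainder (f := fun s => u s y - u s z) (f' := fun s => dt T u s y - dt T u s z)
      (e := e * |y - z|) (dt T u t y - dt T u t z) ht hτ (fun s hs =>
        (hut y hy s hs).hasDerivWithinAt.sub (hut z hz s hs).hasDerivWithinAt) fun s hs hst => ?_
    · refine le_trans (le_of_eq ?_) (this.trans (le_of_eq ?_))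
      · congr 1
        ring
      · ring
    · have h2 : LipC e (fun x => dt T u s x - dt T u t x) :=
        lipC_of_hasDerivWithinAt (fun x hx => (hu'.hasDerivWithinAt one_le_two hs hx).sub
          (hu'.hasDerivWithinAt one_le_two ht hx)) fun x hx => H s hs (hst.trans_lt hd) x hx
      refine le_trans (le_of_eq ?_) (h2 y hy z hz)
      congr 1
      ring
  have h3 := hL.abs_dx_le hx
  have hx' := Ioo_subset_Icc_self hx
  have h4 : HasDerivWithinAt (fun y => u τ y - u t y - (τ - t) * dt T u t y)
      (dx (u τ) x - dx (u t) x - (τ - t) * dx (dt T u t) x) (Icc 0 1) x :=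
    ((hu.hasDerivWithinAt hm hτ hx').sub (hu.hasDerivWithinAt hm ht hx')).sub
      ((hu'.hasDerivWithinAt one_le_two ht hx').const_mul _)
  rwa [dx, h4.derivWithin (uniqueDiffOn_Icc zero_lt_one x hx')] at h3

/-! ### The weak equations satisfied by the exact solution. -/

section exact

variable {ε μ β T : ℝ} {b ζ₀ u₀ : ℝ → ℝ} {ζ u : ℝ → ℝ → ℝ} {r : ℕ}

theorem lip_etab {β : ℝ} {b : ℝ → ℝ} (hb : ContDiffOn ℝ 2 b (Icc 0 1)) : Lip (etab β b) :=
  (Lip.const 1).sub ((Lip.of_contDiffOn (hb.of_le one_le_two)).const_mul β)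

theorem IsSolution.ip_mass (hsol : IsSolution ε μ β b T ζ₀ u₀ ζ u) {t : ℝ} (ht : t ∈ Icc 0 T)
    (g : ℝ → ℝ) :
    ip (dt T ζ t) g = -ip (dx (fun y => (ε * ζ t y + etab β b y) * u t y)) g := by
  rw [← neg_one_mul, ← ip_smul_left]
  refine ip_congr (fun x hx => ?_) fun _ _ => rfl
  have := hsol.mass t ht x (Ioo_subset_Icc_self hx)
  linarith

/-- Integration by parts of `u_xxt` against `χ`, whose boundary values are zero, produces the second
part of the form `a`. -/
theorem IsSolution.a_momentum (hsol : IsSolution ε μ β b T ζ₀ u₀ ζ u)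
    (hsm : IsSmooth r T ζ u) (hr : 2 ≤ r) {t : ℝ} (ht : t ∈ Icc 0 T)
    {χ : ℝ → ℝ} (hχ : Lip χ) (h0 : χ 0 = 0) (h1 : χ 1 = 0) :
    a μ (dt T u t) χ = -ip (dx (ζ t)) χ - ε * ip (fun x => u t x * dx (u t) x) χ := by
  have hud : UniqueDiffOn ℝ (Icc (0 : ℝ) 1) := uniqueDiffOn_Icc zero_lt_one
  have hd2 : ContDiffOn ℝ (1 + 1) (dt T u t) (Icc 0 1) := hsm.u_time.1 t ht
  have hd1 : ContDiffOn ℝ 1 (dx (dt T u t)) (Icc 0 1) :=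
    ((contDiffOn_succ_iff_derivWithin hud).1 hd2).2.2
  have hLdd := Lip.of_contDiffOn hd1
  have hparts := hLdd.ip_dx_left hχ
  rw [h0, h1] at hparts
  have hu := hsm.u_space.lip (by omega) ht
  have hζ := hsm.zeta_space.lip (by omega) ht
  have hE : ip (dt T u t) χ = ip (fun x => (μ / 3 * dx (dx (dt T u t)) x - dx (ζ t) x) -
      ε * (u t x * dx (u t) x)) χ := by
    refine ip_congr (fun x hx => ?_) fun _ _ => rfl
    have := hsol.momentum t ht x (Ioo_subset_Icc_self hx)
    linarith
  rw [ip_sub_left ((hLdd.bm_dx.const_mul _).sub hζ.bm_dx) ((hu.bm.mul hu.bm_dx).const_mul _) hχ.bm,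
    ip_sub_left (hLdd.bm_dx.const_mul _) hζ.bm_dx hχ.bm, ip_smul_left, ip_smul_left, hparts] at hE
  rw [a, hE]
  ring

end exact

/-! ### The energy inequality at a fixed time. -/

theorem young_le {c K : ℝ} (p q : ℝ) (hc : |c| ≤ K) : c * (p * q) ≤ K * ((p ^ 2 + q ^ 2) / 2) := by
  have h1 : |p * q| ≤ (p ^ 2 + q ^ 2) / 2 := by
    rw [abs_le]
    constructor <;> nlinarith [sq_nonneg (p + q), sq_nonneg (p - q)]
  calc c * (p * q) ≤ |c * (p * q)| := le_abs_self _
    _ = |c| * |p * q| := abs_mul _ _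
    _ ≤ _ := mul_le_mul hc h1 (abs_nonneg _) ((abs_nonneg _).trans hc)

/-- Young's inequality term by term. Only `ρ * θx` is weighted, as `(h⁻¹ ρ) * (h θx)`: the first
factor retains order `h^(r-1)` in norm, the second is controlled by `θ` through the inverse
inequality. -/
theorem energy_pointwise {ε A B h η ηx ux U Ux θ θx ξ ξx σ σx ρ : ℝ} (hε : 0 < ε) (hh : 0 < h)
    (h1 : |η| ≤ A) (h2 : |ηx| ≤ A) (h3 : |ux| ≤ A) (h4 : |U| ≤ B) (h5 : |Ux| ≤ B) :
    -(ηx * (σ + ξ) + η * (σx + ξx)) * θ + ε * (ρ * U) * θx - ε / 2 * (Ux * θ ^ 2)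
      + (ρ + θ) * ξx - ε * ((σ + ξ) * ux + U * (σx + ξx)) * ξ ≤
    (1 + A + 2 * ε * A + ε * B) * (θ ^ 2 + ξ ^ 2 + ξx ^ 2 + σ ^ 2 + σx ^ 2 + ρ ^ 2
      + (h ^ 2)⁻¹ * ρ ^ 2 + h ^ 2 * θx ^ 2) := by
  have hA : 0 ≤ A := (abs_nonneg _).trans h1
  have hB : 0 ≤ B := (abs_nonneg _).trans h4
  have i1 := young_le (σ + ξ) θ (c := -ηx) (K := A) (by rwa [abs_neg])
  have i2 := young_le (σx + ξx) θ (c := -η) (K := A) (by rwa [abs_neg])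
  have i3 := young_le (h⁻¹ * ρ) (h * θx) h4
  have i4 := young_le θ θ (c := -Ux) (K := B) (by rwa [abs_neg])
  have i5 := young_le ρ ξx (c := 1) (K := 1) (by simp)
  have i6 := young_le θ ξx (c := 1) (K := 1) (by simp)
  have i7 := young_le (σ + ξ) ξ (c := -ux) (K := A) (by rwa [abs_neg])
  have i8 := young_le (σx + ξx) ξ (c := -U) (K := B) (by rwa [abs_neg])
  have e3 : U * (h⁻¹ * ρ * (h * θx)) = ρ * U * θx := by field_simp
  have e3' : (h⁻¹ * ρ) ^ 2 = (h ^ 2)⁻¹ * ρ ^ 2 := by rw [mul_pow, inv_pow]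
  rw [e3, e3', mul_pow] at i3
  have s1 : (σ + ξ) ^ 2 ≤ 2 * σ ^ 2 + 2 * ξ ^ 2 := by nlinarith [sq_nonneg (σ - ξ)]
  have s2 : (σx + ξx) ^ 2 ≤ 2 * σx ^ 2 + 2 * ξx ^ 2 := by nlinarith [sq_nonneg (σx - ξx)]
  set P := (h ^ 2)⁻¹ * ρ ^ 2
  set Q := h ^ 2 * θx ^ 2
  have hP : 0 ≤ P := by positivity
  have hQ : 0 ≤ Q := by positivity
  have j1 : A * (((σ + ξ) ^ 2 + θ ^ 2) / 2) ≤ A * (σ ^ 2 + ξ ^ 2 + θ ^ 2 / 2) := by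
    gcongr; linarith
  have j2 : A * (((σx + ξx) ^ 2 + θ ^ 2) / 2) ≤ A * (σx ^ 2 + ξx ^ 2 + θ ^ 2 / 2) := by
    gcongr; linarith
  have j7 : A * (((σ + ξ) ^ 2 + ξ ^ 2) / 2) ≤ A * (σ ^ 2 + 3 / 2 * ξ ^ 2) := by
    gcongr; linarith
  have j8 : B * (((σx + ξx) ^ 2 + ξ ^ 2) / 2) ≤ B * (σx ^ 2 + ξx ^ 2 + ξ ^ 2 / 2) := by
    gcongr; linarith
  have k3 := mul_le_mul_of_nonneg_left i3 hε.le
  have k4 := mul_le_mul_of_nonneg_left i4 hε.le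
  have k7 := mul_le_mul_of_nonneg_left (i7.trans j7) hε.le
  have k8 := mul_le_mul_of_nonneg_left (i8.trans j8) hε.le
  have key : -(ηx * (σ + ξ) + η * (σx + ξx)) * θ + ε * (ρ * U) * θx - ε / 2 * (Ux * θ ^ 2)
      + (ρ + θ) * ξx - ε * ((σ + ξ) * ux + U * (σx + ξx)) * ξ ≤
      A * (σ ^ 2 + ξ ^ 2 + θ ^ 2 / 2) + A * (σx ^ 2 + ξx ^ 2 + θ ^ 2 / 2) +
      ε * (B * ((P + Q) / 2)) + ε * (B * ((θ ^ 2 + θ ^ 2) / 2)) / 2 +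
      1 * ((ρ ^ 2 + ξx ^ 2) / 2) + 1 * ((θ ^ 2 + ξx ^ 2) / 2) +
      ε * (A * (σ ^ 2 + 3 / 2 * ξ ^ 2)) + ε * (B * (σx ^ 2 + ξx ^ 2 + ξ ^ 2 / 2)) := by
    linarith
  refine key.trans ?_
  rw [← sub_nonneg]
  -- The difference of the two sides, grouped by the coefficients `1`, `A`, `ε * A`, `ε * B`.
  have : 0 ≤ (θ ^ 2 / 2 + ξ ^ 2 + σ ^ 2 + σx ^ 2 + ρ ^ 2 / 2 + P + Q)
      + A * (ρ ^ 2 + P + Q)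
      + ε * A * (2 * θ ^ 2 + ξ ^ 2 / 2 + 2 * ξx ^ 2 + σ ^ 2 + 2 * σx ^ 2 + 2 * ρ ^ 2 + 2 * P + 2 * Q)
      + ε * B * (θ ^ 2 / 2 + ξ ^ 2 / 2 + σ ^ 2 + ρ ^ 2 + P / 2 + Q / 2) := by positivity
  refine this.trans (le_of_eq ?_)
  ring

/-- With `η = ε ζ + ηb`, the mass terms combine to `-(η (u - uh))_x - ε ((ζ - zh) uh)_x`, where `u -
uh = σ + ξ` and `ζ - zh = ρ + θ`. Adding the derivative of a function that vanishes at both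
endpoints performs all integrations by parts at once and leads to the integrand of
`energy_pointwise`. -/
theorem energy_static {ε A B h : ℝ} (hε : 0 < ε) (hh : 0 < h) {ζ z zh u v uh ηb : ℝ → ℝ}
    (hζ : Lip ζ) (hz : Lip z) (hzh : Lip zh) (hu : LipC A u) (hv : Lip v) (huh : LipC B uh)
    (hηb : Lip ηb) (hη : LipC A (fun x => ε * ζ x + ηb x))
    (hη' : ∀ x ∈ Icc (0 : ℝ) 1, |ε * ζ x + ηb x| ≤ A) (huh0 : uh 0 = 0) (huh1 : uh 1 = 0)
    (hv0 : v 0 = 0) (hv1 : v 1 = 0) :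
    (-ip (dx fun x => (ε * ζ x + ηb x) * u x) (fun x => z x - zh x)
      + ε * ip (dx fun x => zh x * uh x) (fun x => z x - zh x)
      + ip (dx fun x => ηb x * uh x) (fun x => z x - zh x))
    + (-ip (dx ζ) (fun x => v x - uh x) - ε * ip (fun x => u x * dx u x) (fun x => v x - uh x)
      + ip (dx zh) (fun x => v x - uh x) + ε * ip (fun x => uh x * dx uh x) (fun x => v x - uh x))
    ≤ (1 + A + 2 * ε * A + ε * B) *
      (ip (fun x => z x - zh x) (fun x => z x - zh x)
        + ip (fun x => v x - uh x) (fun x => v x - uh x)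
        + ip (dx fun x => v x - uh x) (dx fun x => v x - uh x)
        + ip (fun x => u x - v x) (fun x => u x - v x)
        + ip (dx fun x => u x - v x) (dx fun x => u x - v x)
        + ip (fun x => ζ x - z x) (fun x => ζ x - z x)
        + (h ^ 2)⁻¹ * ip (fun x => ζ x - z x) (fun x => ζ x - z x)
        + h ^ 2 * ip (dx fun x => z x - zh x) (dx fun x => z x - zh x)) := by
  have hu' : Lip u := ⟨A, hu⟩
  have huh' : Lip uh := ⟨B, huh⟩
  have hηL : Lip (fun x => ε * ζ x + ηb x) := ⟨A, hη⟩
  have hθ := hz.sub hzh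
  have hξ := hv.sub huh'
  have hσ := hu'.sub hv
  have hρ := hζ.sub hz
  -- the left-hand side differs from the integral of `L` by the integral of `dx Ψ`
  set Ψ : ℝ → ℝ := fun x => (ε * ((ζ x - z x) * (uh x * (z x - zh x)))
    + ε / 2 * ((z x - zh x) * ((z x - zh x) * uh x))) + (ζ x - zh x) * (v x - uh x) with hΨ
  have hΨL : Lip Ψ := (((hρ.mul (huh'.mul hθ)).const_mul ε).add
    ((hθ.mul (hθ.mul huh')).const_mul (ε / 2))).add ((hζ.sub hzh).mul hξ)
  have hΨ0 : ∫ x, dx Ψ x ∂mI = 0 := by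
    rw [hΨL.integral_mI_dx]
    simp [hΨ, huh0, huh1, hv0, hv1]
  have b1 := (hηL.mul hu').bm_dx.mul hθ.bm
  have b2 := (hzh.mul huh').bm_dx.mul hθ.bm
  have b3 := (hηb.mul huh').bm_dx.mul hθ.bm
  have b4 := hζ.bm_dx.mul hξ.bm
  have b5 := (hu'.bm.mul hu'.bm_dx).mul hξ.bm
  have b6 := hzh.bm_dx.mul hξ.bm
  have b7 := (huh'.bm.mul huh'.bm_dx).mul hξ.bm
  have b8 := hΨL.bm_dx
  simp only [ip_eq, ← integral_const_mul, ← integral_neg]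
  have d2 := b1.neg.add (b2.const_mul ε)
  have d3 := d2.add b3
  have d5 := b4.neg.sub (b5.const_mul ε)
  have d6 := d5.add b6
  have d7 := d6.add (b7.const_mul ε)
  have d8 := (d3.add d7).add b8
  rw [← integral_add b1.neg.integrable (b2.const_mul ε).integrable,
    ← integral_add d2.integrable b3.integrable,
    ← integral_sub b4.neg.integrable (b5.const_mul ε).integrable,
    ← integral_add d5.integrable b6.integrable,
    ← integral_add d6.integrable (b7.const_mul ε).integrable,
    ← integral_add d3.integrable d7.integrable]
  have c1 := hθ.bm.mul hθ.bm
  have c2 := hξ.bm.mul hξ.bm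
  have c3 := hξ.bm_dx.mul hξ.bm_dx
  have c4 := hσ.bm.mul hσ.bm
  have c5 := hσ.bm_dx.mul hσ.bm_dx
  have c6 := hρ.bm.mul hρ.bm
  have c7 := c6.const_mul (h ^ 2)⁻¹
  have c8 := (hθ.bm_dx.mul hθ.bm_dx).const_mul (h ^ 2)
  rw [← integral_add c1.integrable c2.integrable,
    ← integral_add (c1.add c2).integrable c3.integrable,
    ← integral_add ((c1.add c2).add c3).integrable c4.integrable,
    ← integral_add (((c1.add c2).add c3).add c4).integrable c5.integrable,
    ← integral_add ((((c1.add c2).add c3).add c4).add c5).integrable c6.integrable,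
    ← integral_add (((((c1.add c2).add c3).add c4).add c5).add c6).integrable c7.integrable,
    ← integral_add ((((((c1.add c2).add c3).add c4).add c5).add c6).add c7).integrable
      c8.integrable, ← integral_const_mul]
  refine le_trans (le_of_eq (add_zero _).symm) ?_
  rw [← hΨ0, ← integral_add (d3.add d7).integrable b8.integrable]
  refine integral_mono_ae d8.integrable
    ((((((((c1.add c2).add c3).add c4).add c5).add c6).add c7).add c8).const_mul _).integrable ?_
  filter_upwards [ae_mem_Ioo, hζ.ae_diff, hz.ae_diff, hzh.ae_diff, hu'.ae_diff, hv.ae_diff,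
    huh'.ae_diff, hηb.ae_diff] with x hx dζ dz dzh du dv duh dηb
  have hx' := Ioo_subset_Icc_self hx
  have hud := uniqueDiffOn_Icc (zero_lt_one (α := ℝ)) x hx'
  have gζ := dζ.hasDerivWithinAt
  have gz := dz.hasDerivWithinAt
  have gzh := dzh.hasDerivWithinAt
  have gu := du.hasDerivWithinAt
  have gv := dv.hasDerivWithinAt
  have guh := duh.hasDerivWithinAt
  have gηb := dηb.hasDerivWithinAt
  have gη := (gζ.const_mul ε).add gηb
  have gθ := gz.sub gzh
  have gξ := gv.sub guh
  have gρ := gζ.sub gz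
  have e0 : dx (fun x => ε * ζ x + ηb x) x = _ := gη.derivWithin hud
  have e1 : dx (fun x => (ε * ζ x + ηb x) * u x) x = _ := (gη.mul gu).derivWithin hud
  have e2 : dx (fun x => zh x * uh x) x = _ := (gzh.mul guh).derivWithin hud
  have e3 : dx (fun x => ηb x * uh x) x = _ := (gηb.mul guh).derivWithin hud
  have e4 : dx (fun x => v x - uh x) x = _ := gξ.derivWithin hud
  have e5 : dx (fun x => z x - zh x) x = _ := gθ.derivWithin hud
  have e6 : dx (fun x => u x - v x) x = _ := (gu.sub gv).derivWithin hud
  have e7 : dx Ψ x = _ := ((((gρ.mul (guh.mul gθ)).const_mul ε).add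
    ((gθ.mul (gθ.mul guh)).const_mul (ε / 2))).add ((gζ.sub gzh).mul gξ)).derivWithin hud
  have k0 := hη.abs_dx_le hx
  have k1 := hu.abs_dx_le hx
  have k2 := huh.abs_le huh0 hx'
  have k3 := huh.abs_dx_le hx
  rw [e0] at k0
  have key := energy_pointwise (θ := z x - zh x) (ξ := v x - uh x) (σ := u x - v x)
    (ρ := ζ x - z x) (θx := dx z x - dx zh x) (ξx := dx v x - dx uh x) (σx := dx u x - dx v x)
    hε hh (hη' x hx') k0 k1 k2 k3
  simp only [Pi.add_apply, Pi.sub_apply, e1, e2, e3, e4, e5, e6, e7]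
  simp only [dx] at key ⊢
  refine le_trans (le_of_eq ?_) (key.trans (le_of_eq ?_))
  · simp only [Pi.mul_apply, Pi.sub_apply]
    ring
  · ring

/-! ### The form `a` and its Gram matrix. -/

section a

variable {ν : ℝ} {f g h : ℝ → ℝ}

theorem a_comm (ν : ℝ) (f g : ℝ → ℝ) : a ν f g = a ν g f := by
  rw [a, a, ip_comm f, ip_comm (dx f)]

/-- The `L²` projection and the elliptic projection thus become the cases `ν = 0` and `ν = μ` of one
argument; the `H¹` norm is the case `ν = 3`. -/
theorem a_zero (f g : ℝ → ℝ) : a 0 f g = ip f g := by simp [a]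

theorem a_add_left (ν : ℝ) (hf : Lip f) (hg : Lip g) (hh : Lip h) :
    a ν (fun x => f x + g x) h = a ν f h + a ν g h := by
  rw [a, a, a, ip_add_left hf.bm hg.bm hh.bm, ip_congr_ae (hf.dx_add hg) (ae_eq_refl _),
    ip_add_left hf.bm_dx hg.bm_dx hh.bm_dx]
  ring

theorem a_sub_left (ν : ℝ) (hf : Lip f) (hg : Lip g) (hh : Lip h) :
    a ν (fun x => f x - g x) h = a ν f h - a ν g h := by
  rw [a, a, a, ip_sub_left hf.bm hg.bm hh.bm, ip_congr_ae (hf.dx_sub hg) (ae_eq_refl _),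
    ip_sub_left hf.bm_dx hg.bm_dx hh.bm_dx]
  ring

theorem a_smul_left (ν c : ℝ) (hf : Lip f) : a ν (fun x => c * f x) h = c * a ν f h := by
  rw [a, a, ip_smul_left, ip_congr_ae (hf.dx_const_mul c) (ae_eq_refl _), ip_smul_left]
  ring

theorem a_sub_right (ν : ℝ) (hf : Lip f) (hg : Lip g) (hh : Lip h) :
    a ν h (fun x => f x - g x) = a ν h f - a ν h g := by
  rw [a_comm, a_sub_left ν hf hg hh, a_comm, a_comm ν g]

theorem a_congr {f' g' : ℝ → ℝ} (ν : ℝ) (hf : EqOn f f' (Icc 0 1)) (hg : EqOn g g' (Icc 0 1)) :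
    a ν f g = a ν f' g' := by
  rw [a, a, ip_congr (hf.mono Ioo_subset_Icc_self) (hg.mono Ioo_subset_Icc_self),
    ip_congr ((dx_congr hf).mono Ioo_subset_Icc_self) ((dx_congr hg).mono Ioo_subset_Icc_self)]

theorem ip_self_le_a (hν : 0 ≤ ν) (f : ℝ → ℝ) : ip f f ≤ a ν f f := by
  have := ip_self_nonneg (dx f)
  rw [a]
  have : 0 ≤ ν / 3 * ip (dx f) (dx f) := by positivity
  linarith

theorem a_self_nonneg (hν : 0 ≤ ν) (f : ℝ → ℝ) : 0 ≤ a ν f f :=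
  (ip_self_nonneg f).trans (ip_self_le_a hν f)

end a

theorem IsLinearMap.apply_eq_sum {n : ℕ} {Φ : (Fin n → ℝ) → ℝ} (hΦ : IsLinearMap ℝ Φ)
    (c : Fin n → ℝ) : Φ c = ∑ i, c i * Φ (Pi.single i 1) := by
  have h2 := congrArg hΦ.mk' (pi_eq_sum_univ' c)
  rw [map_sum] at h2
  refine h2.trans (Finset.sum_congr rfl fun i _ => ?_)
  rw [map_smul, smul_eq_mul]
  rfl

namespace Coords

variable {Vp : (ℝ → ℝ) → Prop} (X : Coords Vp) {ν : ℝ}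

theorem B_add (c d : Fin X.n → ℝ) : X.B (c + d) = fun x => X.B c x + X.B d x := map_add X.B c d

theorem B_sub (c d : Fin X.n → ℝ) : X.B (c - d) = fun x => X.B c x - X.B d x := map_sub X.B c d

theorem B_smul (s : ℝ) (c : Fin X.n → ℝ) : X.B (s • c) = fun x => s * X.B c x := map_smul X.B s c

theorem isLinearMap_ip (hX : ∀ c, Lip (X.B c)) {g : ℝ → ℝ} (hg : BM g) :
    IsLinearMap ℝ fun c => ip g (X.B c) :=
  ⟨fun c d => by rw [B_add, ip_add_right (hX c).bm (hX d).bm hg],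
    fun s c => by rw [B_smul, ip_smul_right, smul_eq_mul]⟩

theorem isLinearMap_a (hX : ∀ c, Lip (X.B c)) {g : ℝ → ℝ} (hg : Lip g) :
    IsLinearMap ℝ fun c => a ν g (X.B c) :=
  ⟨fun c d => by rw [B_add, a_comm, a_add_left ν (hX c) (hX d) hg, a_comm, a_comm ν (X.B d)],
    fun s c => by rw [B_smul, a_comm, a_smul_left ν s (hX c), a_comm, smul_eq_mul]⟩

theorem isBilinearMap_a (hX : ∀ c, Lip (X.B c)) :
    IsBilinearMap ℝ fun c d => a ν (X.B c) (X.B d) where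
  add_left c c' d := by rw [B_add, a_add_left ν (hX c) (hX c') (hX d)]
  smul_left s c d := by rw [B_smul, a_smul_left ν s (hX c), smul_eq_mul]
  add_right c d d' := (X.isLinearMap_a hX (hX c)).map_add d d'
  smul_right s c d := (X.isLinearMap_a hX (hX c)).map_smul s d

theorem eq_zero_of_a (hν : 0 ≤ ν) (hX : ∀ c, Lip (X.B c)) {c : Fin X.n → ℝ}
    (h : a ν (X.B c) (X.B c) = 0) : c = 0 := by
  refine X.eq_zero_of_B (eq_zero_of_ip_self (hX c).continuousOn (le_antisymm ?_ (ip_self_nonneg _)))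
  rw [← h]
  exact ip_self_le_a hν _

theorem eq_of_a (hν : 0 ≤ ν) (hX : ∀ c, Lip (X.B c)) {c c' : Fin X.n → ℝ}
    (h : ∀ d, a ν (X.B c) (X.B d) = a ν (X.B c') (X.B d)) : c = c' := by
  rw [← sub_eq_zero]
  apply X.eq_zero_of_a hν hX
  rw [B_sub, a_sub_left ν (hX _) (hX _) (by rw [← B_sub]; exact hX _), ← B_sub, h, sub_self]

/-- The solution operator of linear systems with the Gram matrix of `a ν`. -/
theorem exists_solver (hν : 0 ≤ ν) (hX : ∀ c, Lip (X.B c)) :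
    ∃ S : (Fin X.n → ℝ) →L[ℝ] (Fin X.n → ℝ), ∀ Φ : (Fin X.n → ℝ) → ℝ, IsLinearMap ℝ Φ →
      ∀ c, a ν (X.B (S fun i => Φ (Pi.single i 1))) (X.B c) = Φ c := by
  obtain ⟨S, hS⟩ := exists_gram_inverse (X.isBilinearMap_a (ν := ν) hX).toLinearMap
    fun c hc => X.eq_zero_of_a hν hX hc
  refine ⟨S.toContinuousLinearMap, fun Φ hΦ c => ?_⟩
  have h1 := hS (fun i => Φ (Pi.single i 1)) c
  refine h1.trans ((Finset.sum_congr rfl fun i _ => ?_).trans (IsLinearMap.apply_eq_sum hΦ c).symm)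
  rw [mul_comm]

end Coords

theorem IsBilinearMap.contDiff {n m : ℕ} {f : (Fin n → ℝ) → (Fin m → ℝ) → ℝ}
    (hf : IsBilinearMap ℝ f) : ContDiff ℝ 1 fun p : (Fin n → ℝ) × (Fin m → ℝ) => f p.1 p.2 :=
  hf.toContinuousBilinearMap.isBoundedBilinearMap.contDiff

theorem IsLinearMap.contDiff {n : ℕ} {f : (Fin n → ℝ) → ℝ} (hf : IsLinearMap ℝ f) :
    ContDiff ℝ 1 f :=
  hf.mk'.toContinuousLinearMap.contDiff

/-! ### The semidiscrete problem as an ordinary differential equation. -/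

section field

variable {r k : ℕ} {M : Mesh} (X : Coords (MemSh r k M)) (Y : Coords (MemSh0 r k M))

theorem Coords.lip_Sh (c : Fin X.n → ℝ) : Lip (X.B c) := (X.mem c).lip

theorem Coords.lip_Sh0 (c : Fin Y.n → ℝ) : Lip (Y.B c) := (Y.mem c).1.lip

/-- The semidiscrete problem as an ordinary differential equation for the coordinates. -/
theorem exists_field (ε : ℝ) {μ : ℝ} (hμ : 0 < μ) {ηb : ℝ → ℝ} (hηb : Lip ηb) :
    ∃ F : (Fin X.n → ℝ) × (Fin Y.n → ℝ) → (Fin X.n → ℝ) × (Fin Y.n → ℝ), ContDiff ℝ 1 F ∧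
      ∀ p, (∀ φ, MemSh r k M φ → ip (X.B (F p).1) φ
          + ε * ip (dx fun x => X.B p.1 x * Y.B p.2 x) φ + ip (dx fun x => ηb x * Y.B p.2 x) φ = 0)
        ∧ ∀ χ, MemSh0 r k M χ → a μ (Y.B (F p).2) χ + ip (dx (X.B p.1)) χ
          + ε * ip (fun x => Y.B p.2 x * dx (Y.B p.2) x) χ = 0 := by
  have hX := X.lip_Sh
  have hY := Y.lip_Sh0
  obtain ⟨S, hS⟩ := X.exists_solver le_rfl hX
  obtain ⟨S', hS'⟩ := Y.exists_solver hμ.le hY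
  let g : (Fin X.n → ℝ) × (Fin Y.n → ℝ) → ℝ → ℝ := fun p x =>
    -ε * dx (fun x => X.B p.1 x * Y.B p.2 x) x - dx (fun x => ηb x * Y.B p.2 x) x
  let g' : (Fin X.n → ℝ) × (Fin Y.n → ℝ) → ℝ → ℝ := fun p x =>
    -ε * (Y.B p.2 x * dx (Y.B p.2) x) - dx (X.B p.1) x
  have b1 : ∀ p : (Fin X.n → ℝ) × (Fin Y.n → ℝ), BM (dx fun x => X.B p.1 x * Y.B p.2 x) :=
    fun p => ((hX p.1).mul (hY p.2)).bm_dx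
  have b2 : ∀ p : (Fin X.n → ℝ) × (Fin Y.n → ℝ), BM (dx fun x => ηb x * Y.B p.2 x) :=
    fun p => (hηb.mul (hY p.2)).bm_dx
  have b3 : ∀ p : (Fin X.n → ℝ) × (Fin Y.n → ℝ), BM (fun x => Y.B p.2 x * dx (Y.B p.2) x) :=
    fun p => (hY p.2).bm.mul (hY p.2).bm_dx
  have hg : ∀ p, BM (g p) := fun p => ((b1 p).const_mul _).sub (b2 p)
  have hg' : ∀ p, BM (g' p) := fun p => ((b3 p).const_mul _).sub (hX p.1).bm_dx
  have hge : ∀ p {φ}, BM φ → ip (g p) φ = -ε * ip (dx fun x => X.B p.1 x * Y.B p.2 x) φ -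
      ip (dx fun x => ηb x * Y.B p.2 x) φ := fun p φ hφ => by
    rw [ip_sub_left ((b1 p).const_mul _) (b2 p) hφ, ip_smul_left]
  have hge' : ∀ p {φ}, BM φ → ip (g' p) φ = -ε * ip (fun x => Y.B p.2 x * dx (Y.B p.2) x) φ -
      ip (dx (X.B p.1)) φ := fun p φ hφ => by
    rw [ip_sub_left ((b3 p).const_mul _) (hX p.1).bm_dx hφ, ip_smul_left]
  refine ⟨fun p => (S fun i => ip (g p) (X.B (Pi.single i 1)),
    S' fun i => ip (g' p) (Y.B (Pi.single i 1))), ?_, fun p => ⟨fun φ hφ => ?_, fun χ hχ => ?_⟩⟩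
  -- Each right-hand side is a sum of a bilinear and a linear form in the coordinates, so the field
  -- is smooth although finite element functions are not.
  · refine ContDiff.prodMk (S.contDiff.comp (contDiff_pi.2 fun i => ?_))
      (S'.contDiff.comp (contDiff_pi.2 fun i => ?_))
    · have hφ := hX (Pi.single i 1)
      simp only [hge _ hφ.bm]
      refine (contDiff_const.mul (IsBilinearMap.contDiff (f := fun c d =>
        ip (dx fun x => X.B c x * Y.B d x) (X.B (Pi.single i 1))) ?_)).sub
        ((IsLinearMap.contDiff (f := fun d =>
        ip (dx fun x => ηb x * Y.B d x) (X.B (Pi.single i 1))) ?_).comp contDiff_snd)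
      · constructor
        · intro c c' d
          have e : (fun x => X.B (c + c') x * Y.B d x) =
              fun x => X.B c x * Y.B d x + X.B c' x * Y.B d x := by
            funext x
            rw [X.B_add, add_mul]
          have l1 := (hX c).mul (hY d)
          have l2 := (hX c').mul (hY d)
          rw [e, ip_congr_ae (l1.dx_add l2) (ae_eq_refl _), ip_add_left l1.bm_dx l2.bm_dx hφ.bm]
        · intro s c d
          have e : (fun x => X.B (s • c) x * Y.B d x) = fun x => s * (X.B c x * Y.B d x) := by
            funext x
            rw [X.B_smul, mul_assoc]
          rw [e, ip_congr_ae (((hX c).mul (hY d)).dx_const_mul s) (ae_eq_refl _), ip_smul_left,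
            smul_eq_mul]
        · intro c d d'
          have e : (fun x => X.B c x * Y.B (d + d') x) =
              fun x => X.B c x * Y.B d x + X.B c x * Y.B d' x := by
            funext x
            rw [Y.B_add, mul_add]
          have l1 := (hX c).mul (hY d)
          have l2 := (hX c).mul (hY d')
          rw [e, ip_congr_ae (l1.dx_add l2) (ae_eq_refl _), ip_add_left l1.bm_dx l2.bm_dx hφ.bm]
        · intro s c d
          have e : (fun x => X.B c x * Y.B (s • d) x) = fun x => s * (X.B c x * Y.B d x) := by
            funext x
            rw [Y.B_smul]
            ring
          rw [e, ip_congr_ae (((hX c).mul (hY d)).dx_const_mul s) (ae_eq_refl _), ip_smul_left,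
            smul_eq_mul]
      · constructor
        · intro d d'
          have e : (fun x => ηb x * Y.B (d + d') x) =
              fun x => ηb x * Y.B d x + ηb x * Y.B d' x := by
            funext x
            rw [Y.B_add, mul_add]
          have l1 := hηb.mul (hY d)
          have l2 := hηb.mul (hY d')
          rw [e, ip_congr_ae (l1.dx_add l2) (ae_eq_refl _), ip_add_left l1.bm_dx l2.bm_dx hφ.bm]
        · intro s d
          have e : (fun x => ηb x * Y.B (s • d) x) = fun x => s * (ηb x * Y.B d x) := by
            funext x
            rw [Y.B_smul]
            ring
          rw [e, ip_congr_ae ((hηb.mul (hY d)).dx_const_mul s) (ae_eq_refl _), ip_smul_left,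
            smul_eq_mul]
    · have hφ := hY (Pi.single i 1)
      simp only [hge' _ hφ.bm]
      have hdadd : ∀ d d', dx (Y.B (d + d')) =ᵐ[mI] fun x => dx (Y.B d) x + dx (Y.B d') x :=
        fun d d' => by
          rw [Y.B_add]
          exact (hY d).dx_add (hY d')
      have hdsmul : ∀ (s : ℝ) d, dx (Y.B (s • d)) =ᵐ[mI] fun x => s * dx (Y.B d) x :=
        fun s d => by
          rw [Y.B_smul]
          exact (hY d).dx_const_mul s
      have hbil : IsBilinearMap ℝ fun d d' =>
          ip (fun x => Y.B d x * dx (Y.B d') x) (Y.B (Pi.single i 1)) := by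
        constructor
        · intro c c' d
          rw [← ip_add_left ((hY c).bm.mul (hY d).bm_dx) ((hY c').bm.mul (hY d).bm_dx) hφ.bm]
          refine ip_congr (fun x _ => ?_) fun _ _ => rfl
          simp only [Y.B_add, add_mul]
        · intro s c d
          rw [smul_eq_mul, ← ip_smul_left]
          refine ip_congr (fun x _ => ?_) fun _ _ => rfl
          simp only [Y.B_smul, mul_assoc]
        · intro c d d'
          rw [← ip_add_left ((hY c).bm.mul (hY d).bm_dx) ((hY c).bm.mul (hY d').bm_dx) hφ.bm]
          refine ip_congr_ae ?_ (ae_eq_refl _)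
          filter_upwards [hdadd d d'] with x hx
          rw [hx, mul_add]
        · intro s c d
          rw [smul_eq_mul, ← ip_smul_left]
          refine ip_congr_ae ?_ (ae_eq_refl _)
          filter_upwards [hdsmul s d] with x hx
          rw [hx]
          ring
      refine (contDiff_const.mul ((IsBilinearMap.contDiff hbil).comp
        (contDiff_snd.prodMk contDiff_snd))).sub
        ((IsLinearMap.contDiff (f := fun c => ip (dx (X.B c)) (Y.B (Pi.single i 1))) ?_).comp
          contDiff_fst)
      constructor
      · intro c c'
        rw [X.B_add, ip_congr_ae ((hX c).dx_add (hX c')) (ae_eq_refl _),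
          ip_add_left (hX c).bm_dx (hX c').bm_dx hφ.bm]
      · intro s c
        rw [X.B_smul, ip_congr_ae ((hX c).dx_const_mul s) (ae_eq_refl _), ip_smul_left,
          smul_eq_mul]
  · have h1 := hS _ (X.isLinearMap_ip hX (hg p)) (X.coord φ)
    rw [a_zero, ip_congr (fun _ _ => rfl) ((X.B_coord hφ).mono Ioo_subset_Icc_self)] at h1
    have h2 : ip (g p) (X.B (X.coord φ)) = ip (g p) φ :=
      ip_congr (fun _ _ => rfl) ((X.B_coord hφ).mono Ioo_subset_Icc_self)
    rw [h2, hge p hφ.lip.bm] at h1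
    linarith
  · have h1 := hS' _ (Y.isLinearMap_ip hY (hg' p)) (Y.coord χ)
    rw [a_congr μ (fun _ _ => rfl) (Y.B_coord hχ)] at h1
    have h2 : ip (g' p) (Y.B (Y.coord χ)) = ip (g' p) χ :=
      ip_congr (fun _ _ => rfl) ((Y.B_coord hχ).mono Ioo_subset_Icc_self)
    rw [h2, hge' p hχ.1.lip.bm] at h1
    linarith

end field

section ode

variable {r k : ℕ} {M : Mesh} (X : Coords (MemSh r k M)) (Y : Coords (MemSh0 r k M))
  {ε μ β T : ℝ} {b ζ₀ u₀ : ℝ → ℝ}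
  {F : (Fin X.n → ℝ) × (Fin Y.n → ℝ) → (Fin X.n → ℝ) × (Fin Y.n → ℝ)}

/-- Solutions of the differential equation for the coordinates solve the semidiscrete problem. -/
theorem isSemidiscrete_of_ode
    (hF : ∀ p, (∀ φ, MemSh r k M φ → ip (X.B (F p).1) φ
        + ε * ip (dx fun x => X.B p.1 x * Y.B p.2 x) φ
        + ip (dx fun x => etab β b x * Y.B p.2 x) φ = 0)
      ∧ ∀ χ, MemSh0 r k M χ → a μ (Y.B (F p).2) χ + ip (dx (X.B p.1)) χ
        + ε * ip (fun x => Y.B p.2 x * dx (Y.B p.2) x) χ = 0)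
    (hT : 0 < T) {y : ℝ → (Fin X.n → ℝ) × (Fin Y.n → ℝ)}
    (hy : ∀ s ∈ Icc 0 T, HasDerivWithinAt y (F (y s)) (Icc 0 T) s)
    (h0 : IsL2Proj r k M ζ₀ (X.B (y 0).1)) (h0' : IsEllProj μ r k M u₀ (Y.B (y 0).2)) :
    IsSemidiscrete ε μ β b T ζ₀ u₀ r k M (fun t => X.B (y t).1) (fun t => Y.B (y t).2) := by
  have hud := uniqueDiffOn_Icc hT
  have d1 : ∀ t ∈ Icc 0 T, ∀ x,
      HasDerivWithinAt (fun t => X.B (y t).1 x) (X.B (F (y t)).1 x) (Icc 0 T) t := fun t ht x =>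
    X.hasDerivWithinAt_B
      ((ContinuousLinearMap.fst ℝ (Fin X.n → ℝ) (Fin Y.n → ℝ)).hasFDerivAt.comp_hasDerivWithinAt t (hy t ht)) x
  have d2 : ∀ t ∈ Icc 0 T, ∀ x,
      HasDerivWithinAt (fun t => Y.B (y t).2 x) (Y.B (F (y t)).2 x) (Icc 0 T) t := fun t ht x =>
    Y.hasDerivWithinAt_B
      ((ContinuousLinearMap.snd ℝ (Fin X.n → ℝ) (Fin Y.n → ℝ)).hasFDerivAt.comp_hasDerivWithinAt t (hy t ht)) x
  have e1 : ∀ t ∈ Icc 0 T, dt T (fun t => X.B (y t).1) t = X.B (F (y t)).1 := fun t ht =>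
    funext fun x => (d1 t ht x).derivWithin (hud t ht)
  have e2 : ∀ t ∈ Icc 0 T, dt T (fun t => Y.B (y t).2) t = Y.B (F (y t)).2 := fun t ht =>
    funext fun x => (d2 t ht x).derivWithin (hud t ht)
  refine ⟨fun t _ => X.mem _, fun t _ => Y.mem _,
    fun x _ t ht => (d1 t ht x).differentiableWithinAt,
    fun x _ t ht => (d2 t ht x).differentiableWithinAt, fun t ht φ hφ => ?_, fun t ht χ hχ => ?_,
    h0, h0'⟩
  · rw [e1 t ht]
    exact (hF (y t)).1 φ hφ
  · rw [e2 t ht]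
    exact (hF (y t)).2 χ hχ

/-- The coordinates are a linear function of finitely many point values, so pointwise
differentiability in time passes to them, and the time derivative agrees on `[0,1]` with an element
of the space. -/
theorem Coords.dt_eq {Vp : (ℝ → ℝ) → Prop} (Z : Coords Vp) (hT : 0 < T) {w : ℝ → ℝ → ℝ}
    (hw : ∀ t ∈ Icc 0 T, Vp (w t)) (hd : TimeDiff T w) {t : ℝ} (ht : t ∈ Icc 0 T) :
    HasDerivWithinAt (fun t => Z.coord (w t)) (Z.coord (dt T w t)) (Icc 0 T) t ∧
      EqOn (dt T w t) (Z.B (Z.coord (dt T w t))) (Icc 0 1) := by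
  have h1 : HasDerivWithinAt (fun t => Z.coord (w t)) (Z.coord (dt T w t)) (Icc 0 T) t :=
    Z.hasDerivWithinAt_coord fun x hx => (hd x hx t ht).hasDerivWithinAt
  refine ⟨h1, fun x hx => ?_⟩
  have h2 := Z.hasDerivWithinAt_B h1 x
  have h3 : HasDerivWithinAt (fun t => w t x) (Z.B (Z.coord (dt T w t)) x) (Icc 0 T) t :=
    h2.congr (fun s hs => (Z.B_coord (hw s hs) hx).symm) (Z.B_coord (hw t ht) hx).symm
  exact h3.derivWithin (uniqueDiffOn_Icc hT t ht)

/-- The coordinates of a solution of the semidiscrete problem solve the differential equation. -/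
theorem IsSemidiscrete.ode (hμ : 0 < μ)
    (hF : ∀ p, (∀ φ, MemSh r k M φ → ip (X.B (F p).1) φ
        + ε * ip (dx fun x => X.B p.1 x * Y.B p.2 x) φ
        + ip (dx fun x => etab β b x * Y.B p.2 x) φ = 0)
      ∧ ∀ χ, MemSh0 r k M χ → a μ (Y.B (F p).2) χ + ip (dx (X.B p.1)) χ
        + ε * ip (fun x => Y.B p.2 x * dx (Y.B p.2) x) χ = 0)
    (hT : 0 < T) {ζh uh : ℝ → ℝ → ℝ} (h : IsSemidiscrete ε μ β b T ζ₀ u₀ r k M ζh uh) :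
    ∀ t ∈ Icc 0 T, HasDerivWithinAt (fun t => (X.coord (ζh t), Y.coord (uh t)))
      (F (X.coord (ζh t), Y.coord (uh t))) (Icc 0 T) t := by
  intro t ht
  obtain ⟨d1, e1⟩ := X.dt_eq hT h.zeta_mem h.zeta_timeDiff ht
  obtain ⟨d2, e2⟩ := Y.dt_eq hT h.u_mem h.u_timeDiff ht
  have s1 := X.B_coord (h.zeta_mem t ht)
  have s2 := Y.B_coord (h.u_mem t ht)
  obtain ⟨hF1, hF2⟩ := hF (X.coord (ζh t), Y.coord (uh t))
  simp only at hF1 hF2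
  have c1 : X.coord (dt T ζh t) = (F (X.coord (ζh t), Y.coord (uh t))).1 := by
    refine X.eq_of_a (ν := 0) le_rfl X.lip_Sh fun d => ?_
    have m1 := h.mass t ht _ (X.mem d)
    have m2 := hF1 _ (X.mem d)
    rw [a_zero, a_zero, ← ip_congr (e1.mono Ioo_subset_Icc_self) fun _ _ => rfl]
    have q1 : ip (dx fun x => X.B (X.coord (ζh t)) x * Y.B (Y.coord (uh t)) x) (X.B d) =
        ip (dx fun x => ζh t x * uh t x) (X.B d) :=
      ip_congr ((dx_congr fun x hx => by simp only [s1 hx, s2 hx]).mono Ioo_subset_Icc_self)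
        fun _ _ => rfl
    have q2 : ip (dx fun x => etab β b x * Y.B (Y.coord (uh t)) x) (X.B d) =
        ip (dx fun x => etab β b x * uh t x) (X.B d) :=
      ip_congr ((dx_congr fun x hx => by simp only [s2 hx]).mono Ioo_subset_Icc_self)
        fun _ _ => rfl
    rw [q1, q2] at m2
    linarith
  have c2 : Y.coord (dt T uh t) = (F (X.coord (ζh t), Y.coord (uh t))).2 := by
    refine Y.eq_of_a hμ.le Y.lip_Sh0 fun d => ?_
    have m1 := h.momentum t ht _ (Y.mem d)
    have m2 := hF2 _ (Y.mem d)
    rw [← a_congr μ e2 fun _ _ => rfl]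
    have q1 : ip (dx (X.B (X.coord (ζh t)))) (Y.B d) = ip (dx (ζh t)) (Y.B d) :=
      ip_congr ((dx_congr s1).mono Ioo_subset_Icc_self) fun _ _ => rfl
    have q2 : ip (fun x => Y.B (Y.coord (uh t)) x * dx (Y.B (Y.coord (uh t))) x) (Y.B d) =
        ip (fun x => uh t x * dx (uh t) x) (Y.B d) :=
      ip_congr (fun x hx => by
        have hx' := Ioo_subset_Icc_self hx
        simp only [s2 hx', dx_congr s2 hx']) fun _ _ => rfl
    rw [q1, q2] at m2
    linarith
  have := d1.prodMk d2
  rwa [c1, c2] at this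

end ode

/-! ### The projections of the exact solution as paths in time. -/

section projection

variable {Vp : (ℝ → ℝ) → Prop} (X : Coords Vp) {ν T : ℝ}

/-- Riesz representatives of a differentiable path of functionals. -/
theorem Coords.exists_riesz_path (hν : 0 ≤ ν) (hX : ∀ c, Lip (X.B c))
    {Φ Φ' : ℝ → (Fin X.n → ℝ) → ℝ} (hΦ : ∀ t ∈ Icc 0 T, IsLinearMap ℝ (Φ t))
    (hΦ' : ∀ t ∈ Icc 0 T, IsLinearMap ℝ (Φ' t))
    (hd : ∀ c, ∀ t ∈ Icc 0 T, HasDerivWithinAt (fun s => Φ s c) (Φ' t c) (Icc 0 T) t) :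
    ∃ Z Z' : ℝ → Fin X.n → ℝ, ∀ t ∈ Icc 0 T, HasDerivWithinAt Z (Z' t) (Icc 0 T) t ∧
      (∀ c, a ν (X.B (Z t)) (X.B c) = Φ t c) ∧ ∀ c, a ν (X.B (Z' t)) (X.B c) = Φ' t c := by
  obtain ⟨S, hS⟩ := X.exists_solver hν hX
  refine ⟨fun t => S fun i => Φ t (Pi.single i 1), fun t => S fun i => Φ' t (Pi.single i 1),
    fun t ht => ⟨?_, hS _ (hΦ t ht), hS _ (hΦ' t ht)⟩⟩
  exact S.hasFDerivAt.comp_hasDerivWithinAt t (hasDerivWithinAt_pi.2 fun i => hd _ t ht)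

/-- Expand the square: the mixed term is a finite sum over coordinates. This is what makes the
maximum over `[0,T]` attained. -/
theorem Coords.continuousOn_a_sub (hX : ∀ c, Lip (X.B c)) {w : ℝ → ℝ → ℝ} {s : Set ℝ}
    (hw : ∀ t ∈ s, Lip (w t)) (hww : ContinuousOn (fun t => a ν (w t) (w t)) s)
    (hwX : ∀ c, ContinuousOn (fun t => a ν (w t) (X.B c)) s) {c : ℝ → Fin X.n → ℝ}
    (hc : ContinuousOn c s) :
    ContinuousOn (fun t => a ν (fun x => w t x - X.B (c t) x) (fun x => w t x - X.B (c t) x)) s := by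
  have h1 : ContinuousOn (fun t => a ν (w t) (X.B (c t))) s := by
    have : ContinuousOn (fun t => ∑ i, c t i * a ν (w t) (X.B (Pi.single i 1))) s :=
      continuousOn_finsetSum _ fun i _ => (continuousOn_pi.1 hc i).mul (hwX _)
    exact this.congr fun t ht => IsLinearMap.apply_eq_sum (X.isLinearMap_a hX (hw t ht)) (c t)
  have h2 : ContinuousOn (fun t => a ν (X.B (c t)) (X.B (c t))) s :=
    (X.isBilinearMap_a (ν := ν) hX).toContinuousBilinearMap.isBoundedBilinearMap.continuous
      |>.comp_continuousOn (hc.prodMk hc)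
  refine ((hww.sub (h1.const_mul 2)).add h2).congr fun t ht => ?_
  have l1 := hw t ht
  have l2 := hX (c t)
  simp only [Pi.add_apply, Pi.sub_apply]
  rw [a_sub_left ν l1 l2 (l1.sub l2), a_sub_right ν l1 l2 l1, a_sub_right ν l1 l2 l2,
    a_comm ν (X.B (c t)) (w t)]
  ring

end projection

section exact

variable {ε μ β T : ℝ} {b ζ₀ u₀ : ℝ → ℝ} {ζ u : ℝ → ℝ → ℝ} {r : ℕ}

theorem IsSmooth.hasDerivWithinAt_ip_zeta (hsm : IsSmooth r T ζ u) {g : ℝ → ℝ} (hg : BM g) {t : ℝ}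
    (ht : t ∈ Icc 0 T) : HasDerivWithinAt (fun s => ip (ζ s) g) (ip (dt T ζ t) g) (Icc 0 T) t :=
  hasDerivWithinAt_ip (fun s hs x hx =>
    (hsm.zeta_timeDiff x (Ioo_subset_Icc_self hx) s hs).hasDerivWithinAt)
    hsm.zeta_time.continuousOn (fun _ hs => ContinuousOn.bm (hsm.zeta_space.slice_continuousOn hs))
    (fun _ hs => ContinuousOn.bm (hsm.zeta_time.slice_continuousOn hs)) hg ht

theorem IsSmooth.hasDerivWithinAt_a_u (hsm : IsSmooth r T ζ u) (hr : 2 ≤ r) {g : ℝ → ℝ}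
    (hg : Lip g) (ν : ℝ) {t : ℝ} (ht : t ∈ Icc 0 T) :
    HasDerivWithinAt (fun s => a ν (u s) g) (a ν (dt T u t) g) (Icc 0 T) t := by
  have h1 : HasDerivWithinAt (fun s => ip (u s) g) (ip (dt T u t) g) (Icc 0 T) t :=
    hasDerivWithinAt_ip (fun s hs x hx =>
      (hsm.u_timeDiff x (Ioo_subset_Icc_self hx) s hs).hasDerivWithinAt)
      hsm.u_time.continuousOn (fun _ hs => ContinuousOn.bm (hsm.u_space.slice_continuousOn hs))
      (fun _ hs => ContinuousOn.bm (hsm.u_time.slice_continuousOn hs)) hg.bm ht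
  have h2 : HasDerivWithinAt (fun s => ip (dx (u s)) (dx g)) (ip (dx (dt T u t)) (dx g))
      (Icc 0 T) t :=
    hasDerivWithinAt_ip (w := fun s => dx (u s)) (w' := fun s => dx (dt T u s))
      (fun _ hs _ hx => hasDerivWithinAt_dx hsm.u_space (by omega) hsm.u_timeDiff hsm.u_time hs hx)
      (hsm.u_time.continuousOn_dx one_le_two)
      (fun _ hs => (hsm.u_space.lip (by omega) hs).bm_dx)
      (fun _ hs => (hsm.u_time.lip one_le_two hs).bm_dx) hg.bm_dx ht
  exact h1.add (h2.const_mul _)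

theorem IsSmooth.continuousOn_a_u_self (hsm : IsSmooth r T ζ u) (hr : 2 ≤ r) (hT : 0 ≤ T) (ν : ℝ) :
    ContinuousOn (fun t => a ν (u t) (u t)) (Icc 0 T) :=
  (continuousOn_ip_self hT hsm.u_space.continuousOn).add
    ((continuousOn_ip_self (w := fun t => dx (u t)) hT
      (hsm.u_space.continuousOn_dx (by omega))).const_mul _)

end exact

/-! ### Projection errors and the energy inequality with explicit powers of `h`. -/

theorem ip_self_le {f : ℝ → ℝ} {K : ℝ} (hK : ∀ x ∈ Ioo (0 : ℝ) 1, |f x| ≤ K) :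
    ip f f ≤ K ^ 2 := by
  have h := norm_setIntegral_le_of_norm_le_const (μ := volume) (s := Ioo (0 : ℝ) 1)
    (f := fun x => f x * f x) (C := K ^ 2) (by simp) fun x hx => by
      rw [norm_mul, ← sq]
      exact pow_le_pow_left₀ (norm_nonneg _) (hK x hx) 2
  rw [ip_eq]
  refine (le_abs_self _).trans (h.trans ?_)
  simp [Measure.real]

theorem a_self_le {f : ℝ → ℝ} {K ν : ℝ} (hν : 0 ≤ ν) (hf : LipC K f) (h0 : f 0 = 0) :
    a ν f f ≤ (1 + ν / 3) * K ^ 2 := by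
  have h1 := ip_self_le (f := f) fun x hx => hf.abs_le h0 (Ioo_subset_Icc_self hx)
  have h2 := ip_self_le (f := dx f) fun x hx => hf.abs_dx_le hx
  have h3 : ν / 3 * ip (dx f) (dx f) ≤ ν / 3 * K ^ 2 :=
    mul_le_mul_of_nonneg_left h2 (by positivity)
  rw [a]
  linarith

/-- The Pythagorean identity for a projection `w` of `v` tested with `w` and `s`. -/
theorem a_pythagoras {ν : ℝ} {v w s : ℝ → ℝ} (hv : Lip v) (hw : Lip w) (hs : Lip s)
    (h1 : a ν w w = a ν v w) (h2 : a ν w s = a ν v s) :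
    a ν (fun x => v x - s x) (fun x => v x - s x) =
      a ν (fun x => v x - w x) (fun x => v x - w x) +
        a ν (fun x => w x - s x) (fun x => w x - s x) := by
  rw [a_sub_left ν hv hs (hv.sub hs), a_sub_left ν hv hw (hv.sub hw),
    a_sub_left ν hw hs (hw.sub hs), a_sub_right ν hv hs hv, a_sub_right ν hv hs hs,
    a_sub_right ν hv hw hv, a_sub_right ν hv hw hw, a_sub_right ν hw hs hw,
    a_sub_right ν hw hs hs, a_comm ν s v, a_comm ν w v, a_comm ν s w, h1, h2]
  ring

theorem ip_self_sub_le {f g : ℝ → ℝ} (hf : BM f) (hg : BM g) :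
    ip (fun x => f x - g x) (fun x => f x - g x) ≤ 2 * (ip f f + ip g g) := by
  simp only [ip_eq]
  rw [← integral_add (hf.mul hf).integrable (hg.mul hg).integrable, ← integral_const_mul]
  refine integral_mono ((hf.sub hg).mul (hf.sub hg)).integrable
    (((hf.mul hf).add (hg.mul hg)).const_mul 2).integrable fun x => ?_
  simp only []
  nlinarith [sq_nonneg (f x + g x)]

theorem a_self_sub_le {f g : ℝ → ℝ} {ν : ℝ} (hν : 0 ≤ ν) (hf : Lip f) (hg : Lip g) :
    a ν (fun x => f x - g x) (fun x => f x - g x) ≤ 2 * (a ν f f + a ν g g) := by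
  have h1 := ip_self_sub_le hf.bm hg.bm
  have h2 := mul_le_mul_of_nonneg_left (ip_self_sub_le hf.bm_dx hg.bm_dx)
    (show 0 ≤ ν / 3 by positivity)
  have h3 := hf.dx_sub hg
  rw [a, ip_congr_ae h3 h3, a, a]
  linarith

theorem ip_dx_self_le_a {μ : ℝ} (hμ : 0 < μ) (f : ℝ → ℝ) :
    ip (dx f) (dx f) ≤ 3 / μ * a μ f f := by
  rw [a, mul_add, ← mul_assoc, show 3 / μ * (μ / 3) = 1 by field_simp, one_mul]
  have := ip_self_nonneg f
  have : 0 ≤ 3 / μ * ip f f := by positivity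
  linarith

section approx

variable {r k : ℕ} {T : ℝ} {w : ℝ → ℝ → ℝ}

/-- With `r = m + 2`, splines of degree `r - 1` and class `C^(r-2)` lie in `S_h` for every `k ≤ r -
2`. The constant is uniform in `t` because the `r`-th derivative is bounded on `[0,T] × [0,1]`. -/
theorem exists_approx (hr : 2 ≤ r) (hk : k ≤ r - 2) (hw : ContCm T r w) :
    ∃ D ≥ 0, ∀ M : Mesh, ∀ t ∈ Icc 0 T, ∃ s, MemSh r k M s ∧
      ∀ x ∈ Icc (0 : ℝ) 1, |w t x - s x| ≤ D * M.h ^ r := by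
  obtain ⟨m, rfl⟩ := Nat.exists_eq_add_of_le' hr
  obtain ⟨C, hC⟩ := exists_splineApprox m
  obtain ⟨A, hA, hA'⟩ := hw.exists_bound le_rfl
  refine ⟨|C| * A, by positivity, fun M t ht => ?_⟩
  obtain ⟨s, hs, hs'⟩ := hC M.node M.N M.h M.node_strictMono M.node_zero M.node_N M.node_gap_le
    (w t) A (hw.1 t ht) (hA' t ht)
  refine ⟨s, hs.memSh (by omega), fun x hx => (hs' x hx).trans ?_⟩
  have h1 := M.h_pos
  calc C * M.h ^ (m + 2) * A ≤ |C| * M.h ^ (m + 2) * A := by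
        gcongr
        exact le_abs_self C
    _ = _ := by ring

theorem exists_approx_lip (hr : 2 ≤ r) (hk : k ≤ r - 2) (hw : ContCm T r w)
    (h0 : ∀ t ∈ Icc 0 T, w t 0 = 0) (h1 : ∀ t ∈ Icc 0 T, w t 1 = 0) :
    ∃ D ≥ 0, ∀ M : Mesh, ∀ t ∈ Icc 0 T, ∃ s, MemSh0 r k M s ∧
      LipC (D * M.h ^ (r - 1)) (fun x => w t x - s x) := by
  obtain ⟨m, rfl⟩ := Nat.exists_eq_add_of_le' hr
  obtain ⟨C, hC⟩ := exists_splineApproxDeriv m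
  obtain ⟨A, hA, hA'⟩ := hw.exists_bound le_rfl
  refine ⟨|C| * A, by positivity, fun M t ht => ?_⟩
  obtain ⟨s, hs, hs', hs0, hs1⟩ := hC M.node M.N M.h M.node_strictMono M.node_zero M.node_N
    M.node_gap_le (w t) A (hw.1 t ht) (hA' t ht)
  refine ⟨s, ⟨hs.memSh (by omega), hs0.trans (h0 t ht), hs1.trans (h1 t ht)⟩, hs'.mono ?_⟩
  have h1 := M.h_pos
  calc C * M.h ^ (m + 1) * A ≤ |C| * M.h ^ (m + 1) * A := by
        gcongr
        exact le_abs_self C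
    _ = |C| * A * M.h ^ (m + 2 - 1) := by
        rw [show m + 2 - 1 = m + 1 by omega]
        ring

end approx

section bounds

variable {r k : ℕ} {T ε μ β : ℝ} {b ζ₀ u₀ : ℝ → ℝ} {ζ u : ℝ → ℝ → ℝ}

/-- By `a_pythagoras` a projection is a best approximation, so the spline error bounds its error, on
arbitrary meshes. -/
theorem exists_projection_error (hr : 2 ≤ r) (hk : k ≤ r - 2) (hμ : 0 < μ)
    (hsol : IsSolution ε μ β b T ζ₀ u₀ ζ u) (hsm : IsSmooth r T ζ u) :
    ∃ D ≥ 0, ∀ M : Mesh, ∀ t ∈ Icc 0 T, ∀ z v : ℝ → ℝ, IsL2Proj r k M (ζ t) z →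
      IsEllProj μ r k M (u t) v →
      ip (fun x => ζ t x - z x) (fun x => ζ t x - z x) ≤ D * (M.h ^ r) ^ 2 ∧
      a μ (fun x => u t x - v x) (fun x => u t x - v x) ≤ D * (M.h ^ (r - 1)) ^ 2 := by
  obtain ⟨D₁, hD₁, H₁⟩ := exists_approx hr hk hsm.zeta_space
  obtain ⟨D₂, hD₂, H₂⟩ := exists_approx_lip hr hk hsm.u_space hsol.u_left hsol.u_right
  refine ⟨max (D₁ ^ 2) ((1 + μ / 3) * D₂ ^ 2), le_max_of_le_left (by positivity),
    fun M t ht z v hz hv => ⟨?_, ?_⟩⟩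
  · obtain ⟨s, hs, hs'⟩ := H₁ M t ht
    have h1 := a_pythagoras (ν := 0) (hsm.zeta_space.lip (by omega) ht) hz.1.lip hs.lip
      (by rw [a_zero, a_zero]; exact hz.2 z hz.1) (by rw [a_zero, a_zero]; exact hz.2 s hs)
    simp only [a_zero] at h1
    have h2 := ip_self_nonneg (fun x => z x - s x)
    have h3 := ip_self_le (f := fun x => ζ t x - s x) fun x hx => hs' x (Ioo_subset_Icc_self hx)
    rw [mul_pow] at h3
    have h4 : D₁ ^ 2 * (M.h ^ r) ^ 2 ≤ max (D₁ ^ 2) ((1 + μ / 3) * D₂ ^ 2) * (M.h ^ r) ^ 2 :=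
      mul_le_mul_of_nonneg_right (le_max_left _ _) (sq_nonneg _)
    linarith
  · obtain ⟨s, hs, hs'⟩ := H₂ M t ht
    have h1 := a_pythagoras (ν := μ) (hsm.u_space.lip (by omega) ht) hv.1.1.lip hs.1.lip
      (hv.2 v hv.1) (hv.2 s hs)
    have h2 := a_self_nonneg hμ.le (fun x => v x - s x)
    have h3 := a_self_le hμ.le hs' (by rw [hsol.u_left t ht, hs.2.1, sub_zero])
    rw [mul_pow, ← mul_assoc] at h3
    have h4 : (1 + μ / 3) * D₂ ^ 2 * (M.h ^ (r - 1)) ^ 2 ≤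
        max (D₁ ^ 2) ((1 + μ / 3) * D₂ ^ 2) * (M.h ^ (r - 1)) ^ 2 :=
      mul_le_mul_of_nonneg_right (le_max_right _ _) (sq_nonneg _)
    linarith

/-- Finite element functions close to the elliptic projection are uniformly Lipschitz. -/
theorem exists_lip_bound (hr : 2 ≤ r) (hk : k ≤ r - 2) (hμ : 0 < μ) (γ : ℝ)
    (hsol : IsSolution ε μ β b T ζ₀ u₀ ζ u) (hsm : IsSmooth r T ζ u) :
    ∃ B ≥ 0, ∀ M : Mesh, M.Quasiuniform γ → M.h ≤ 1 → ∀ t ∈ Icc 0 T, ∀ v uh : ℝ → ℝ,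
      IsEllProj μ r k M (u t) v → MemSh0 r k M uh →
      a μ (fun x => v x - uh x) (fun x => v x - uh x) ≤ M.h → LipC B uh := by
  obtain ⟨D, hD, H⟩ := exists_approx_lip hr hk hsm.u_space hsol.u_left hsol.u_right
  obtain ⟨A, hA, hA'⟩ := hsm.u_space.exists_lipC (by omega)
  obtain ⟨C, hC, HC⟩ := exists_inverse_max r γ
  set E : ℝ := C * (3 / μ * (2 * ((1 + μ / 3) * D ^ 2 + 1))) with hE
  have hE0 : 0 ≤ E := by positivity
  -- The spline `s` near `u t` has Lipschitz constant at most `A + D`. The difference `uh - s` has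
  -- energy `O(h)`, just enough for the maximum-norm inverse inequality to bound its derivative; `1
  -- + E` is used because `E ≤ (1 + E) ^ 2`.
  refine ⟨(A + D) + (1 + E), by positivity, fun M hM hh t ht v uh hv huh hle => ?_⟩
  have hpos := M.h_pos
  obtain ⟨s, hs, hs'⟩ := H M t ht
  have hpow : M.h ^ (r - 1) ≤ 1 := pow_le_one₀ hpos.le hh
  have hpow2 : (M.h ^ (r - 1)) ^ 2 ≤ M.h := by
    calc (M.h ^ (r - 1)) ^ 2 ≤ (M.h ^ 1) ^ 2 := by
          gcongr ?_ ^ 2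
          exact pow_le_pow_of_le_one hpos.le hh (by omega)
      _ ≤ M.h := by nlinarith
  have h1 := a_pythagoras (ν := μ) (hsm.u_space.lip (by omega) ht) hv.1.1.lip hs.1.lip
    (hv.2 v hv.1) (hv.2 s hs)
  have h2 := a_self_nonneg hμ.le (fun x => u t x - v x)
  have h3 := a_self_le hμ.le hs' (by rw [hsol.u_left t ht, hs.2.1, sub_zero])
  have h4 : a μ (fun x => v x - s x) (fun x => v x - s x) ≤ (1 + μ / 3) * D ^ 2 * M.h := by
    calc _ ≤ (1 + μ / 3) * (D * M.h ^ (r - 1)) ^ 2 := by linarith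
      _ = (1 + μ / 3) * D ^ 2 * (M.h ^ (r - 1)) ^ 2 := by ring
      _ ≤ _ := by gcongr
  have h5 := a_self_sub_le hμ.le (hv.1.1.lip.sub hs.1.lip) (hv.1.1.lip.sub huh.1.lip)
  have e5 : (fun x => v x - s x - (v x - uh x)) = fun x => uh x - s x := by
    funext x
    ring
  rw [e5] at h5
  have h6 : LipC (1 + E) (fun x => uh x - s x) := by
    refine HC k M _ (1 + E) hM (huh.1.sub hs.1) (by positivity) ?_
    calc C * ip (dx fun x => uh x - s x) (dx fun x => uh x - s x)
        ≤ C * (3 / μ * (2 * ((1 + μ / 3) * D ^ 2 * M.h + M.h))) := by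
          gcongr
          refine (ip_dx_self_le_a hμ _).trans ?_
          gcongr
          linarith
      _ = M.h * E := by
          rw [hE]
          ring
      _ ≤ M.h * (1 + E) ^ 2 := by
          gcongr
          nlinarith
  have h7 : LipC (A + D) s := by
    have := ((hA' t ht).1.sub hs').congr (g := s) fun x _ => by ring
    exact this.mono (by nlinarith)
  exact (h7.add h6).congr fun x _ => by ring

/-- The energy inequality at a fixed time. -/
theorem exists_energy_rate (hr : 2 ≤ r) (hk : k ≤ r - 2) (hε : 0 < ε) (hμ : 0 < μ) (γ : ℝ)
    (hb : ContDiffOn ℝ 2 b (Icc 0 1))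
    (hsol : IsSolution ε μ β b T ζ₀ u₀ ζ u) (hsm : IsSmooth r T ζ u) :
    ∃ Q > 0, ∀ M : Mesh, M.Quasiuniform γ → M.h ≤ 1 → ∀ t ∈ Icc 0 T, ∀ z v zh uh : ℝ → ℝ,
      IsL2Proj r k M (ζ t) z → IsEllProj μ r k M (u t) v → MemSh r k M zh → MemSh0 r k M uh →
      a μ (fun x => v x - uh x) (fun x => v x - uh x) ≤ M.h →
      2 * ((-ip (dx fun x => (ε * ζ t x + etab β b x) * u t x) (fun x => z x - zh x)
          + ε * ip (dx fun x => zh x * uh x) (fun x => z x - zh x)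
          + ip (dx fun x => etab β b x * uh x) (fun x => z x - zh x))
        + (-ip (dx (ζ t)) (fun x => v x - uh x)
          - ε * ip (fun x => u t x * dx (u t) x) (fun x => v x - uh x)
          + ip (dx zh) (fun x => v x - uh x)
          + ε * ip (fun x => uh x * dx uh x) (fun x => v x - uh x)))
      ≤ Q * (ip (fun x => z x - zh x) (fun x => z x - zh x)
          + a μ (fun x => v x - uh x) (fun x => v x - uh x)) + Q * (M.h ^ (r - 1)) ^ 2 := by
  obtain ⟨D, hD, HD⟩ := exists_projection_error hr hk hμ hsol hsm
  obtain ⟨B, hB, HB⟩ := exists_lip_bound hr hk hμ γ hsol hsm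
  obtain ⟨C, hC, HC⟩ := exists_inverse_L2 r γ
  obtain ⟨A₁, hA₁, HA₁⟩ := hsm.zeta_space.exists_lipC (by omega)
  obtain ⟨A₂, hA₂, HA₂⟩ := hsm.u_space.exists_lipC (by omega)
  obtain ⟨A₃, HA₃⟩ := lip_etab (β := β) hb
  obtain ⟨A₄, HA₄⟩ := isCompact_Icc.exists_bound_of_continuousOn (Lip.continuousOn ⟨A₃, HA₃⟩)
  have hA₃ := HA₃.nonneg
  have hA₄ : 0 ≤ A₄ := (norm_nonneg _).trans (HA₄ 0 (by simp))
  -- One bound for the depth, its slope and the slope of `u`.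
  set A := ε * A₁ + A₃ + A₄ + A₂ with hA
  have hA0 : 0 ≤ A := by positivity
  set P := 1 + A + 2 * ε * A + ε * B
  have hP : 0 < P := by positivity
  refine ⟨2 * P * (2 + 3 / μ + C + D * (3 + 3 / μ)), by positivity,
    fun M hM hh t ht z v zh uh hz hv hzh huh hle => ?_⟩
  have hpos := M.h_pos
  have key := energy_static (A := A) (B := B) hε hpos (hsm.zeta_space.lip (by omega) ht) hz.1.lip
    hzh.lip ((HA₂ t ht).1.mono (L := A) (by rw [hA]; nlinarith [mul_nonneg hε.le hA₁])) hv.1.1.lip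
    (HB M hM hh t ht v uh hv huh hle) ⟨A₃, HA₃⟩
    ((((HA₁ t ht).1.const_mul ε).add HA₃).mono (by rw [abs_of_pos hε, hA]; linarith))
    (fun x hx => by
      refine (abs_add_le _ _).trans ?_
      rw [abs_mul, abs_of_pos hε]
      have q1 := mul_le_mul_of_nonneg_left ((HA₁ t ht).2 x hx) hε.le
      have q2 := HA₄ x hx
      rw [Real.norm_eq_abs] at q2
      rw [hA]
      linarith) huh.2.1 huh.2.2 hv.1.2.1 hv.1.2.2
  obtain ⟨p1, p2⟩ := HD M t ht z v hz hv
  have p3 := HC k M _ hM (hz.1.sub hzh)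
  have p4 := ip_self_le_a hμ.le (fun x => v x - uh x)
  have p5 := ip_dx_self_le_a hμ (fun x => v x - uh x)
  have p6 := ip_self_le_a hμ.le (fun x => u t x - v x)
  have p7 := ip_dx_self_le_a hμ (fun x => u t x - v x)
  have n1 := ip_self_nonneg (fun x => z x - zh x)
  have n2 := a_self_nonneg hμ.le (fun x => v x - uh x)
  set θθ := ip (fun x => z x - zh x) (fun x => z x - zh x)
  set ξξ := a μ (fun x => v x - uh x) (fun x => v x - uh x)
  set ρρ := ip (fun x => ζ t x - z x) (fun x => ζ t x - z x)
  set σσ := a μ (fun x => u t x - v x) (fun x => u t x - v x)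
  set H := M.h ^ (r - 1) with hH
  have hHr : M.h ^ r = M.h * H := by
    rw [hH, ← pow_succ']
    congr 1
    omega
  have hH0 : 0 ≤ H := by positivity
  -- Here the order drops from `r` to `r - 1`.
  have p8 : (M.h ^ 2)⁻¹ * ρρ ≤ D * H ^ 2 := by
    rw [inv_mul_le_iff₀ (by positivity)]
    refine p1.trans (le_of_eq ?_)
    rw [hHr]
    ring
  have p9 : ρρ ≤ D * H ^ 2 := by
    refine p1.trans ?_
    rw [hHr]
    gcongr
    exact mul_le_of_le_one_left hH0 hh
  have p10 : 3 / μ * σσ ≤ 3 / μ * (D * H ^ 2) := by gcongr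
  calc _ ≤ 2 * (P * (θθ + ξξ + 3 / μ * ξξ + D * H ^ 2 + 3 / μ * (D * H ^ 2) + D * H ^ 2
        + D * H ^ 2 + C * θθ)) := by
        refine mul_le_mul_of_nonneg_left (key.trans (mul_le_mul_of_nonneg_left ?_ hP.le)) zero_le_two
        linarith
    _ = 2 * P * ((1 + C) * θθ + (1 + 3 / μ) * ξξ + D * (3 + 3 / μ) * H ^ 2) := by ring
    _ ≤ 2 * P * ((2 + 3 / μ + C + D * (3 + 3 / μ)) * θθ + (2 + 3 / μ + C + D * (3 + 3 / μ)) * ξξ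
        + (2 + 3 / μ + C + D * (3 + 3 / μ)) * H ^ 2) := by
        have m1 : 0 < 3 / μ := by positivity
        have m2 : 0 ≤ D * (3 + 3 / μ) := by positivity
        have m3 := mul_le_mul_of_nonneg_right
          (show 1 + C ≤ 2 + 3 / μ + C + D * (3 + 3 / μ) by linarith) n1
        have m4 := mul_le_mul_of_nonneg_right
          (show 1 + 3 / μ ≤ 2 + 3 / μ + C + D * (3 + 3 / μ) by linarith) n2
        have m5 := mul_le_mul_of_nonneg_right
          (show D * (3 + 3 / μ) ≤ 2 + 3 / μ + C + D * (3 + 3 / μ) by linarith) (sq_nonneg H)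
        exact mul_le_mul_of_nonneg_left (by linarith) (by positivity)
    _ = _ := by ring

end bounds

/-! ### The bootstrap: closeness to the projections on any interval of existence. -/

namespace Coords

variable {Vp : (ℝ → ℝ) → Prop} (X : Coords Vp) {ν : ℝ}

theorem a_B_sub_left (hX : ∀ c, Lip (X.B c)) (c d e : Fin X.n → ℝ) :
    a ν (X.B (c - d)) (X.B e) = a ν (X.B c) (X.B e) - a ν (X.B d) (X.B e) := by
  rw [X.B_sub, a_sub_left ν (hX c) (hX d) (hX e)]

theorem hasDerivWithinAt_a_self (hX : ∀ c, Lip (X.B c)) {c : ℝ → Fin X.n → ℝ}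
    {c' : Fin X.n → ℝ} {s : Set ℝ} {t : ℝ} (hc : HasDerivWithinAt c c' s t) :
    HasDerivWithinAt (fun t => a ν (X.B (c t)) (X.B (c t))) (2 * a ν (X.B c') (X.B (c t))) s t := by
  have h := (X.isBilinearMap_a (ν := ν) hX).toContinuousBilinearMap.isBoundedBilinearMap
    |>.hasFDerivAt (c t, c t) |>.comp_hasDerivWithinAt t (hc.prodMk hc)
  refine h.congr_deriv ?_
  change a ν (X.B (c t)) (X.B c') + a ν (X.B c') (X.B (c t)) = _
  rw [a_comm ν (X.B (c t))]
  ring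

/-- The constant `m` depends on the mesh. It only serves to exclude blow-up on a fixed mesh, so no
uniformity is needed. -/
theorem exists_norm_bound (hν : 0 ≤ ν) (hX : ∀ c, Lip (X.B c)) :
    ∃ m > 0, ∀ c, m * ‖c‖ ^ 2 ≤ a ν (X.B c) (X.B c) := by
  have hb := X.isBilinearMap_a (ν := ν) hX
  refine exists_quadratic_lower_bound (q := fun c => a ν (X.B c) (X.B c))
    (hb.toContinuousBilinearMap.isBoundedBilinearMap.continuous.comp
      (continuous_id.prodMk continuous_id)) (fun s c => ?_) fun c hc => ?_
  · simp only [hb.smul_left, hb.smul_right, smul_eq_mul]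
    ring
  · exact (a_self_nonneg hν _).lt_of_ne fun h => hc (X.eq_zero_of_a hν hX h.symm)

end Coords

section main

variable {r k : ℕ} {T ε μ β : ℝ} {b ζ₀ u₀ : ℝ → ℝ} {ζ u : ℝ → ℝ → ℝ} {M : Mesh}

theorem isL2Proj_of_coords (X : Coords (MemSh r k M)) {v : ℝ → ℝ} {c : Fin X.n → ℝ}
    (h : ∀ d, a 0 (X.B c) (X.B d) = ip v (X.B d)) : IsL2Proj r k M v (X.B c) := by
  refine ⟨X.mem c, fun φ hφ => ?_⟩
  have e := (X.B_coord hφ).mono Ioo_subset_Icc_self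
  rw [← ip_congr (fun _ _ => rfl) e, ← ip_congr (fun _ _ => rfl) e, ← h, a_zero]

theorem isEllProj_of_coords (Y : Coords (MemSh0 r k M)) {v : ℝ → ℝ} {c : Fin Y.n → ℝ}
    (h : ∀ d, a μ (Y.B c) (Y.B d) = a μ v (Y.B d)) : IsEllProj μ r k M v (Y.B c) := by
  refine ⟨Y.mem c, fun χ hχ => ?_⟩
  have e := Y.B_coord hχ
  rw [← a_congr μ (fun _ _ => rfl) e, ← a_congr μ (fun _ _ => rfl) e, h]

theorem IsL2Proj.congr {v v' w : ℝ → ℝ} (h : IsL2Proj r k M v w) (e : EqOn v v' (Icc 0 1)) :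
    IsL2Proj r k M v' w :=
  ⟨h.1, fun φ hφ => (h.2 φ hφ).trans (ip_congr (e.mono Ioo_subset_Icc_self) fun _ _ => rfl)⟩

theorem IsEllProj.congr {v v' w : ℝ → ℝ} (h : IsEllProj μ r k M v w) (e : EqOn v v' (Icc 0 1)) :
    IsEllProj μ r k M v' w :=
  ⟨h.1, fun φ hφ => (h.2 φ hφ).trans (a_congr μ e fun _ _ => rfl)⟩

/-- Superconvergence: solutions of the semidiscrete problem are close to the projections of the
exact solution, as long as they exist. -/
theorem exists_energy_bound (hr : 2 ≤ r) (hk : k ≤ r - 2) (hε : 0 < ε) (hμ : 0 < μ)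
    (γ : ℝ) (hb : ContDiffOn ℝ 2 b (Icc 0 1))
    (hsol : IsSolution ε μ β b T ζ₀ u₀ ζ u) (hsm : IsSmooth r T ζ u) :
    ∃ h₀ > 0, ∃ K ≥ 0, h₀ ≤ 1 ∧ ∀ M : Mesh, M.Quasiuniform γ → M.h ≤ h₀ →
      ∀ (X : Coords (MemSh r k M)) (Y : Coords (MemSh0 r k M))
        (F : (Fin X.n → ℝ) × (Fin Y.n → ℝ) → (Fin X.n → ℝ) × (Fin Y.n → ℝ)),
      (∀ p, (∀ φ, MemSh r k M φ → ip (X.B (F p).1) φ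
          + ε * ip (dx fun x => X.B p.1 x * Y.B p.2 x) φ
          + ip (dx fun x => etab β b x * Y.B p.2 x) φ = 0)
        ∧ ∀ χ, MemSh0 r k M χ → a μ (Y.B (F p).2) χ + ip (dx (X.B p.1)) χ
          + ε * ip (fun x => Y.B p.2 x * dx (Y.B p.2) x) χ = 0) →
      ∀ (Z Z' : ℝ → Fin X.n → ℝ) (V V' : ℝ → Fin Y.n → ℝ),
      (∀ t ∈ Icc 0 T, HasDerivWithinAt Z (Z' t) (Icc 0 T) t ∧
        (∀ c, a 0 (X.B (Z t)) (X.B c) = ip (ζ t) (X.B c)) ∧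
        ∀ c, a 0 (X.B (Z' t)) (X.B c) = ip (dt T ζ t) (X.B c)) →
      (∀ t ∈ Icc 0 T, HasDerivWithinAt V (V' t) (Icc 0 T) t ∧
        (∀ c, a μ (Y.B (V t)) (Y.B c) = a μ (u t) (Y.B c)) ∧
        ∀ c, a μ (Y.B (V' t)) (Y.B c) = a μ (dt T u t) (Y.B c)) →
      ∀ y : ℝ → (Fin X.n → ℝ) × (Fin Y.n → ℝ), y 0 = (Z 0, V 0) → ∀ t ∈ Icc 0 T,
      (∀ s ∈ Icc 0 t, HasDerivWithinAt y (F (y s)) (Icc 0 T) s) →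
      a 0 (X.B (Z t - (y t).1)) (X.B (Z t - (y t).1))
        + a μ (Y.B (V t - (y t).2)) (Y.B (V t - (y t).2)) ≤ K * (M.h ^ (r - 1)) ^ 2 := by
  obtain ⟨Q, hQ, HQ⟩ := exists_energy_rate hr hk hε hμ γ hb hsol hsm
  set K := Real.exp (Q * T) with hK
  have hK0 : 0 < K := Real.exp_pos _
  -- For such `h`, `K * H ^ 2 ≤ K * h ^ 2 < h`: the Grönwall bound is strictly better than the
  -- assumption `G ≤ h` under which it is derived.
  refine ⟨min 1 (1 / (2 * K)), by positivity, K, hK0.le, min_le_left _ _,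
    fun M hM hh X Y F hF Z Z' V V' hZ hV y hy0 t ht hy => ?_⟩
  have hpos := M.h_pos
  have hh1 : M.h ≤ 1 := hh.trans (min_le_left _ _)
  have hhK : M.h * (2 * K) ≤ 1 := (le_div_iff₀ (by positivity)).1 (hh.trans (min_le_right _ _))
  set H := M.h ^ (r - 1) with hH
  have hHh : H ≤ M.h := by
    calc H ≤ M.h ^ 1 := pow_le_pow_of_le_one hpos.le hh1 (by omega)
      _ = M.h := pow_one _
  have hH0 : 0 ≤ H := by positivity
  have hsmall : K * H ^ 2 < M.h := by
    have : K * H ^ 2 ≤ K * M.h ^ 2 := by gcongr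
    nlinarith
  let G : ℝ → ℝ := fun s => a 0 (X.B (Z s - (y s).1)) (X.B (Z s - (y s).1))
        + a μ (Y.B (V s - (y s).2)) (Y.B (V s - (y s).2))
  let G' : ℝ → ℝ := fun s => 2 * a 0 (X.B (Z' s - (F (y s)).1)) (X.B (Z s - (y s).1))
        + 2 * a μ (Y.B (V' s - (F (y s)).2)) (Y.B (V s - (y s).2))
  have hsub : Icc 0 t ⊆ Icc 0 T := Icc_subset_Icc_right ht.2
  have hG : ∀ s ∈ Icc 0 t, HasDerivWithinAt G (G' s) (Icc 0 t) s := fun s hs => by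
    have d1 := (ContinuousLinearMap.fst ℝ (Fin X.n → ℝ) (Fin Y.n → ℝ)).hasFDerivAt
      |>.comp_hasDerivWithinAt s (hy s hs)
    have d2 := (ContinuousLinearMap.snd ℝ (Fin X.n → ℝ) (Fin Y.n → ℝ)).hasFDerivAt
      |>.comp_hasDerivWithinAt s (hy s hs)
    exact ((X.hasDerivWithinAt_a_self X.lip_Sh ((hZ s (hsub hs)).1.sub d1)).add
      (Y.hasDerivWithinAt_a_self Y.lip_Sh0 ((hV s (hsub hs)).1.sub d2))).mono hsub
  have hG0 : G 0 = 0 := by simp [G, hy0, a, ip, dx]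
  have hG'le : ∀ s ∈ Icc 0 t, G s ≤ M.h → G' s ≤ Q * G s + Q * H ^ 2 := fun s hs hle => by
    have hs' := hsub hs
    obtain ⟨-, z1, z2⟩ := hZ s hs'
    obtain ⟨-, v1, v2⟩ := hV s hs'
    obtain ⟨f1, f2⟩ := hF (y s)
    have n1 := a_self_nonneg le_rfl (X.B (Z s - (y s).1))
    have key := HQ M hM hh1 s hs' _ _ _ _ (isL2Proj_of_coords X z1) (isEllProj_of_coords Y v1)
      (X.mem (y s).1) (Y.mem (y s).2)
    rw [← X.B_sub, ← Y.B_sub] at key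
    have key := key (by simp only [G] at hle; linarith)
    have m := Y.mem (V s - (y s).2)
    have g1 := f1 _ (X.mem (Z s - (y s).1))
    have g2 := f2 _ m
    have w1 := (z2 (Z s - (y s).1)).trans (hsol.ip_mass hs' _)
    have w2 := (v2 (V s - (y s).2)).trans (hsol.a_momentum hsm hr hs' m.1.lip m.2.1 m.2.2)
    -- Testing with `θ` and `ξ` themselves, the time derivatives of the projections are replaced
    -- through the exact equations and those of the discrete solution through the scheme; twice the
    -- left side of the energy inequality remains.
    simp only [G, G']
    rw [X.a_B_sub_left X.lip_Sh, Y.a_B_sub_left Y.lip_Sh0, w1, w2, a_zero, a_zero]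
    linarith
  have step : ∀ s ∈ Icc 0 t, (∀ s' ∈ Icc 0 s, G s' ≤ M.h) → G s ≤ K * H ^ 2 := fun s hs hle => by
    have hsub' : Icc 0 s ⊆ Icc 0 t := Icc_subset_Icc_right hs.2
    refine (gronwall (δ := Q * H ^ 2) hQ (by positivity) (fun x hx => (hG x (hsub' hx)).mono hsub')
      hG0 (fun x hx => hG'le x (hsub' hx) (hle x hx)) hs.1).trans ?_
    rw [mul_div_cancel_left₀ _ hQ.ne', mul_comm]
    have : Q * s ≤ Q * T := mul_le_mul_of_nonneg_left (hs.2.trans ht.2) hQ.le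
    gcongr
    exact Real.exp_le_exp.2 this
  exact barrier (fun s hs => (hG s hs).continuousWithinAt) hsmall (by rw [hG0]; positivity) step
    t ⟨ht.1, le_rfl⟩

end main

theorem normH1_eq (f : ℝ → ℝ) : normH1 f = Real.sqrt (a 3 f f) := by
  rw [normH1, a]
  congr 2
  ring

theorem normL2_eq (f : ℝ → ℝ) : normL2 f = Real.sqrt (a 0 f f) := by rw [a_zero, normL2]

theorem a_three_self_le {μ : ℝ} (hμ : 0 < μ) (f : ℝ → ℝ) : a 3 f f ≤ (1 + 3 / μ) * a μ f f := by
  have h1 := ip_self_le_a hμ.le f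
  have h2 := ip_dx_self_le_a hμ f
  rw [a]
  linarith

theorem norm_le_of_quadratic {n : ℕ} {q : (Fin n → ℝ) → ℝ} {m E : ℝ} (hm : 0 < m)
    (h : ∀ c, m * ‖c‖ ^ 2 ≤ q c) {c d : Fin n → ℝ} (hq : q (c - d) ≤ E) :
    ‖d‖ ≤ ‖c‖ + (1 + E / m) := by
  have h1 : ‖c - d‖ ^ 2 ≤ E / m := by
    rw [le_div_iff₀ hm, mul_comm]
    exact (h _).trans hq
  have h2 : ‖d‖ ≤ ‖c‖ + ‖c - d‖ := by
    rw [norm_sub_rev]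
    exact norm_le_norm_add_norm_sub' d c
  nlinarith [sq_nonneg (‖c - d‖ - 1)]

end CBw

/-! ### Existence, uniqueness and the error estimate. -/

theorem theorem2p2
    (r k : ℕ) (hr : 2 ≤ r) (hk : k ≤ r - 2) (γ : ℝ)
    (ε μ β T : ℝ) (hε : 0 < ε) (hμ : 0 < μ) (hβ : 0 < β) (hT : 0 < T)
    (b : ℝ → ℝ) (hb : ContDiffOn ℝ 2 b (Icc 0 1))
    (hηb : ∀ x ∈ Icc (0 : ℝ) 1, 0 < CBw.etab β b x)
    (ζ₀ u₀ : ℝ → ℝ) (ζ u : ℝ → ℝ → ℝ)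
    (hsol : CBw.IsSolution ε μ β b T ζ₀ u₀ ζ u)
    (hsmooth : CBw.IsSmooth r T ζ u) :
    ∃ h₀ > 0, ∃ C : ℝ, ∀ M : CBw.Mesh, M.Quasiuniform γ → M.h ≤ h₀ →
      ∃ ζh uh : ℝ → ℝ → ℝ,
        CBw.IsSemidiscrete ε μ β b T ζ₀ u₀ r k M ζh uh ∧
        (∀ ζh' uh' : ℝ → ℝ → ℝ, CBw.IsSemidiscrete ε μ β b T ζ₀ u₀ r k M ζh' uh' →
          ∀ t ∈ Icc 0 T, ∀ x ∈ Icc (0 : ℝ) 1, ζh' t x = ζh t x ∧ uh' t x = uh t x) ∧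
        ∃ E : ℝ, IsGreatest
            ((fun t => CBw.normL2 (fun x => ζ t x - ζh t x)
              + CBw.normH1 (fun x => u t x - uh t x)) '' Icc 0 T) E ∧
          E ≤ C * M.h ^ (r - 1) := by
  
  obtain ⟨D, hD, HD⟩ := CBw.exists_projection_error hr hk hμ hsol hsmooth
  obtain ⟨h₀, hh₀, K, hK, hh₀1, HK⟩ := CBw.exists_energy_bound hr hk hε hμ γ hb hsol hsmooth
  -- `D` comes from the projection errors and `K` from the bootstrap; `1 + 3 / μ` compares the `H¹`
  -- norm with `a`.
  refine ⟨h₀, hh₀, √(D + K) + √((1 + 3 / μ) * (D + K)), fun M hM hh => ?_⟩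
  have hpos := M.h_pos
  have hζ : ∀ t ∈ Icc 0 T, CBw.Lip (ζ t) := fun t ht => hsmooth.zeta_space.lip (by omega) ht
  have hu : ∀ t ∈ Icc 0 T, CBw.Lip (u t) := fun t ht => hsmooth.u_space.lip (by omega) ht
  obtain ⟨X⟩ := CBw.exists_coords_Sh r k (by omega) M
  obtain ⟨Y⟩ := CBw.exists_coords_Sh0 r k (by omega) M
  have hX := X.lip_Sh
  have hY := Y.lip_Sh0
  obtain ⟨F, hFs, hF⟩ := CBw.exists_field X Y ε hμ (CBw.lip_etab (β := β) hb)
  obtain ⟨Z, Z', hZ⟩ := X.exists_riesz_path (ν := 0) le_rfl hX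
    (Φ := fun t c => CBw.ip (ζ t) (X.B c)) (Φ' := fun t c => CBw.ip (CBw.dt T ζ t) (X.B c))
    (fun t ht => X.isLinearMap_ip hX (hζ t ht).bm)
    (fun t ht => X.isLinearMap_ip hX
      (CBw.ContinuousOn.bm (hsmooth.zeta_time.slice_continuousOn ht)))
    (fun c t ht => hsmooth.hasDerivWithinAt_ip_zeta (hX c).bm ht)
  obtain ⟨V, V', hV⟩ := Y.exists_riesz_path (ν := μ) hμ.le hY
    (Φ := fun t c => CBw.a μ (u t) (Y.B c)) (Φ' := fun t c => CBw.a μ (CBw.dt T u t) (Y.B c))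
    (fun t ht => Y.isLinearMap_a hY (hu t ht))
    (fun t ht => Y.isLinearMap_a hY (hsmooth.u_time.lip one_le_two ht))
    (fun c t ht => hsmooth.hasDerivWithinAt_a_u hr (hY c) μ ht)
  have hPZ : ∀ t ∈ Icc 0 T, CBw.IsL2Proj r k M (ζ t) (X.B (Z t)) := fun t ht =>
    CBw.isL2Proj_of_coords X (hZ t ht).2.1
  have hPV : ∀ t ∈ Icc 0 T, CBw.IsEllProj μ r k M (u t) (Y.B (V t)) := fun t ht =>
    CBw.isEllProj_of_coords Y (hV t ht).2.1
  have apriori := HK M hM hh X Y F hF Z Z' V V' hZ hV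
  have h0mem : (0 : ℝ) ∈ Icc 0 T := ⟨le_rfl, hT.le⟩
  obtain ⟨RZ, hRZ⟩ := isCompact_Icc.exists_bound_of_continuousOn (f := Z) (s := Icc 0 T)
    fun t ht => (hZ t ht).1.continuousWithinAt
  obtain ⟨RV, hRV⟩ := isCompact_Icc.exists_bound_of_continuousOn (f := V) (s := Icc 0 T)
    fun t ht => (hV t ht).1.continuousWithinAt
  obtain ⟨m₁, hm₁, Hm₁⟩ := X.exists_norm_bound (ν := 0) le_rfl hX
  obtain ⟨m₂, hm₂, Hm₂⟩ := Y.exists_norm_bound (ν := μ) hμ.le hY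
  set H := M.h ^ (r - 1) with hH
  -- The radius is a bound for the coordinates of the projections plus the deviation allowed by the
  -- energy bound.
  obtain ⟨y, hy0, hy⟩ := CBw.exists_global_of_apriori hFs (y₀ := (Z 0, V 0)) (T := T)
    (R := max (RZ + (1 + K * H ^ 2 / m₁)) (RV + (1 + K * H ^ 2 / m₂))) hT.le
    (max_le_max ((hRZ 0 h0mem).trans (le_add_of_nonneg_right (by positivity)))
      ((hRV 0 h0mem).trans (le_add_of_nonneg_right (by positivity))))
    fun y hy0 t ht hy => by
      have h1 := apriori y hy0 t ht hy
      have n1 := CBw.a_self_nonneg le_rfl (X.B (Z t - (y t).1))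
      have n2 := CBw.a_self_nonneg hμ.le (Y.B (V t - (y t).2))
      have h2 : CBw.a 0 (X.B (Z t - (y t).1)) (X.B (Z t - (y t).1)) ≤ K * H ^ 2 := by linarith
      have h3 : CBw.a μ (Y.B (V t - (y t).2)) (Y.B (V t - (y t).2)) ≤ K * H ^ 2 := by linarith
      exact max_le_max
        ((CBw.norm_le_of_quadratic hm₁ Hm₁ h2).trans (add_le_add (hRZ t ht) le_rfl))
        ((CBw.norm_le_of_quadratic hm₂ Hm₂ h3).trans (add_le_add (hRV t ht) le_rfl))
  have hyc : ContinuousOn y (Icc 0 T) := fun t ht => (hy t ht).continuousWithinAt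
  refine ⟨fun t => X.B (y t).1, fun t => Y.B (y t).2,
    CBw.isSemidiscrete_of_ode X Y hF hT hy ?_ ?_, fun ζh uh h t ht x hx => ?_, ?_⟩
  · rw [hy0]
    exact (hPZ 0 h0mem).congr hsol.zeta_init
  · rw [hy0]
    exact (hPV 0 h0mem).congr hsol.u_init
  -- Discrete projections are unique, so any other solution has the same initial coordinates, and
  -- its coordinates solve the same equation.
  · have h1 : X.coord (ζh 0) = Z 0 := X.eq_of_a (ν := 0) le_rfl hX fun d => by
      rw [CBw.a_congr 0 (X.B_coord (h.zeta_mem 0 h0mem)) fun _ _ => rfl, CBw.a_zero, CBw.a_zero,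
        h.zeta_init.2 _ (X.mem d), ((hPZ 0 h0mem).congr hsol.zeta_init).2 _ (X.mem d)]
    have h2 : Y.coord (uh 0) = V 0 := Y.eq_of_a hμ.le hY fun d => by
      rw [CBw.a_congr μ (Y.B_coord (h.u_mem 0 h0mem)) fun _ _ => rfl,
        h.u_init.2 _ (Y.mem d), ((hPV 0 h0mem).congr hsol.u_init).2 _ (Y.mem d)]
    have h3 := CBw.ode_unique hFs (by rw [hy0, h1, h2]) (h.ode X Y hμ hF hT) hy ht
    beta_reduce
    rw [show y t = (X.coord (ζh t), Y.coord (uh t)) from h3.symm]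
    exact ⟨(X.B_coord (h.zeta_mem t ht) hx).symm, (Y.B_coord (h.u_mem t ht) hx).symm⟩
  · have hc : ContinuousOn (fun t => CBw.normL2 (fun x => ζ t x - X.B (y t).1 x)
        + CBw.normH1 (fun x => u t x - Y.B (y t).2 x)) (Icc 0 T) := by
      simp only [CBw.normL2_eq, CBw.normH1_eq]
      refine ContinuousOn.add (ContinuousOn.sqrt ?_) (ContinuousOn.sqrt ?_)
      · refine X.continuousOn_a_sub hX hζ ?_ (fun c => ?_) (continuous_fst.comp_continuousOn hyc)
        · simp only [CBw.a_zero]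
          exact CBw.continuousOn_ip_self hT.le hsmooth.zeta_space.continuousOn
        · simp only [CBw.a_zero]
          exact fun t ht =>
            (hsmooth.hasDerivWithinAt_ip_zeta (hX c).bm ht).continuousWithinAt
      · exact Y.continuousOn_a_sub hY hu (hsmooth.continuousOn_a_u_self hr hT.le 3)
          (fun c t ht => (hsmooth.hasDerivWithinAt_a_u hr (hY c) 3 ht).continuousWithinAt)
          (continuous_snd.comp_continuousOn hyc)
    obtain ⟨t, ht, hmax⟩ := isCompact_Icc.exists_isMaxOn ⟨0, h0mem⟩ hc
    refine ⟨_, ⟨mem_image_of_mem _ ht, ?_⟩, ?_⟩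
    · rintro _ ⟨s, hs, rfl⟩
      exact hmax hs
    · have e := apriori y hy0 t ht fun s hs => hy s ⟨hs.1, hs.2.trans ht.2⟩
      obtain ⟨p1, p2⟩ := HD M t ht _ _ (hPZ t ht) (hPV t ht)
      -- Orthogonality adds the squared projection error and the squared discrete error exactly.
      have q1 := CBw.a_pythagoras (ν := 0) (hζ t ht) (hX (Z t)) (hX (y t).1)
        (by rw [CBw.a_zero, CBw.a_zero]; exact (hPZ t ht).2 _ (X.mem _))
        (by rw [CBw.a_zero, CBw.a_zero]; exact (hPZ t ht).2 _ (X.mem _))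
      have q2 := CBw.a_pythagoras (ν := μ) (hu t ht) (hY (V t)) (hY (y t).2)
        ((hPV t ht).2 _ (Y.mem _)) ((hPV t ht).2 _ (Y.mem _))
      rw [← CBw.a_zero] at p1
      rw [← X.B_sub] at q1
      rw [← Y.B_sub] at q2
      have n1 := CBw.a_self_nonneg le_rfl (X.B (Z t - (y t).1))
      have n2 := CBw.a_self_nonneg hμ.le (Y.B (V t - (y t).2))
      have p3 : D * (M.h ^ r) ^ 2 ≤ D * H ^ 2 := by
        have := pow_le_pow_of_le_one hpos.le (hh.trans hh₀1) (show r - 1 ≤ r by omega)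
        gcongr
      have hH0 : 0 ≤ H := by positivity
      have s1 : ∀ {A B : ℝ}, A ≤ B * H ^ 2 → √A ≤ √B * H := fun {A B} hAB => by
        have := Real.sqrt_le_sqrt hAB
        rwa [Real.sqrt_mul' _ (sq_nonneg H), Real.sqrt_sq hH0] at this
      simp only
      rw [CBw.normL2_eq, CBw.normH1_eq, add_mul]
      refine add_le_add (s1 (by linarith)) (s1 ((CBw.a_three_self_le hμ _).trans ?_))
      rw [mul_assoc]
      gcongr
      linarith
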